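/- Let $\mathfrak P=(P_{n})_{n\ge 0}$ be a subfactor planar algebra: a shaded planar algebra over $\mathbb C$ (vector spaces $P_{n,\pm}$, indexed by discs with $2n$ boundary points and by the shading at the distinguished boundary interval, on which the planar tangles act multilinearly, depending only on the isotopy class of the tangle and compatibly with gluing), with conjugate-linear involutions $x\mapsto x^*$ on the $P_{n,\pm}$ intertwining the action of each tangle with that of its mirror image, finite dimensional, with $\dim P_{0,\pm}=1$, spherical, and with positive definite form $\langle x,y\rangle$ (all points of $x$ and $y^*$ joined in pairs). Fix the shading of the distinguished intervals and write $P_n$ for the corresponding $P_{n,\pm}$. For $k\ge 0$ let $Gr_k(\mathfrak P)=\bigoplus_{n\ge 0}P_{n,k}$, where $P_{n,k}=P_{n+k}$. An element of $P_{n,k}$ is drawn as a box whose distinguished interval is at the top left, with $2n$ strings on the top, $k$ strings on the left side, $k$ strings on the right side and none on the bottom. For $a\in P_{m,k}$ and $b\in P_{n,k}$ put $$a\star b=\sum_{i=0}^{\min(2m,2n)}(a\star b)_i ,\qquad (a\star b)_i\in P_{m+n-i,k},$$ where $(a\star b)_i$ is given by the tangle with $a$ to the left of $b$ in which the last $i$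 strings on the top of $a$ are joined by $i$ parallel (nested) strings to the first $i$ strings on the top of $b$, the remaining $2m-i$ and $2n-i$ top strings go, in order, to the top of the outer box, the $k$ strings on the right of $a$ are joined to the $k$ strings on the left of $b$, and the $k$ strings on the left of $a$ and on the right of $b$ go to the left and right side of the outer box. Extend $\star$ bilinearly to $Gr_k(\mathfrak P)$. Let $x\mapsto x^\dagger$ be the involution on $Gr_k(\mathfrak P)$ which comes from that of the planar algebra by reflecting pictures in a vertical line: for $x\in P_{n,k}$, $x^\dagger\in P_{n,k}$ is the box labelled $x^*$ whose distinguished interval (which the reflection moves to the top right) is moved back to the top left, i.e. $x^*$ with its boundary points rotated by $2n$ steps; for $n=0$ or $k=0$ simply $x^\dagger=x^*$. Then $(Gr_k(\mathfrak P),\star,{}^\dagger)$ is an associative $*$-algebra: for all $a,b,c\in Gr_k(\mathfrak P)$ and $z\in\mathbb C$, $$(a\star b)\star c=a\star(b\star c),\quad 1\star a=a=a\star 1,\quad (a+b)^\dagger=a^\dagger+b^\dagger,\quad (za)^\dagger=\bar z\,a^\dagger,\quad (a^\dagger)^\dagger=a,\quad (a\star b)^\dagger=b^\dagger\star a^\dagger,$$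 where $1\in P_{0,k}=P_k$ is the element given by $k$ parallel horizontal strings. -/

import Mathlib

open scoped DirectSum ComplexConjugate

/-- The type of a disc: it has `2 * half` marked boundary points, and `shaded` tells whether its
distinguished boundary interval lies in a shaded region.

On every disc, inner or outer, the marked points are numbered `0, 1, ..., 2 * half - 1` clockwise,
starting from the distinguished interval.  The boundary intervals are numbered `0, ..., 2 * half`:
interval `j` comes just before point `j`, interval `j + 1` just after it, and the intervals `0` and
`2 * half` are one and the same, namely the distinguished interval. -/
structure DiscType where
  half : ℕ
  shaded : Bool

namespace PlanarTangle

/-- The shading at the boundary interval `j` of a disc (`true` means shaded). -/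
def colour (b : DiscType) (j : ℕ) : Bool := b.shaded ^^ decide (j % 2 = 1)

/-- The discs of a tangle: `none` is the outer disc, `some i` are the inner discs. -/
abbrev disc {I : Type} (inn : I → DiscType) (out : DiscType) : Option I → DiscType
  | none => out
  | some i => inn i

/-- All marked points of a tangle. -/
abbrev Pt {I : Type} (inn : I → DiscType) (out : DiscType) : Type :=
  Σ d : Option I, Fin (2 * (disc inn out d).half)

/-- All boundary intervals of a tangle (with `0` and the last one of each disc not yet
identified). -/
abbrev Iv {I : Type} (inn : I → DiscType) (out : DiscType) : Type :=
  Σ d : Option I, Fin (2 * (disc inn out d).half + 1)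

section Boundary

variable {I : Type} {inn : I → DiscType} {out : DiscType}

/-- The shading at a boundary interval. -/
def ivColour (v : Iv inn out) : Bool := colour (disc inn out v.1) v.2

/-- The interval just before a marked point, in clockwise order on the circle of the point. -/
def before (p : Pt inn out) : Iv inn out := ⟨p.1, p.2.castSucc⟩

/-- The interval just after a marked point, in clockwise order on the circle of the point. -/
def after (p : Pt inn out) : Iv inn out := ⟨p.1, p.2.succ⟩

/-- The interval next to the marked point `p` which has shading `c`. -/
def nb (p : Pt inn out) (c : Bool) : Iv inn out :=
  if ivColour (before p) = c then before p else after p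

/-- Orient all strings so that the shaded side is on the left.  `isSource p` says that the string
at `p` starts at `p`; otherwise it ends at `p`.  Strings leave an inner disc outwards, so that the
interval before `p` is on the left of a string leaving `p`; they leave the outer disc inwards, so
that the interval before `p` is on the right. -/
def isSource (p : Pt inn out) : Bool := ivColour (before p) ^^ p.1.isNone

end Boundary

/-- A shaded planar tangle with inner discs of types `inn i` and outer disc of type `out`, up to
isotopy, recorded through its finite sets of strings (arcs and closed loops) and of regions and
through their incidences.

* `side s c` is the region adjoining the string `s` on its side of shading `c`.
* `str p` is the string which ends at the marked point `p`, and `reg v` is the region which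
  touches the boundary interval `v`.
* `str_inj`, `str_pair`: if a string has an end at all, it has exactly two, a source and a target;
  the strings without ends are the closed loops.
* `connected`, `acyclic` express planarity.  Collapse the discs (the outer one included) to
  vertices; the strings become the edges of a graph drawn on the closed oriented surface which the
  regions (planar surfaces) form with it.  This surface has to be a sphere, i.e. to be connected
  with vanishing first homology.  So `connected` says that any two regions are joined by a path
  that crosses strings (equivalently, a function on regions without a jump across any string is
  constant), and `acyclic` that every integral `1`-cycle on the graph is the boundary of a
  `2`-chain: it is the jump across the strings of an integral function on the set of regions.
  (The cycle condition at the outer disc follows from those at the inner discs.) -/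
structure Tangle {I : Type} (inn : I → DiscType) (out : DiscType) : Type 1 where
  Str : Type
  Reg : Type
  finite_disc : Finite I
  finite_str : Finite Str
  finite_reg : Finite Reg
  side : Str → Bool → Reg
  shade : Reg → Bool
  shade_side : ∀ s c, shade (side s c) = c
  str : Pt inn out → Str
  reg : Iv inn out → Reg
  shade_reg : ∀ v, shade (reg v) = ivColour v
  reg_last : ∀ d, reg ⟨d, 0⟩ = reg ⟨d, Fin.last _⟩
  side_before : ∀ p, side (str p) (ivColour (before p)) = reg (before p)
  side_after : ∀ p, side (str p) (ivColour (after p)) = reg (after p)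
  str_inj : ∀ p q, str p = str q → isSource p = isSource q → p = q
  str_pair : ∀ p, ∃ q, str q = str p ∧ isSource q ≠ isSource p
  connected : ∀ h : Reg → ℤ, (∀ s, h (side s true) = h (side s false)) → ∀ r r', h r = h r'
  acyclic : ∀ w : Str → ℤ,
    (∀ i : I, ∑ j : Fin (2 * (disc inn out (some i)).half),
      (if isSource (⟨some i, j⟩ : Pt inn out) then w (str ⟨some i, j⟩)
        else - w (str ⟨some i, j⟩)) = 0) →
    ∃ h : Reg → ℤ, ∀ s, h (side s true) - h (side s false) = w s

section Lemmas

variable {I : Type} {inn : I → DiscType} {out : DiscType}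

theorem colour_succ (b : DiscType) (j : ℕ) : colour b (j + 1) = !colour b j := by
  unfold colour
  rcases Nat.mod_two_eq_zero_or_one j with h | h
  · have : (j + 1) % 2 = 1 := by omega
    simp [h, this]
  · have : (j + 1) % 2 = 0 := by omega
    simp [h, this]

theorem ivColour_after (p : Pt inn out) : ivColour (after p) = !ivColour (before p) := by
  simp [ivColour, after, before, colour_succ]

theorem ivColour_nb (p : Pt inn out) (c : Bool) : ivColour (nb p c) = c := by
  unfold nb
  split_ifs with h
  · exact h
  · rw [ivColour_after]
    cases hb : ivColour (before p) <;> cases c <;> simp_all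

theorem nb_before (p : Pt inn out) : nb p (ivColour (before p)) = before p := by simp [nb]

theorem nb_after (p : Pt inn out) : nb p (ivColour (after p)) = after p := by
  rw [ivColour_after]; simp [nb]

theorem Tangle.side_nb (T : Tangle inn out) (p : Pt inn out) (c : Bool) :
    T.side (T.str p) c = T.reg (nb p c) := by
  unfold nb
  split_ifs with h
  · rw [← h, T.side_before]
  · rw [← T.side_after, ivColour_after]
    cases hb : ivColour (before p) <;> cases c <;> simp_all

end Lemmas

/-! ### Isomorphic tangles, relabelling, reflection -/

section Operations

variable {I : Type} {inn : I → DiscType} {out : DiscType}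

/-- Two tangles with the same discs are isotopic (up to moving the inner discs along) if their
strings and regions correspond to each other with all incidences. -/
structure Tangle.Iso (T T' : Tangle inn out) where
  strEquiv : T.Str ≃ T'.Str
  regEquiv : T.Reg ≃ T'.Reg
  map_side : ∀ s c, regEquiv (T.side s c) = T'.side (strEquiv s) c
  map_str : ∀ p, strEquiv (T.str p) = T'.str p
  map_reg : ∀ v, regEquiv (T.reg v) = T'.reg v

/-- The marked points of a tangle with renamed inner discs. -/
def relabelPt {J : Type} (e : J ≃ I) : Pt (fun j => inn (e j)) out → Pt inn out
  | ⟨none, j⟩ => ⟨none, j⟩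
  | ⟨some i, j⟩ => ⟨some (e i), j⟩

/-- The boundary intervals of a tangle with renamed inner discs. -/
def relabelIv {J : Type} (e : J ≃ I) : Iv (fun j => inn (e j)) out → Iv inn out
  | ⟨none, j⟩ => ⟨none, j⟩
  | ⟨some i, j⟩ => ⟨some (e i), j⟩

/-- Renaming the inner discs of a tangle along a bijection. -/
def Tangle.relabel {J : Type} (T : Tangle inn out) (e : J ≃ I) :
    Tangle (fun j => inn (e j)) out where
  Str := T.Str
  Reg := T.Reg
  finite_disc := by
    have := T.finite_disc
    exact Finite.of_equiv I e.symm
  finite_str := T.finite_str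
  finite_reg := T.finite_reg
  side := T.side
  shade := T.shade
  shade_side := T.shade_side
  str p := T.str (relabelPt e p)
  reg v := T.reg (relabelIv e v)
  shade_reg := by
    rintro ⟨_ | i, j⟩
    · exact T.shade_reg ⟨none, j⟩
    · exact T.shade_reg ⟨some (e i), j⟩
  reg_last := by
    rintro (_ | i)
    · exact T.reg_last none
    · exact T.reg_last (some (e i))
  side_before := by
    rintro ⟨_ | i, j⟩
    · exact T.side_before ⟨none, j⟩
    · exact T.side_before ⟨some (e i), j⟩
  side_after := by
    rintro ⟨_ | i, j⟩
    · exact T.side_after ⟨none, j⟩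
    · exact T.side_after ⟨some (e i), j⟩
  str_inj := by
    rintro ⟨_ | i, j⟩ ⟨_ | i', j'⟩ h h'
    · have := T.str_inj ⟨none, j⟩ ⟨none, j'⟩ h h'
      cases this; rfl
    · have := T.str_inj ⟨none, j⟩ ⟨some (e i'), j'⟩ h h'
      cases this
    · have := T.str_inj ⟨some (e i), j⟩ ⟨none, j'⟩ h h'
      cases this
    · have := T.str_inj ⟨some (e i), j⟩ ⟨some (e i'), j'⟩ h h'
      have h1 : i = i' := e.injective (Option.some.inj (congrArg Sigma.fst this))
      subst h1
      have h2 : j = j' := eq_of_heq (Sigma.mk.inj this).2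
      rw [h2]
  str_pair := by
    rintro ⟨_ | i, j⟩
    · obtain ⟨⟨_ | i', j'⟩, h1, h2⟩ := T.str_pair ⟨none, j⟩
      · exact ⟨⟨none, j'⟩, h1, h2⟩
      · obtain ⟨i', rfl⟩ := e.surjective i'
        exact ⟨⟨some i', j'⟩, h1, h2⟩
    · obtain ⟨⟨_ | i', j'⟩, h1, h2⟩ := T.str_pair ⟨some (e i), j⟩
      · exact ⟨⟨none, j'⟩, h1, h2⟩
      · obtain ⟨i', rfl⟩ := e.surjective i'
        exact ⟨⟨some i', j'⟩, h1, h2⟩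
  connected := T.connected
  acyclic := by
    intro w hw
    refine T.acyclic w fun i => ?_
    obtain ⟨i, rfl⟩ := e.surjective i
    exact hw i

theorem rev_before (b : ℕ) (j : Fin b) : (Fin.rev j).castSucc = Fin.rev j.succ := by
  ext; simp [Fin.val_rev]

theorem rev_after (b : ℕ) (j : Fin b) : (Fin.rev j).succ = Fin.rev j.castSucc := by
  ext; simp [Fin.val_rev]; omega

/-- The marked point which `p` becomes when the order of the points is reversed on each disc. -/
def revPt (p : Pt inn out) : Pt inn out := ⟨p.1, p.2.rev⟩

/-- The interval which `v` becomes when the order of the intervals is reversed on each disc. -/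
def revIv (v : Iv inn out) : Iv inn out := ⟨v.1, v.2.rev⟩

theorem before_revPt (p : Pt inn out) : before (revPt p) = revIv (after p) := by
  simp [before, revPt, revIv, after, rev_before]

theorem after_revPt (p : Pt inn out) : after (revPt p) = revIv (before p) := by
  simp [before, revPt, revIv, after, rev_after]

theorem revPt_revPt (p : Pt inn out) : revPt (revPt p) = p := by simp [revPt]

theorem ivColour_revIv (v : Iv inn out) : ivColour (revIv v) = ivColour v := by
  obtain ⟨d, j⟩ := v
  have : (2 * (disc inn out d).half + 1 - (j.1 + 1)) % 2 = j.1 % 2 := by omega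
  simp only [ivColour, revIv, colour, Fin.val_rev, this]

theorem isSource_revPt (p : Pt inn out) : isSource (revPt p) = !isSource p := by
  simp only [isSource, before_revPt, ivColour_revIv, ivColour_after]
  simp [revPt]

/-- The mirror image of a tangle under an orientation reversing map which preserves the
distinguished intervals and the shading. -/
def Tangle.reflect (T : Tangle inn out) : Tangle inn out where
  Str := T.Str
  Reg := T.Reg
  finite_disc := T.finite_disc
  finite_str := T.finite_str
  finite_reg := T.finite_reg
  side := T.side
  shade := T.shade
  shade_side := T.shade_side
  str p := T.str (revPt p)
  reg v := T.reg (revIv v)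
  shade_reg v := by rw [T.shade_reg, ivColour_revIv]
  reg_last d := by
    have := T.reg_last d
    simp [revIv, this]
  side_before p := by
    have := T.side_after (revPt p)
    rwa [after_revPt, ivColour_revIv] at this
  side_after p := by
    have := T.side_before (revPt p)
    rwa [before_revPt, ivColour_revIv] at this
  str_inj p q h h' := by
    have := T.str_inj _ _ h (by simp [isSource_revPt, h'])
    rw [← revPt_revPt p, this, revPt_revPt]
  str_pair p := by
    obtain ⟨q, h1, h2⟩ := T.str_pair (revPt p)
    refine ⟨revPt q, by rw [revPt_revPt, h1], ?_⟩
    rw [isSource_revPt] at h2 ⊢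
    intro h3
    apply h2
    rw [← h3, Bool.not_not]
  connected := T.connected
  acyclic w hw := by
    refine T.acyclic w fun i => ?_
    have h := hw i
    rw [← Equiv.sum_comp Fin.revPerm, ← neg_eq_zero, ← Finset.sum_neg_distrib]
    rw [← h]
    refine Finset.sum_congr rfl fun j _ => ?_
    have h2 := isSource_revPt (⟨some i, j⟩ : Pt inn out)
    simp only [revPt] at h2 ⊢
    simp only [Fin.revPerm_apply, h2]
    cases isSource (⟨some i, j⟩ : Pt inn out) <;> simp

/-- If the outer disc has no marked points, it can be moved on the sphere to any region `r`. -/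
def Tangle.moveOuter {ε : Bool} (T : Tangle inn ⟨0, ε⟩) (r : T.Reg) :
    Tangle inn ⟨0, T.shade r⟩ where
  Str := T.Str
  Reg := T.Reg
  finite_disc := T.finite_disc
  finite_str := T.finite_str
  finite_reg := T.finite_reg
  side := T.side
  shade := T.shade
  shade_side := T.shade_side
  str
    | ⟨none, j⟩ => j.elim0
    | ⟨some i, j⟩ => T.str ⟨some i, j⟩
  reg
    | ⟨none, _⟩ => r
    | ⟨some i, j⟩ => T.reg ⟨some i, j⟩
  shade_reg := by
    rintro ⟨_ | i, j⟩
    · simp [ivColour, colour]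
    · exact T.shade_reg ⟨some i, j⟩
  reg_last := by
    rintro (_ | i)
    · rfl
    · exact T.reg_last (some i)
  side_before := by
    rintro ⟨_ | i, j⟩
    · exact j.elim0
    · exact T.side_before ⟨some i, j⟩
  side_after := by
    rintro ⟨_ | i, j⟩
    · exact j.elim0
    · exact T.side_after ⟨some i, j⟩
  str_inj := by
    rintro ⟨_ | i, j⟩ ⟨_ | i', j'⟩ h h'
    · exact j.elim0
    · exact j.elim0
    · exact j'.elim0
    · have := T.str_inj ⟨some i, j⟩ ⟨some i', j'⟩ h h'
      cases this; rfl
  str_pair := by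
    rintro ⟨_ | i, j⟩
    · exact j.elim0
    · obtain ⟨⟨_ | i', j'⟩, h1, h2⟩ := T.str_pair ⟨some i, j⟩
      · exact j'.elim0
      · exact ⟨⟨some i', j'⟩, h1, h2⟩
  connected := T.connected
  acyclic := T.acyclic

end Operations

/-! ### Gluing tangles into the inner discs of a tangle -/

section Chains

open Relation

variable {X E : Type} {piece : E → X} {src : E → Bool} {g : E → E → Prop}

/-- One step along a chain of pieces that are glued at their ends. -/
def ChainStep (piece : E → X) (src : E → Bool) (g : E → E → Prop) (c : Bool) (x y : X) : Prop :=
  ∃ e e', g e e' ∧ piece e = x ∧ piece e' = y ∧ src e = !c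

theorem chain_total (inj : ∀ e e', piece e = piece e' → src e = src e' → e = e')
    (symm : ∀ e e', g e e' → g e' e) (func : ∀ e e' e'', g e e' → g e e'' → e' = e'')
    (flip : ∀ e e', g e e' → src e' = !src e) (c : Bool) {x y : X}
    (h : EqvGen (fun x y => ∃ e e', g e e' ∧ piece e = x ∧ piece e' = y) x y) :
    ReflTransGen (ChainStep piece src g c) x y ∨ ReflTransGen (ChainStep piece src g c) y x := by
  have hr : Relator.RightUnique (ChainStep piece src g c) := by
    rintro x y z ⟨e, e', h1, h2, h3, h4⟩ ⟨f, f', k1, k2, k3, k4⟩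
    have := inj e f (h2.trans k2.symm) (h4.trans k4.symm)
    subst this
    rw [← h3, ← k3, func _ _ _ h1 k1]
  have hl : Relator.RightUnique (Function.swap (ChainStep piece src g c)) := by
    rintro x y z ⟨e, e', h1, h2, h3, h4⟩ ⟨f, f', k1, k2, k3, k4⟩
    have := inj e' f' (h3.trans k3.symm) (by rw [flip _ _ h1, flip _ _ k1, h4, k4])
    subst this
    rw [← h2, ← k2, func _ _ _ (symm _ _ h1) (symm _ _ k1)]
  induction h with
  | rel x y h =>
    obtain ⟨e, e', h1, h2, h3⟩ := h
    by_cases hc : src e = !c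
    · exact Or.inl (ReflTransGen.single ⟨e, e', h1, h2, h3, hc⟩)
    · refine Or.inr (ReflTransGen.single ⟨e', e, symm _ _ h1, h3, h2, ?_⟩)
      rw [flip _ _ h1]
      revert hc
      cases src e <;> cases c <;> simp
  | refl x => exact Or.inl .refl
  | symm x y _ ih => exact ih.symm
  | trans x y z _ _ ih1 ih2 =>
    rcases ih1 with h1 | h1 <;> rcases ih2 with h2 | h2
    · exact Or.inl (h1.trans h2)
    · have := ReflTransGen.total_of_right_unique hl
        (reflTransGen_swap.mpr h1) (reflTransGen_swap.mpr h2)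
      exact this.symm.imp (fun k => reflTransGen_swap.mp k) (fun k => reflTransGen_swap.mp k)
    · exact ReflTransGen.total_of_right_unique hr h1 h2
    · exact Or.inr (h2.trans h1)

theorem chain_no_pred (inj : ∀ e e', piece e = piece e' → src e = src e' → e = e')
    (symm : ∀ e e', g e e' → g e' e)
    (flip : ∀ e e', g e e' → src e' = !src e) {e : E} (he : ∀ e', ¬ g e e') (z : X) :
    ¬ ChainStep piece src g (src e) z (piece e) := by
  rintro ⟨f, f', h1, h2, h3, h4⟩
  have := inj f' e h3 (by rw [flip _ _ h1, h4, Bool.not_not])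
  subst this
  exact he _ (symm _ _ h1)

theorem chain_inj (inj : ∀ e e', piece e = piece e' → src e = src e' → e = e')
    (symm : ∀ e e', g e e' → g e' e) (func : ∀ e e' e'', g e e' → g e e'' → e' = e'')
    (flip : ∀ e e', g e e' → src e' = !src e) {e f : E} (he : ∀ e', ¬ g e e')
    (hf : ∀ e', ¬ g f e') (hs : src e = src f)
    (h : EqvGen (fun x y => ∃ e e', g e e' ∧ piece e = x ∧ piece e' = y) (piece e) (piece f)) :
    e = f := by
  refine inj e f ?_ hs
  rcases chain_total inj symm func flip (src e) h with h | h
  · rcases ReflTransGen.cases_tail h with h | ⟨z, -, h⟩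
    · exact h.symm
    · rw [hs] at h
      exact absurd h (chain_no_pred inj symm flip hf z)
  · rcases ReflTransGen.cases_tail h with h | ⟨z, -, h⟩
    · exact h
    · exact absurd h (chain_no_pred inj symm flip he z)

theorem chain_pair [Finite X] (inj : ∀ e e', piece e = piece e' → src e = src e' → e = e')
    (pair : ∀ e, ∃ e', piece e' = piece e ∧ src e' ≠ src e)
    (symm : ∀ e e', g e e' → g e' e) (func : ∀ e e' e'', g e e' → g e e'' → e' = e'')
    (flip : ∀ e e', g e e' → src e' = !src e) {e : E} (he : ∀ e', ¬ g e e') :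
    ∃ f, (∀ e', ¬ g f e') ∧ src f ≠ src e ∧
      EqvGen (fun x y => ∃ e e', g e e' ∧ piece e = x ∧ piece e' = y) (piece f) (piece e) := by
  by_contra hcon
  push Not at hcon
  have hmono : ∀ {x y}, ReflTransGen (ChainStep piece src g (src e)) x y →
      EqvGen (fun x y => ∃ e e', g e e' ∧ piece e = x ∧ piece e' = y) x y := by
    intro x y h
    induction h with
    | refl => exact .refl _
    | tail _ h ih =>
      obtain ⟨e, e', h1, h2, h3, -⟩ := h
      exact .trans _ _ _ ih (.rel _ _ ⟨e, e', h1, h2, h3⟩)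
  let Y := {y : X // ReflTransGen (ChainStep piece src g (src e)) (piece e) y}
  have hstart : ∀ y : Y, ∃ f, piece f = y.1 ∧ src f = src e := by
    rintro ⟨y, hy⟩
    rcases ReflTransGen.cases_tail hy with h | ⟨z, -, f, f', h1, h2, h3, h4⟩
    · exact ⟨e, h.symm, rfl⟩
    · exact ⟨f', h3, by rw [flip _ _ h1, h4, Bool.not_not]⟩
  have hnext : ∀ y : Y, ∃ z : Y, ChainStep piece src g (src e) y.1 z.1 := by
    intro y
    obtain ⟨f, hf, hfs⟩ := hstart y
    obtain ⟨f', hf', hfs'⟩ := pair f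
    have hne : src f' ≠ src e := hfs ▸ hfs'
    have hex : ∃ e', g f' e' := by
      by_contra hno
      push Not at hno
      refine hcon f' hno hne ?_
      rw [hf', hf]
      exact .symm _ _ (hmono y.2)
    obtain ⟨e', he'⟩ := hex
    have hstep : ChainStep piece src g (src e) y.1 (piece e') := by
      refine ⟨f', e', he', hf'.trans hf, rfl, ?_⟩
      revert hne
      cases src f' <;> cases src e <;> simp
    exact ⟨⟨piece e', y.2.tail hstep⟩, hstep⟩
  choose F hF using hnext
  have hFinj : Function.Injective F := by
    intro y z hyz
    obtain ⟨a, a', h1, h2, h3, h4⟩ := hF y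
    obtain ⟨b, b', k1, k2, k3, k4⟩ := hF z
    have := inj a' b' (by rw [h3, k3, hyz]) (by rw [flip _ _ h1, flip _ _ k1, h4, k4])
    subst this
    apply Subtype.ext
    rw [← h2, ← k2, func _ _ _ (symm _ _ h1) (symm _ _ k1)]
  obtain ⟨y, hy⟩ := Finite.surjective_of_injective hFinj ⟨piece e, .refl⟩
  have := hF y
  rw [hy] at this
  exact chain_no_pred inj symm flip he _ this

end Chains

section Composition

variable {I : Type} {inn : I → DiscType} {out : DiscType} {J : I → Type}
  {sub : ∀ i, J i → DiscType}

/-- Strings of `T` and of the `S i` which end at the same point of the `i`-th inner disc of `T`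
(which is the outer disc of `S i`) are glued. -/
inductive StrGlue (T : Tangle inn out) (S : ∀ i, Tangle (sub i) (inn i)) :
    (T.Str ⊕ Σ i, (S i).Str) → (T.Str ⊕ Σ i, (S i).Str) → Prop
  | mk (i : I) (j : Fin (2 * (inn i).half)) :
    StrGlue T S (Sum.inl (T.str ⟨some i, j⟩)) (Sum.inr ⟨i, (S i).str ⟨none, j⟩⟩)

/-- Regions of `T` and of the `S i` which touch the same interval of the `i`-th inner disc of `T`
(which is the outer disc of `S i`) are glued. -/
inductive RegGlue (T : Tangle inn out) (S : ∀ i, Tangle (sub i) (inn i)) :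
    (T.Reg ⊕ Σ i, (S i).Reg) → (T.Reg ⊕ Σ i, (S i).Reg) → Prop
  | mk (i : I) (j : Fin (2 * (inn i).half + 1)) :
    RegGlue T S (Sum.inl (T.reg ⟨some i, j⟩)) (Sum.inr ⟨i, (S i).reg ⟨none, j⟩⟩)

/-- The piece of string at a marked point of the glued tangle. -/
def compStr (T : Tangle inn out) (S : ∀ i, Tangle (sub i) (inn i)) :
    Pt (fun x : Σ i, J i => sub x.1 x.2) out → T.Str ⊕ Σ i, (S i).Str
  | ⟨none, j⟩ => Sum.inl (T.str ⟨none, j⟩)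
  | ⟨some x, j⟩ => Sum.inr ⟨x.1, (S x.1).str ⟨some x.2, j⟩⟩

/-- The piece of region at a boundary interval of the glued tangle. -/
def compReg (T : Tangle inn out) (S : ∀ i, Tangle (sub i) (inn i)) :
    Iv (fun x : Σ i, J i => sub x.1 x.2) out → T.Reg ⊕ Σ i, (S i).Reg
  | ⟨none, j⟩ => Sum.inl (T.reg ⟨none, j⟩)
  | ⟨some x, j⟩ => Sum.inr ⟨x.1, (S x.1).reg ⟨some x.2, j⟩⟩

/-- The piece of region along a piece of string. -/
def compSide (T : Tangle inn out) (S : ∀ i, Tangle (sub i) (inn i)) (c : Bool) :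
    (T.Str ⊕ Σ i, (S i).Str) → T.Reg ⊕ Σ i, (S i).Reg
  | Sum.inl s => Sum.inl (T.side s c)
  | Sum.inr s => Sum.inr ⟨s.1, (S s.1).side s.2 c⟩

/-- The shading of a piece of region. -/
def compShade (T : Tangle inn out) (S : ∀ i, Tangle (sub i) (inn i)) :
    (T.Reg ⊕ Σ i, (S i).Reg) → Bool
  | Sum.inl r => T.shade r
  | Sum.inr r => (S r.1).shade r.2

theorem compSide_glue (T : Tangle inn out) (S : ∀ i, Tangle (sub i) (inn i)) (c : Bool)
    (a b : T.Str ⊕ Σ i, (S i).Str) (h : StrGlue T S a b) :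
    RegGlue T S (compSide T S c a) (compSide T S c b) := by
  obtain ⟨i, j⟩ := h
  simp only [compSide]
  rw [T.side_nb, (S i).side_nb]
  unfold nb
  have hcol : ivColour (before (⟨none, j⟩ : Pt (sub i) (inn i))) =
    ivColour (before (⟨some i, j⟩ : Pt inn out)) := rfl
  rw [hcol]
  split_ifs
  · exact RegGlue.mk i j.castSucc
  · exact RegGlue.mk i j.succ

theorem compShade_glue (T : Tangle inn out) (S : ∀ i, Tangle (sub i) (inn i))
    (a b : T.Reg ⊕ Σ i, (S i).Reg) (h : RegGlue T S a b) : compShade T S a = compShade T S b := by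
  obtain ⟨i, j⟩ := h
  simp only [compShade]
  rw [T.shade_reg, (S i).shade_reg]
  rfl

/-- The end points of all pieces of strings. -/
def pieceStr (T : Tangle inn out) (S : ∀ i, Tangle (sub i) (inn i)) :
    (Pt inn out ⊕ Σ i, Pt (sub i) (inn i)) → T.Str ⊕ Σ i, (S i).Str
  | Sum.inl p => Sum.inl (T.str p)
  | Sum.inr p => Sum.inr ⟨p.1, (S p.1).str p.2⟩

/-- Whether a piece of string starts at a given end point. -/
def pieceSource : (Pt inn out ⊕ Σ i, Pt (sub i) (inn i)) → Bool
  | Sum.inl p => isSource p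
  | Sum.inr p => isSource p.2

/-- Equality of end points on the glued circles. -/
inductive PtGlue : (Pt inn out ⊕ Σ i, Pt (sub i) (inn i)) →
    (Pt inn out ⊕ Σ i, Pt (sub i) (inn i)) → Prop
  | left (i : I) (j : Fin (2 * (inn i).half)) :
    PtGlue (Sum.inl ⟨some i, j⟩) (Sum.inr ⟨i, ⟨none, j⟩⟩)
  | right (i : I) (j : Fin (2 * (inn i).half)) :
    PtGlue (Sum.inr ⟨i, ⟨none, j⟩⟩) (Sum.inl ⟨some i, j⟩)

/-- The end points which are left free after gluing. -/
def freePt : Pt (fun x : Σ i, J i => sub x.1 x.2) out → Pt inn out ⊕ Σ i, Pt (sub i) (inn i)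
  | ⟨none, j⟩ => Sum.inl ⟨none, j⟩
  | ⟨some x, j⟩ => Sum.inr ⟨x.1, ⟨some x.2, j⟩⟩

theorem piece_inj (T : Tangle inn out) (S : ∀ i, Tangle (sub i) (inn i))
    (e e' : Pt inn out ⊕ Σ i, Pt (sub i) (inn i)) (h : pieceStr T S e = pieceStr T S e')
    (h' : pieceSource e = pieceSource e') : e = e' := by
  rcases e with p | ⟨i, p⟩ <;> rcases e' with q | ⟨i', q⟩
  · rw [T.str_inj p q (Sum.inl.inj h) h']
  · exact absurd h (by simp [pieceStr])
  · exact absurd h (by simp [pieceStr])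
  · have h1 := Sum.inr.inj h
    have h2 : i = i' := congrArg Sigma.fst h1
    subst h2
    rw [(S i).str_inj p q (eq_of_heq (Sigma.mk.inj h1).2) h']

theorem piece_pair (T : Tangle inn out) (S : ∀ i, Tangle (sub i) (inn i))
    (e : Pt inn out ⊕ Σ i, Pt (sub i) (inn i)) :
    ∃ e', pieceStr T S e' = pieceStr T S e ∧ pieceSource e' ≠ pieceSource e := by
  rcases e with p | ⟨i, p⟩
  · obtain ⟨q, h1, h2⟩ := T.str_pair p
    exact ⟨Sum.inl q, by simp [pieceStr, h1], h2⟩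
  · obtain ⟨q, h1, h2⟩ := (S i).str_pair p
    exact ⟨Sum.inr ⟨i, q⟩, by simp [pieceStr, h1], h2⟩

theorem ptGlue_symm (e e' : Pt inn out ⊕ Σ i, Pt (sub i) (inn i)) (h : PtGlue e e') :
    PtGlue e' e := by
  cases h
  · exact .right _ _
  · exact .left _ _

theorem ptGlue_func (e e' e'' : Pt inn out ⊕ Σ i, Pt (sub i) (inn i)) (h : PtGlue e e')
    (h' : PtGlue e e'') : e' = e'' := by
  cases h <;> cases h' <;> rfl

theorem ptGlue_flip (e e' : Pt inn out ⊕ Σ i, Pt (sub i) (inn i)) (h : PtGlue e e') :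
    pieceSource e' = !pieceSource e := by
  cases h with
  | left i j =>
    simp only [pieceSource, isSource, Option.isNone, Bool.bne_true, Bool.bne_false]
    rfl
  | right i j =>
    simp only [pieceSource, isSource, Option.isNone, Bool.bne_true, Bool.bne_false, Bool.not_not]
    rfl

theorem freePt_free (p : Pt (fun x : Σ i, J i => sub x.1 x.2) out)
    (e' : Pt inn out ⊕ Σ i, Pt (sub i) (inn i)) : ¬ PtGlue (freePt p) e' := by
  rcases p with ⟨_ | x, j⟩ <;> intro h <;> cases h

theorem freePt_of_free (e : Pt inn out ⊕ Σ i, Pt (sub i) (inn i)) (he : ∀ e', ¬ PtGlue e e') :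
    ∃ p : Pt (fun x : Σ i, J i => sub x.1 x.2) out, freePt p = e := by
  rcases e with ⟨_ | i, j⟩ | ⟨i, _ | i', j⟩
  · exact ⟨⟨none, j⟩, rfl⟩
  · exact absurd (PtGlue.left i j) (he _)
  · exact absurd (PtGlue.right i j) (he _)
  · exact ⟨⟨some ⟨i, i'⟩, j⟩, rfl⟩

theorem freePt_inj (p q : Pt (fun x : Σ i, J i => sub x.1 x.2) out)
    (h : (freePt p : Pt inn out ⊕ Σ i, Pt (sub i) (inn i)) = freePt q) : p = q := by
  rcases p with ⟨_ | ⟨x, x'⟩, j⟩ <;> rcases q with ⟨_ | ⟨y, y'⟩, j'⟩ <;> cases h <;> rfl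

theorem pieceSource_freePt (p : Pt (fun x : Σ i, J i => sub x.1 x.2) out) :
    pieceSource (freePt p : Pt inn out ⊕ Σ i, Pt (sub i) (inn i)) = isSource p := by
  rcases p with ⟨_ | x, j⟩ <;> rfl

theorem pieceStr_freePt (T : Tangle inn out) (S : ∀ i, Tangle (sub i) (inn i))
    (p : Pt (fun x : Σ i, J i => sub x.1 x.2) out) :
    pieceStr T S (freePt p) = compStr T S p := by
  rcases p with ⟨_ | x, j⟩ <;> rfl

theorem eqvGen_of_strGlue (T : Tangle inn out) (S : ∀ i, Tangle (sub i) (inn i))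
    {a b : T.Str ⊕ Σ i, (S i).Str} (h : Quot.mk (StrGlue T S) a = Quot.mk (StrGlue T S) b) :
    Relation.EqvGen (fun x y => ∃ e e', PtGlue e e' ∧ pieceStr T S e = x ∧ pieceStr T S e' = y)
      a b := by
  refine Relation.EqvGen.mono (r := StrGlue T S) ?_ _ _ (Quot.eqvGen_exact h)
  rintro _ _ ⟨i, j⟩
  exact ⟨_, _, PtGlue.left i j, rfl, rfl⟩

theorem strGlue_of_eqvGen (T : Tangle inn out) (S : ∀ i, Tangle (sub i) (inn i))
    {a b : T.Str ⊕ Σ i, (S i).Str}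
    (h : Relation.EqvGen (fun x y => ∃ e e', PtGlue e e' ∧ pieceStr T S e = x ∧
      pieceStr T S e' = y) a b) : Quot.mk (StrGlue T S) a = Quot.mk (StrGlue T S) b := by
  induction h with
  | rel x y h =>
    obtain ⟨e, e', h, rfl, rfl⟩ := h
    cases h with
    | left i j => exact Quot.sound (.mk i j)
    | right i j => exact (Quot.sound (.mk i j)).symm
  | refl => rfl
  | symm _ _ _ ih => exact ih.symm
  | trans _ _ _ _ _ ih1 ih2 => exact ih1.trans ih2

/-- A function on regions whose jumps across the strings are `w` has along each circle the
increments given by `w`. -/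
theorem jump_eq (T : Tangle inn out) (w : T.Str → ℤ) (h : T.Reg → ℤ)
    (hw : ∀ s, h (T.side s true) - h (T.side s false) = w s) (p : Pt inn out) :
    h (T.reg (before p)) - h (T.reg (after p)) =
      if ivColour (before p) then w (T.str p) else - w (T.str p) := by
  have h1 := hw (T.str p)
  rw [← T.side_before, ← T.side_after, ivColour_after]
  cases ivColour (before p)
  · simp; linarith
  · simpa using h1

/-- The tangle obtained by gluing `S i` into the `i`-th inner disc of `T`, for all `i`: strings and
regions are glued along the circles, which are then forgotten. -/
def Tangle.comp (T : Tangle inn out) (S : ∀ i, Tangle (sub i) (inn i)) :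
    Tangle (fun x : Σ i, J i => sub x.1 x.2) out where
  Str := Quot (StrGlue T S)
  Reg := Quot (RegGlue T S)
  finite_disc := by
    have := T.finite_disc
    have := fun i => (S i).finite_disc
    infer_instance
  finite_str := by
    have := T.finite_disc
    have := T.finite_str
    have := fun i => (S i).finite_str
    infer_instance
  finite_reg := by
    have := T.finite_disc
    have := T.finite_reg
    have := fun i => (S i).finite_reg
    infer_instance
  side s c := Quot.map (compSide T S c) (compSide_glue T S c) s
  shade := Quot.lift (compShade T S) (compShade_glue T S)
  shade_side := by
    rintro ⟨s | s⟩ c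
    · exact T.shade_side s c
    · exact (S s.1).shade_side s.2 c
  str p := Quot.mk _ (compStr T S p)
  reg v := Quot.mk _ (compReg T S v)
  shade_reg := by
    rintro ⟨_ | x, j⟩
    · exact T.shade_reg ⟨none, j⟩
    · exact (S x.1).shade_reg ⟨some x.2, j⟩
  reg_last := by
    rintro (_ | x)
    · exact congrArg (fun r => Quot.mk _ (Sum.inl r)) (T.reg_last none)
    · exact congrArg (fun r => Quot.mk (RegGlue T S) (Sum.inr (⟨x.1, r⟩ : Σ i, (S i).Reg))) ((S x.1).reg_last (some x.2))
  side_before := by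
    rintro ⟨_ | x, j⟩
    · exact congrArg (fun r => Quot.mk _ (Sum.inl r)) (T.side_before ⟨none, j⟩)
    · exact congrArg (fun r => Quot.mk (RegGlue T S) (Sum.inr (⟨x.1, r⟩ : Σ i, (S i).Reg)))
        ((S x.1).side_before ⟨some x.2, j⟩)
  side_after := by
    rintro ⟨_ | x, j⟩
    · exact congrArg (fun r => Quot.mk _ (Sum.inl r)) (T.side_after ⟨none, j⟩)
    · exact congrArg (fun r => Quot.mk (RegGlue T S) (Sum.inr (⟨x.1, r⟩ : Σ i, (S i).Reg)))
        ((S x.1).side_after ⟨some x.2, j⟩)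
  str_inj p q h h' := by
    apply freePt_inj (inn := inn)
    refine chain_inj (piece_inj T S) ptGlue_symm ptGlue_func ptGlue_flip (freePt_free p)
      (freePt_free q) (by rw [pieceSource_freePt, pieceSource_freePt, h']) ?_
    rw [pieceStr_freePt, pieceStr_freePt]
    exact eqvGen_of_strGlue T S h
  str_pair p := by
    have := T.finite_disc
    have := T.finite_str
    have := fun i => (S i).finite_str
    obtain ⟨f, h1, h2, h3⟩ := chain_pair (piece_inj T S) (piece_pair T S) ptGlue_symm ptGlue_func
      ptGlue_flip (freePt_free p)
    obtain ⟨q, rfl⟩ := freePt_of_free f h1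
    rw [pieceStr_freePt, pieceStr_freePt] at h3
    rw [pieceSource_freePt, pieceSource_freePt] at h2
    exact ⟨q, strGlue_of_eqvGen T S h3, h2⟩
  connected := by
    intro h hh
    have hT : ∀ r r', h (Quot.mk _ (Sum.inl r)) = h (Quot.mk _ (Sum.inl r')) :=
      T.connected (fun r => h (Quot.mk _ (Sum.inl r))) fun s => hh (Quot.mk _ (Sum.inl s))
    have hS : ∀ i r r', h (Quot.mk _ (Sum.inr ⟨i, r⟩)) = h (Quot.mk _ (Sum.inr ⟨i, r'⟩)) :=
      fun i => (S i).connected (fun r => h (Quot.mk _ (Sum.inr ⟨i, r⟩)))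
        fun s => hh (Quot.mk _ (Sum.inr ⟨i, s⟩))
    have key : ∀ r, h r = h (Quot.mk _ (Sum.inl (T.reg ⟨none, 0⟩))) := by
      rintro ⟨r | ⟨i, r⟩⟩
      · exact hT _ _
      · rw [hS i r ((S i).reg ⟨none, 0⟩), hT (T.reg ⟨none, 0⟩) (T.reg ⟨some i, 0⟩)]
        exact congrArg h (Quot.sound (RegGlue.mk i 0)).symm
    intro r r'
    rw [key r, key r']
  acyclic := by
    intro w hw
    have hS : ∀ i, ∃ h : (S i).Reg → ℤ, ∀ s, h ((S i).side s true) - h ((S i).side s false) =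
        w (Quot.mk _ (Sum.inr ⟨i, s⟩)) :=
      fun i => (S i).acyclic (fun s => w (Quot.mk _ (Sum.inr ⟨i, s⟩))) fun i' => hw ⟨i, i'⟩
    choose hS hS' using hS
    -- the increments along the glued circle, seen from the inside
    obtain ⟨A, hA⟩ : ∃ A : ∀ i, Fin (2 * (inn i).half + 1) → ℤ,
      ∀ i j, hS i ((S i).reg ⟨none, j⟩) = A i j := ⟨_, fun _ _ => rfl⟩
    have hin : ∀ i (j : Fin (2 * (inn i).half)), A i j.castSucc - A i j.succ =
        if isSource (⟨some i, j⟩ : Pt inn out) then w (Quot.mk _ (Sum.inl (T.str ⟨some i, j⟩)))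
        else - w (Quot.mk _ (Sum.inl (T.str ⟨some i, j⟩))) := by
      intro i j
      have h1 := jump_eq (S i) _ (hS i) (hS' i) ⟨none, j⟩
      have h2 : Quot.mk (StrGlue T S) (Sum.inl (T.str ⟨some i, j⟩)) =
        Quot.mk (StrGlue T S) (Sum.inr ⟨i, (S i).str ⟨none, j⟩⟩) := Quot.sound (.mk i j)
      have h3 : isSource (⟨some i, j⟩ : Pt inn out) =
        ivColour (before (⟨none, j⟩ : Pt (sub i) (inn i))) := by
        simp [isSource]; rfl
      rw [h2, h3, ← hA, ← hA]
      exact h1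
    have hcyc : ∀ i, ∑ j : Fin (2 * (inn i).half),
        (if isSource (⟨some i, j⟩ : Pt inn out) then w (Quot.mk _ (Sum.inl (T.str ⟨some i, j⟩)))
        else - w (Quot.mk _ (Sum.inl (T.str ⟨some i, j⟩)))) = 0 := by
      intro i
      rw [← Finset.sum_congr rfl fun j _ => hin i j, Finset.sum_sub_distrib]
      have e1 := Fin.sum_univ_castSucc (A i)
      have e2 := Fin.sum_univ_succ (A i)
      have e3 : A i 0 = A i (Fin.last _) := by
        rw [← hA, ← hA]
        exact congrArg (hS i) ((S i).reg_last none)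
      linarith
    obtain ⟨hT, hT'⟩ := T.acyclic (fun s => w (Quot.mk _ (Sum.inl s))) hcyc
    obtain ⟨B, hB⟩ : ∃ B : ∀ i, Fin (2 * (inn i).half + 1) → ℤ,
      ∀ i j, hT (T.reg ⟨some i, j⟩) = B i j := ⟨_, fun _ _ => rfl⟩
    have hcirc : ∀ i (j : Fin (2 * (inn i).half + 1)), B i j = A i j + (B i 0 - A i 0) := by
      intro i j
      induction j using Fin.induction with
      | zero => ring
      | succ j ih =>
        have h2 := jump_eq T _ hT hT' ⟨some i, j⟩
        have h3 : isSource (⟨some i, j⟩ : Pt inn out) =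
          ivColour (before (⟨some i, j⟩ : Pt inn out)) := by simp [isSource]
        rw [← h3, ← hin i j] at h2
        have h4 : B i j.castSucc - B i j.succ = A i j.castSucc - A i j.succ := by
          rw [← hB, ← hB]
          exact h2
        linarith
    refine ⟨Quot.lift (fun r : T.Reg ⊕ Σ i, (S i).Reg => match r with
      | Sum.inl r => hT r
      | Sum.inr r => hS r.1 r.2 + (B r.1 0 - A r.1 0)) ?_,
      ?_⟩
    · rintro _ _ ⟨i, j⟩
      change hT (T.reg ⟨some i, j⟩) = hS i ((S i).reg ⟨none, j⟩) + (B i 0 - A i 0)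
      rw [hA, hB]
      exact hcirc i j
    · rintro ⟨s | ⟨i, s⟩⟩
      · exact hT' s
      · have := hS' i s
        simp only [Quot.map, compSide]
        linarith

end Composition

/-! ### Tangles without closed loops, given by an explicit pairing of the marked points -/

section Explicit

variable {I : Type} {inn : I → DiscType} {out : DiscType} {Str : Type}

/-- The identifications of boundary intervals that define the regions of an explicit tangle: the
two names of each distinguished interval are identified, as are the intervals next to the two ends
of each string on the same side of it (`rep s` is one of the two ends of `s`); moreover the
interval `base i` of the `i`-th inner disc lies in the same region as the interval `pos i` of the
outer disc. -/
inductive RegRel (str : Pt inn out → Str) (rep : Str → Pt inn out)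
    (base : ∀ i, Fin (2 * (inn i).half + 1)) (pos : I → Fin (2 * out.half + 1)) :
    Iv inn out → Iv inn out → Prop
  | last (d : Option I) : RegRel str rep base pos ⟨d, 0⟩ ⟨d, Fin.last _⟩
  | string (p : Pt inn out) (c : Bool) :
    RegRel str rep base pos (nb p c) (nb (rep (str p)) c)
  | disc (i : I) : RegRel str rep base pos ⟨some i, base i⟩ ⟨none, pos i⟩

/-- The tangle with strings `Str`, incidences `str`, and the regions defined by `RegRel`. -/
def Tangle.explicit [Finite I] [Finite Str] (str : Pt inn out → Str) (rep : Str → Pt inn out)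
    (base : ∀ i, Fin (2 * (inn i).half + 1)) (pos : I → Fin (2 * out.half + 1))
    (str_rep : ∀ s, str (rep s) = s)
    (str_inj : ∀ p q, str p = str q → isSource p = isSource q → p = q)
    (str_pair : ∀ p, ∃ q, str q = str p ∧ isSource q ≠ isSource p)
    (colour_base : ∀ i, ivColour (⟨some i, base i⟩ : Iv inn out) =
      ivColour (⟨none, pos i⟩ : Iv inn out))
    (potential : ∀ w : Str → ℤ,
      (∀ i : I, ∑ j : Fin (2 * (disc inn out (some i)).half),
        (if isSource (⟨some i, j⟩ : Pt inn out) then w (str ⟨some i, j⟩)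
          else - w (str ⟨some i, j⟩)) = 0) →
      ∃ H : Option I → ℕ → ℤ,
        (∀ p : Pt inn out, H p.1 p.2 - H p.1 (p.2 + 1) =
          if ivColour (before p) then w (str p) else - w (str p)) ∧
        (∀ d, H d 0 = H d (2 * (disc inn out d).half)) ∧
        (∀ p : Pt inn out,
          (ivColour (before (rep (str p))) = ivColour (before p) ∧
            H p.1 p.2 = H (rep (str p)).1 (rep (str p)).2) ∨
          (ivColour (before (rep (str p))) = !ivColour (before p) ∧
            H p.1 p.2 = H (rep (str p)).1 ((rep (str p)).2 + 1))) ∧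
        (∀ i, H (some i) (base i) = H none (pos i))) :
    Tangle inn out where
  Str := Str
  Reg := Quot (RegRel str rep base pos)
  finite_disc := inferInstance
  finite_str := inferInstance
  finite_reg := inferInstance
  side s c := Quot.mk _ (nb (rep s) c)
  shade := Quot.lift ivColour (by
    rintro _ _ (d | ⟨p, c⟩ | i)
    · have : (2 * (disc inn out d).half) % 2 = 0 := by omega
      simp [ivColour, colour]
    · rw [ivColour_nb, ivColour_nb]
    · exact colour_base i)
  shade_side s c := ivColour_nb (rep s) c
  str := str
  reg v := Quot.mk _ v
  shade_reg _ := rfl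
  reg_last d := Quot.sound (.last d)
  side_before p := by
    rw [← Quot.sound (RegRel.string p (ivColour (before p))), nb_before]
  side_after p := by
    rw [← Quot.sound (RegRel.string p (ivColour (after p))), nb_after]
  str_inj := str_inj
  str_pair := str_pair
  connected := by
    intro h hh
    have hnb : ∀ p : Pt inn out, h (Quot.mk _ (before p)) = h (Quot.mk _ (after p)) := by
      intro p
      have h1 := hh (str p)
      rw [← Quot.sound (RegRel.string p true), ← Quot.sound (RegRel.string p false)] at h1
      rw [← nb_before, ← nb_after, ivColour_after]
      cases ivColour (before p)
      · exact h1.symm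
      · exact h1
    have hdisc : ∀ d j, h (Quot.mk _ ⟨d, j⟩) = h (Quot.mk _ ⟨d, 0⟩) := by
      intro d j
      induction j using Fin.induction with
      | zero => rfl
      | succ j ih => exact (hnb ⟨d, j⟩).symm.trans ih
    have key : ∀ r, h r = h (Quot.mk _ ⟨none, 0⟩) := by
      rintro ⟨_ | i, j⟩
      · exact hdisc none j
      · refine (hdisc (some i) j).trans ((hdisc (some i) (base i)).symm.trans ?_)
        exact (congrArg h (Quot.sound (RegRel.disc i))).trans (hdisc none (pos i))
    intro r r'
    rw [key r, key r']
  acyclic := by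
    intro w hw
    obtain ⟨H, h1, h2, h3, h4⟩ := potential w hw
    have hjump : ∀ p : Pt inn out,
        H (nb p true).1 (nb p true).2 - H (nb p false).1 (nb p false).2 = w (str p) := by
      intro p
      have := h1 p
      unfold nb
      revert this
      cases hc : ivColour (before p)
      · simp [before, after]; intro h; linarith
      · simp [before, after]
    refine ⟨Quot.lift (fun v => H v.1 v.2) ?_, ?_⟩
    · rintro _ _ (d | ⟨p, c⟩ | i)
      · simpa using h2 d
      · have e1 := hjump p
        have e2 := hjump (rep (str p))
        rw [str_rep] at e2
        have e3 : H p.1 p.2 = H (nb (rep (str p)) (ivColour (before p))).1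
            (nb (rep (str p)) (ivColour (before p))).2 := by
          rcases h3 p with ⟨k1, k2⟩ | ⟨k1, k2⟩
          · rw [← k1, nb_before]
            exact k2
          · rw [show ivColour (before p) = ivColour (after (rep (str p))) by
              rw [ivColour_after, k1, Bool.not_not], nb_after]
            exact k2
        have e4 : H p.1 p.2 = H (nb p (ivColour (before p))).1 (nb p (ivColour (before p))).2 := by
          rw [nb_before]; rfl
        rw [e4] at e3
        revert e3
        cases ivColour (before p) <;> cases c <;> intro e3 <;> linarith
      · exact h4 i
    · intro s
      have := hjump (rep s)
      rwa [str_rep] at this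

theorem colour_congr (ε : Bool) (n n' : ℕ) {a b : ℕ} (h : a % 2 = b % 2) :
    colour ⟨n, ε⟩ a = colour ⟨n', ε⟩ b := by simp [colour, h]

theorem colour_opp (ε : Bool) (n n' : ℕ) {a b : ℕ} (h : a % 2 ≠ b % 2) :
    colour ⟨n, ε⟩ a = !colour ⟨n', ε⟩ b := by
  rcases Nat.mod_two_eq_zero_or_one a with ha | ha <;>
    rcases Nat.mod_two_eq_zero_or_one b with hb | hb <;> simp [colour, ha, hb] <;> omega

theorem colour_eq_iff (ε : Bool) (n n' a b : ℕ) :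
    colour ⟨n, ε⟩ a = colour ⟨n', ε⟩ b ↔ a % 2 = b % 2 := by
  refine ⟨fun h => ?_, colour_congr ε n n'⟩
  by_contra hne
  rw [colour_opp ε n n' hne] at h
  cases hc : colour ⟨n', ε⟩ b <;> simp [hc] at h

theorem colour_eq_not_iff (ε : Bool) (n n' a b : ℕ) :
    colour ⟨n, ε⟩ a = !colour ⟨n', ε⟩ b ↔ a % 2 ≠ b % 2 := by
  refine ⟨fun h hne => ?_, colour_opp ε n n'⟩
  rw [colour_congr ε n n' hne] at h
  cases hc : colour ⟨n', ε⟩ b <;> simp [hc] at h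

theorem not_colour_eq_iff (ε : Bool) (n n' a b : ℕ) :
    (!colour ⟨n, ε⟩ a) = colour ⟨n', ε⟩ b ↔ a % 2 ≠ b % 2 := by
  rw [eq_comm, colour_eq_not_iff]
  exact ne_comm

/-- The sign with which the string at the point `x` of a disc counts. -/
def sgn (ε : Bool) (x : ℕ) : ℤ := if colour ⟨0, ε⟩ x then 1 else -1

theorem sgn_congr (ε : Bool) {a b : ℕ} (h : a % 2 = b % 2) : sgn ε a = sgn ε b := by
  simp [sgn, colour_congr ε 0 0 h]

theorem sgn_opp (ε : Bool) {a b : ℕ} (h : a % 2 ≠ b % 2) : sgn ε a = - sgn ε b := by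
  unfold sgn
  rw [colour_opp ε 0 0 h]
  cases colour ⟨0, ε⟩ b <;> simp

/-- Partial sums of the signed weights around a disc. -/
def psum (ε : Bool) (W : ℕ → ℤ) (j : ℕ) : ℤ := ∑ x ∈ Finset.range j, sgn ε x * W x

theorem psum_zero (ε : Bool) (W : ℕ → ℤ) : psum ε W 0 = 0 := rfl

theorem psum_succ (ε : Bool) (W : ℕ → ℤ) (j : ℕ) :
    psum ε W (j + 1) = psum ε W j + sgn ε j * W j := Finset.sum_range_succ _ _

/-- Partial sums agree along parallel strings. -/
theorem psum_same (ε : Bool) (U W : ℕ → ℤ) (a b l : ℕ) (hab : a % 2 = b % 2) (c : ℤ)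
    (h0 : psum ε U a = psum ε W b + c) (h : ∀ x < l, U (a + x) = W (b + x)) :
    ∀ x ≤ l, psum ε U (a + x) = psum ε W (b + x) + c := by
  intro x
  induction x with
  | zero => intro _; simpa using h0
  | succ x ih =>
    intro hx
    rw [← Nat.add_assoc, ← Nat.add_assoc, psum_succ, psum_succ, ih (by omega), h x (by omega),
      sgn_congr ε (show (a + x) % 2 = (b + x) % 2 by omega)]
    ring

/-- Partial sums agree along strings that turn back. -/
theorem psum_opp (ε : Bool) (U W : ℕ → ℤ) (a b l : ℕ) (hl : l ≤ b) (hab : a % 2 = b % 2) (c : ℤ)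
    (h0 : psum ε U a = psum ε W b + c) (h : ∀ x < l, U (a + x) = W (b - 1 - x)) :
    ∀ x ≤ l, psum ε U (a + x) = psum ε W (b - x) + c := by
  intro x
  induction x with
  | zero => intro _; simpa using h0
  | succ x ih =>
    intro hx
    obtain ⟨y, hy⟩ : ∃ y, b - x = y + 1 := ⟨b - x - 1, by omega⟩
    have h1 := ih (by omega)
    have h2 := h x (by omega)
    rw [hy, psum_succ] at h1
    rw [← Nat.add_assoc, psum_succ, h1, h2, show b - (x + 1) = y by omega,
      show b - 1 - x = y by omega, sgn_opp ε (show (a + x) % 2 ≠ y % 2 by omega)]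
    ring

end Explicit

/-! ### The tangles used below -/

section Concrete

/-- Extension of a function on `Fin L` by zero. -/
def ext0 {L : ℕ} (w : Fin L → ℤ) (x : ℕ) : ℤ := if h : x < L then w ⟨x, h⟩ else 0

theorem ext0_val {L : ℕ} (w : Fin L → ℤ) (x : Fin L) : ext0 w x = w x := by simp [ext0]

theorem sgn_mul (ε : Bool) (n x : ℕ) (a : ℤ) :
    (if colour ⟨n, ε⟩ x then a else -a) = sgn ε x * a := by
  rw [sgn, colour_congr ε n 0 (rfl : x % 2 = x % 2)]
  split_ifs <;> simp

/-- The signed sum around a disc, as a partial sum. -/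
theorem sum_eq_psum (ε : Bool) (n : ℕ) (f : Fin (2 * n) → ℤ) (W : ℕ → ℤ)
    (h : ∀ j : Fin (2 * n), f j = W j) :
    ∑ j : Fin (2 * n), (if colour ⟨n, ε⟩ j then f j else - f j) = psum ε W (2 * n) := by
  rw [psum, Finset.sum_range]
  refine Finset.sum_congr rfl fun j _ => ?_
  rw [sgn_mul, h]

/-- The strings of the identity tangle are radial. -/
def idStr (b : DiscType) : Pt (fun _ : Unit => b) b → Fin (2 * b.half)
  | ⟨none, j⟩ => j
  | ⟨some _, j⟩ => j

/-- The identity tangle: the point `j` of the inner disc is joined to the point `j` of the outer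
disc by a radial string, and the two distinguished intervals touch the same region. -/
def idTangle (b : DiscType) : Tangle (fun _ : Unit => b) b :=
  Tangle.explicit (idStr b) (fun s => ⟨none, s⟩) (fun _ => 0) (fun _ => 0)
    (fun s => rfl)
    (by
      rintro ⟨_ | i, j⟩ ⟨_ | i', j'⟩ h h'
      · have : j = j' := h
        rw [this]
      · have : j = j' := h
        subst this
        simp [isSource, ivColour, before] at h'
      · have : j = j' := h
        subst this
        simp [isSource, ivColour, before] at h'
      · have : j = j' := h
        rw [this])
    (by
      rintro ⟨_ | i, j⟩
      · exact ⟨⟨some (), j⟩, rfl, by simp [isSource, ivColour, before]⟩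
      · exact ⟨⟨none, j⟩, rfl, by simp [isSource, ivColour, before]⟩)
    (fun _ => rfl)
    (by
      obtain ⟨n, ε⟩ := b
      intro w hw
      have h0 : psum ε (ext0 w) (2 * n) = 0 := by
        rw [← sum_eq_psum ε n w (ext0 w) fun j => (ext0_val w j).symm]
        simpa [isSource, ivColour, before, idStr] using hw ()
      refine ⟨fun _ j => - psum ε (ext0 w) j, ?_, ?_, ?_, fun _ => rfl⟩
      · have key : ∀ j : Fin (2 * n), - psum ε (ext0 w) j - - psum ε (ext0 w) (j + 1) =
          if colour ⟨n, ε⟩ j then w j else - w j := by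
          intro j
          rw [psum_succ, sgn_mul, ext0_val]
          ring
        rintro ⟨_ | i, j⟩
        · exact key j
        · exact key j
      · rintro (_ | i) <;> simp [h0, psum_zero]
      · rintro ⟨_ | i, j⟩
        · exact Or.inl ⟨rfl, rfl⟩
        · exact Or.inl ⟨rfl, rfl⟩)

/-- The string at a point of `unitTangle`: the point `p` is joined to `2 * k - 1 - p`. -/
def unitStr (k : ℕ) (ε : Bool) : Pt (Empty.elim : Empty → DiscType) ⟨k, ε⟩ → Fin k
  | ⟨none, j⟩ => ⟨if j.1 < k then j.1 else 2 * k - 1 - j.1, by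
      have h : j.1 < 2 * k := j.2
      split_ifs <;> omega⟩

/-- The tangle without inner discs whose strings are `k` parallel horizontal lines, from the `k`
points on the left of the outer disc to the `k` points on its right. -/
def unitTangle (k : ℕ) (ε : Bool) : Tangle (Empty.elim : Empty → DiscType) ⟨k, ε⟩ :=
  Tangle.explicit (unitStr k ε) (fun s => ⟨none, ⟨s.1, by simp only; omega⟩⟩) (fun i => i.elim)
    (fun i => i.elim)
    (fun s => by simp [unitStr])
    (by
      rintro ⟨_ | i, j⟩ ⟨_ | i', j'⟩ h h'
      · have h1 : j.1 < 2 * k := j.2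
        have h2 : j'.1 < 2 * k := j'.2
        have h3 : colour ⟨k, ε⟩ j = colour ⟨k, ε⟩ j' := by
          simpa [isSource, ivColour, before] using h'
        rw [colour_eq_iff] at h3
        have h4 := congrArg Fin.val h
        simp only [unitStr] at h4
        have : j = j' := by
          apply Fin.ext
          split_ifs at h4 <;> omega
        rw [this]
      · exact i'.elim
      · exact i.elim
      · exact i.elim)
    (by
      rintro ⟨_ | i, j⟩
      · have h1 : j.1 < 2 * k := j.2
        refine ⟨⟨none, ⟨2 * k - 1 - j.1, by simp only; omega⟩⟩, ?_, ?_⟩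
        · apply Fin.ext
          simp only [unitStr]
          split_ifs <;> omega
        · simp only [isSource, ivColour, before, Option.isNone, ne_eq, Bool.xor_left_inj,
            Fin.val_castSucc]
          rw [colour_eq_iff]
          omega
      · exact i.elim)
    (fun i => i.elim)
    (by
      intro w _
      have hW : ∀ x < k, (fun x => if x < k then ext0 w x else ext0 w (2 * k - 1 - x)) (k + x) =
          (fun x => if x < k then ext0 w x else ext0 w (2 * k - 1 - x)) (k - 1 - x) := by
        intro x hx
        simp only
        rw [if_neg (by omega), if_pos (by omega)]
        congr 1
        omega
      set W : ℕ → ℤ := fun x => if x < k then ext0 w x else ext0 w (2 * k - 1 - x) with hWdef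
      have hw : ∀ j : Fin (2 * k), w (unitStr k ε ⟨none, j⟩) = W j := by
        intro j
        rw [← ext0_val w, hWdef]
        simp only [unitStr]
        split_ifs <;> rfl
      have key := psum_opp ε W W k k k le_rfl rfl 0 (by simp) hW
      refine ⟨fun _ j => - psum ε W j, ?_, ?_, ?_, fun i => i.elim⟩
      · rintro ⟨_ | i, j⟩
        · change - psum ε W j - - psum ε W (j + 1) =
            if colour ⟨k, ε⟩ j then w (unitStr k ε ⟨none, j⟩) else - w (unitStr k ε ⟨none, j⟩)
          rw [psum_succ, sgn_mul, hw]
          ring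
        · exact i.elim
      · rintro (_ | i)
        · have := key k le_rfl
          rw [Nat.sub_self, add_zero, ← two_mul] at this
          simp [this, psum_zero]
        · exact i.elim
      · rintro ⟨_ | i, j⟩
        · have h1 : j.1 < 2 * k := j.2
          by_cases hj : j.1 < k
          · left
            simp [unitStr, hj, ivColour, before]
          · right
            constructor
            · simp only [ivColour, before, unitStr, hj, if_false, Fin.val_castSucc]
              rw [colour_eq_not_iff]
              omega
            · simp only [unitStr, hj, if_false]
              have := key (j - k) (by omega)
              rw [show k + (j.1 - k) = j by omega,
                show k - (j.1 - k) = 2 * k - 1 - j + 1 by omega, add_zero] at this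
              rw [this]
        · exact i.elim)

/-- The string at a point of `turnTangle n k`. -/
def turnStr (n k : ℕ) (ε : Bool) :
    Pt (fun _ : Unit => (⟨n + k, ε⟩ : DiscType)) ⟨n + k, ε⟩ → Fin (2 * (n + k))
  | ⟨none, j⟩ => j
  | ⟨some _, j⟩ => ⟨if j.1 < 2 * k then j.1 + 2 * n else j.1 - 2 * k, by
      have h : j.1 < 2 * (n + k) := j.2
      split_ifs <;> omega⟩

/-- The rotation which joins the point `j` of the inner disc to the point `j + 2 * n`
(modulo `2 * (n + k)`) of the outer disc by a radial string. -/
def turnTangle (n k : ℕ) (ε : Bool) :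
    Tangle (fun _ : Unit => (⟨n + k, ε⟩ : DiscType)) ⟨n + k, ε⟩ :=
  Tangle.explicit (turnStr n k ε) (fun s => ⟨none, s⟩)
    (fun _ => ⟨2 * k, by simp only; omega⟩) (fun _ => 0)
    (fun s => rfl)
    (by
      rintro ⟨_ | i, j⟩ ⟨_ | i', j'⟩ h h' <;> have h4 := congrArg Fin.val h <;>
        simp only [turnStr] at h4 <;> have h1 : j.1 < 2 * (n + k) := j.2 <;>
        have h2 : j'.1 < 2 * (n + k) := j'.2
      · rw [Fin.ext h4]
      · have h3 : colour ⟨n + k, ε⟩ j' = !colour ⟨n + k, ε⟩ j := by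
          simpa [isSource, ivColour, before] using h'.symm
        rw [colour_eq_not_iff] at h3
        split_ifs at h4 <;> omega
      · have h3 : colour ⟨n + k, ε⟩ j = !colour ⟨n + k, ε⟩ j' := by
          simpa [isSource, ivColour, before] using h'
        rw [colour_eq_not_iff] at h3
        split_ifs at h4 <;> omega
      · have : j = j' := by
          apply Fin.ext
          split_ifs at h4 <;> omega
        rw [this])
    (by
      rintro ⟨_ | i, j⟩ <;> have h1 : j.1 < 2 * (n + k) := j.2
      · refine ⟨⟨some (), ⟨if j.1 < 2 * n then j.1 + 2 * k else j.1 - 2 * n, ?_⟩⟩, ?_, ?_⟩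
        · simp only
          split_ifs <;> omega
        · apply Fin.ext
          simp only [turnStr]
          split_ifs <;> omega
        · have : (colour ⟨n + k, ε⟩ (if j.1 < 2 * n then j.1 + 2 * k else j.1 - 2 * n)) =
              colour ⟨n + k, ε⟩ j := by
            rw [colour_eq_iff]
            split_ifs <;> omega
          simp [isSource, ivColour, before, this]
      · refine ⟨⟨none, turnStr n k ε ⟨some i, j⟩⟩, rfl, ?_⟩
        have : (colour ⟨n + k, ε⟩ (if j.1 < 2 * k then j.1 + 2 * n else j.1 - 2 * k)) =
            colour ⟨n + k, ε⟩ j := by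
          rw [colour_eq_iff]
          split_ifs <;> omega
        simp [isSource, ivColour, before, turnStr, this])
    (fun _ => by
      change colour ⟨n + k, ε⟩ (2 * k) = colour ⟨n + k, ε⟩ 0
      rw [colour_eq_iff]
      omega)
    (by
      intro w hw
      set W := ext0 w with hW
      set U : ℕ → ℤ := fun x => if x < 2 * k then W (x + 2 * n) else W (x - 2 * k) with hU
      have hwU : ∀ i (j : Fin (2 * (n + k))), w (turnStr n k ε ⟨some i, j⟩) = U j := by
        intro i j
        rw [← ext0_val w, hU, hW]
        simp only [turnStr]
        split_ifs <;> rfl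
      have h0 : psum ε U (2 * (n + k)) = 0 := by
        rw [← sum_eq_psum ε (n + k) (fun j => w (turnStr n k ε ⟨some (), j⟩)) U (hwU ())]
        simpa [isSource, ivColour, before] using hw ()
      have k1 := psum_same ε U W (2 * k) 0 (2 * n) (by omega) (psum ε U (2 * k))
        (by simp [psum_zero]) (by
          intro x hx
          rw [hU]
          simp only
          rw [if_neg (by omega)]
          congr 1
          omega)
      have k2 := psum_same ε U W 0 (2 * n) (2 * k) (by omega) (psum ε U (2 * k)) (by
          have := k1 (2 * n) le_rfl
          rw [show 2 * k + 2 * n = 2 * (n + k) by ring, h0, Nat.zero_add] at this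
          rw [psum_zero, this]) (by
          intro x hx
          rw [hU]
          simp only
          rw [if_pos (by omega)]
          congr 1
          omega)
      have k3 : psum ε W (2 * (n + k)) = 0 := by
        have := k2 (2 * k) le_rfl
        rw [Nat.zero_add, show 2 * n + 2 * k = 2 * (n + k) by ring] at this
        linarith
      refine ⟨fun d j => match d with
        | none => - psum ε W j
        | some _ => - psum ε U j + psum ε U (2 * k), ?_, ?_, ?_, ?_⟩
      · rintro ⟨_ | i, j⟩
        · change - psum ε W j - - psum ε W (j + 1) =
            if colour ⟨n + k, ε⟩ j then w j else - w j
          rw [psum_succ, sgn_mul, hW, ext0_val]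
          ring
        · change - psum ε U j + psum ε U (2 * k) - (- psum ε U (j + 1) + psum ε U (2 * k)) =
            if colour ⟨n + k, ε⟩ j then w (turnStr n k ε ⟨some i, j⟩)
              else - w (turnStr n k ε ⟨some i, j⟩)
          rw [psum_succ, sgn_mul, hwU]
          ring
      · rintro (_ | i)
        · simp [k3, psum_zero]
        · simp [h0, psum_zero]
      · rintro ⟨_ | i, j⟩
        · exact Or.inl ⟨rfl, rfl⟩
        · have h1 : j.1 < 2 * (n + k) := j.2
          left
          constructor
          · change colour ⟨n + k, ε⟩ (if j.1 < 2 * k then j.1 + 2 * n else j.1 - 2 * k) =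
              colour ⟨n + k, ε⟩ j
            rw [colour_eq_iff]
            split_ifs <;> omega
          · change - psum ε U j + psum ε U (2 * k) =
              - psum ε W (if j.1 < 2 * k then j.1 + 2 * n else j.1 - 2 * k)
            split_ifs with hj
            · have := k2 j (by omega)
              rw [Nat.zero_add, Nat.add_comm (2 * n)] at this
              linarith
            · have := k1 (j - 2 * k) (by omega)
              rw [Nat.zero_add, show 2 * k + (j.1 - 2 * k) = j by omega] at this
              linarith
      · intro _
        change - psum ε U (2 * k) + psum ε U (2 * k) = - psum ε W 0
        simp [psum_zero])

/-- The types of two inner discs. -/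
abbrev pairDisc (A B : DiscType) : Bool → DiscType
  | false => A
  | true => B

/-- The number of the string at the point `x` of the first box of `starTangle`. -/
def starA (m k i c x : ℕ) : ℕ :=
  if x + i < 2 * m then x
  else if x < 2 * m + k then 2 * (c + k) + (x + i - 2 * m)
  else x + 2 * c - 2 * m

/-- The number of the string at the point `x` of the second box of `starTangle`. -/
def starB (m n k i c x : ℕ) : ℕ :=
  if x < i then 2 * (c + k) + (i - 1 - x)
  else if x < 2 * n + k then x + 2 * m - 2 * i
  else 2 * (c + k) + (i + 2 * n + 2 * k - 1 - x)

/-- The string at a point of `starTangle`.  The strings are numbered as follows: first those which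
end at the points `0, 1, ...` of the outer disc, then the `i + k` strings which join the two
boxes, in the order in which they leave the first box. -/
def starStr (m n k i c : ℕ) (ε : Bool) (hm : i ≤ 2 * m) (hn : i ≤ 2 * n) (hc : c + i = m + n) :
    Pt (pairDisc ⟨m + k, ε⟩ ⟨n + k, ε⟩) ⟨c + k, ε⟩ → Fin (2 * (c + k) + (i + k))
  | ⟨none, x⟩ => ⟨x.1, by
      have h : x.1 < 2 * (c + k) := x.2
      omega⟩
  | ⟨some false, x⟩ => ⟨starA m k i c x, by
      have h : x.1 < 2 * (m + k) := x.2
      unfold starA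
      split_ifs <;> omega⟩
  | ⟨some true, x⟩ => ⟨starB m n k i c x, by
      have h : x.1 < 2 * (n + k) := x.2
      unfold starB
      split_ifs <;> omega⟩

/-- One of the two ends of a string of `starTangle`. -/
def starRep (m n k i c : ℕ) (ε : Bool) (hm : i ≤ 2 * m)
    (s : Fin (2 * (c + k) + (i + k))) : Pt (pairDisc ⟨m + k, ε⟩ ⟨n + k, ε⟩) ⟨c + k, ε⟩ :=
  if h : s.1 < 2 * (c + k) then ⟨none, ⟨s.1, h⟩⟩
  else ⟨some false, ⟨s.1 - 2 * (c + k) + (2 * m - i), by simp only; omega⟩⟩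

/-- The tangle of the `i`-th summand of the product `a ⋆ b`, for `a ∈ P_{m,k}` and `b ∈ P_{n,k}`,
with result in `P_{c,k}` where `c = m + n - i`.

A box in `P_{n,k}` has its distinguished interval at the top left; clockwise from there it has
`2 * n` points on the top (`0, ..., 2 * n - 1`, from left to right), `k` points on the right side
(`2 * n, ..., 2 * n + k - 1`, from top to bottom), no points on the bottom, and `k` points on the
left side (`2 * n + k, ..., 2 * n + 2 * k - 1`, from bottom to top).

The first box stands to the left of the second one.  The last `i` points on the top of the first
box are joined to the first `i` points on the top of the second box by `i` parallel (nested)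
strings; the other top points are joined, in order, to the top of the outer box.  The right
side of the first box is joined to the left side of the second one by `k` parallel strings, and so
are the left sides of the first box and of the outer box, and the right sides of the second box and
of the outer box.  The bottoms of all boxes touch one region. -/
def starTangle (m n k i c : ℕ) (ε : Bool) (hm : i ≤ 2 * m) (hn : i ≤ 2 * n) (hc : c + i = m + n) :
    Tangle (pairDisc ⟨m + k, ε⟩ ⟨n + k, ε⟩) ⟨c + k, ε⟩ :=
  Tangle.explicit (starStr m n k i c ε hm hn hc) (starRep m n k i c ε hm)
    (fun b => match b with
      | false => ⟨2 * m + k, by simp only; omega⟩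
      | true => ⟨2 * n + k, by simp only [pairDisc]; omega⟩)
    (fun _ => ⟨2 * c + k, by simp only; omega⟩)
    (fun s => by
      have hs := s.2
      apply Fin.ext
      unfold starRep
      split_ifs with h
      · rfl
      · simp only [starStr, starA]
        split_ifs <;> omega)
    (by
      rintro ⟨_ | _ | _, x⟩ ⟨_ | _ | _, y⟩ h h' <;> have h4 := congrArg Fin.val h <;>
        have hx := x.2 <;> have hy := y.2 <;>
        simp only [disc, pairDisc] at hx hy <;>
        simp only [starStr, starA, starB] at h4 <;>
        simp only [isSource, ivColour, before, disc, Option.isNone, Fin.val_castSucc,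
          Bool.xor_false, Bool.xor_true, Bool.not_inj_iff, pairDisc, colour_eq_iff,
          not_colour_eq_iff, colour_eq_not_iff] at h'
      · rw [Fin.ext h4]
      · split_ifs at h4 <;> omega
      · split_ifs at h4 <;> omega
      · split_ifs at h4 <;> omega
      · rw [show x = y from Fin.ext (by split_ifs at h4 <;> omega)]
      · split_ifs at h4 <;> omega
      · split_ifs at h4 <;> omega
      · split_ifs at h4 <;> omega
      · rw [show x = y from Fin.ext (by split_ifs at h4 <;> omega)])
    (by
      have mk : ∀ p q : Pt (pairDisc ⟨m + k, ε⟩ ⟨n + k, ε⟩) ⟨c + k, ε⟩,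
          (starStr m n k i c ε hm hn hc q).1 = (starStr m n k i c ε hm hn hc p).1 →
          isSource q ≠ isSource p →
          ∃ q, starStr m n k i c ε hm hn hc q = starStr m n k i c ε hm hn hc p ∧
            isSource q ≠ isSource p := fun p q h1 h2 => ⟨q, Fin.ext h1, h2⟩
      rintro ⟨_ | _ | _, x⟩ <;> have hx := x.2 <;> simp only [disc, pairDisc] at hx
      · by_cases h1 : x.1 + i < 2 * m
        · refine mk _ ⟨some false, ⟨x.1, by simp only [disc, pairDisc]; omega⟩⟩ ?_ ?_
          · simp only [starStr, starA, if_pos h1]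
          · simp only [isSource, ivColour, before, disc, Option.isNone, Fin.val_castSucc,
              Bool.xor_false, Bool.xor_true, pairDisc, ne_eq, colour_eq_not_iff]
            exact not_not_intro trivial
        · by_cases h2 : x.1 < 2 * c + k
          · refine mk _ ⟨some true, ⟨x.1 + 2 * i - 2 * m, by simp only [disc, pairDisc]; omega⟩⟩
              ?_ ?_
            · simp only [starStr, starB]
              split_ifs <;> omega
            · simp only [isSource, ivColour, before, disc, Option.isNone, Fin.val_castSucc,
                Bool.xor_false, Bool.xor_true, pairDisc, ne_eq, colour_eq_not_iff]
              omega
          · refine mk _ ⟨some false, ⟨x.1 + 2 * m - 2 * c, by simp only [disc, pairDisc]; omega⟩⟩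
              ?_ ?_
            · simp only [starStr, starA]
              split_ifs <;> omega
            · simp only [isSource, ivColour, before, disc, Option.isNone, Fin.val_castSucc,
                Bool.xor_false, Bool.xor_true, pairDisc, ne_eq, colour_eq_not_iff]
              omega
      · by_cases h1 : x.1 + i < 2 * m ∨ 2 * m + k ≤ x.1
        · refine mk _ ⟨none, ⟨starA m k i c x, ?_⟩⟩ rfl ?_
          · simp only [disc, starA]
            split_ifs <;> omega
          · simp only [isSource, ivColour, before, disc, Option.isNone, Fin.val_castSucc,
              Bool.xor_false, Bool.xor_true, pairDisc, ne_eq, not_colour_eq_iff, starA]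
            split_ifs <;> omega
        · by_cases h2 : x.1 < 2 * m
          · refine mk _ ⟨some true, ⟨2 * m - 1 - x.1, by simp only [disc, pairDisc]; omega⟩⟩ ?_ ?_
            · simp only [starStr, starA, starB]
              split_ifs <;> omega
            · simp only [isSource, ivColour, before, disc, Option.isNone, Fin.val_castSucc,
                Bool.xor_false, pairDisc, ne_eq, colour_eq_iff]
              omega
          · refine mk _ ⟨some true, ⟨2 * n + 2 * k - 1 - (x.1 - 2 * m),
              by simp only [disc, pairDisc]; omega⟩⟩ ?_ ?_
            · simp only [starStr, starA, starB]
              split_ifs <;> omega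
            · simp only [isSource, ivColour, before, disc, Option.isNone, Fin.val_castSucc,
                Bool.xor_false, pairDisc, ne_eq, colour_eq_iff]
              omega
      · by_cases h1 : i ≤ x.1 ∧ x.1 < 2 * n + k
        · refine mk _ ⟨none, ⟨starB m n k i c x, ?_⟩⟩ rfl ?_
          · simp only [disc, starB]
            split_ifs <;> omega
          · simp only [isSource, ivColour, before, disc, Option.isNone, Fin.val_castSucc,
              Bool.xor_false, Bool.xor_true, pairDisc, ne_eq, not_colour_eq_iff, starB]
            split_ifs <;> omega
        · by_cases h2 : x.1 < i
          · refine mk _ ⟨some false, ⟨2 * m - 1 - x.1, by simp only [disc, pairDisc]; omega⟩⟩ ?_ ?_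
            · simp only [starStr, starA, starB]
              split_ifs <;> omega
            · simp only [isSource, ivColour, before, disc, Option.isNone, Fin.val_castSucc,
                Bool.xor_false, pairDisc, ne_eq, colour_eq_iff]
              omega
          · refine mk _ ⟨some false, ⟨2 * m + (2 * n + 2 * k - 1 - x.1),
              by simp only [disc, pairDisc]; omega⟩⟩ ?_ ?_
            · simp only [starStr, starA, starB]
              split_ifs <;> omega
            · simp only [isSource, ivColour, before, disc, Option.isNone, Fin.val_castSucc,
                Bool.xor_false, pairDisc, ne_eq, colour_eq_iff]
              omega)
    (by
      rintro (_ | _)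
      · change colour ⟨m + k, ε⟩ (2 * m + k) = colour ⟨c + k, ε⟩ (2 * c + k)
        rw [colour_eq_iff]
        omega
      · change colour ⟨n + k, ε⟩ (2 * n + k) = colour ⟨c + k, ε⟩ (2 * c + k)
        rw [colour_eq_iff]
        omega)
    (by
      intro w hw
      set W := ext0 w with hW
      set A : ℕ → ℤ := fun x => W (starA m k i c x) with hA
      set B : ℕ → ℤ := fun x => W (starB m n k i c x) with hB
      have hwA : ∀ x : Fin (2 * (m + k)),
          w (starStr m n k i c ε hm hn hc ⟨some false, x⟩) = A x :=
        fun x => (ext0_val w (starStr m n k i c ε hm hn hc ⟨some false, x⟩)).symm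
      have hwB : ∀ x : Fin (2 * (n + k)),
          w (starStr m n k i c ε hm hn hc ⟨some true, x⟩) = B x :=
        fun x => (ext0_val w (starStr m n k i c ε hm hn hc ⟨some true, x⟩)).symm
      have hwO : ∀ x : Fin (2 * (c + k)),
          w (starStr m n k i c ε hm hn hc ⟨none, x⟩) = W x :=
        fun x => (ext0_val w (starStr m n k i c ε hm hn hc ⟨none, x⟩)).symm
      have hA0 : psum ε A (2 * (m + k)) = 0 := by
        rw [← sum_eq_psum ε (m + k) _ A hwA]
        simpa [isSource, ivColour, before] using hw false
      have hB0 : psum ε B (2 * (n + k)) = 0 := by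
        rw [← sum_eq_psum ε (n + k) _ B hwB]
        simpa [isSource, ivColour, before] using hw true
      -- the top left of the first box
      have k1 := psum_same ε W A 0 0 (2 * m - i) rfl 0 (by simp [psum_zero]) (by
        intro x hx
        simp only [hA, starA]
        rw [if_pos (by omega)])
      -- the strings that join the tops of the boxes
      have k2 := psum_opp ε B A 0 (2 * m) i hm (by omega) (- psum ε A (2 * m))
        (by simp [psum_zero]) (by
        intro x hx
        simp only [hA, hB, starA, starB]
        congr 1
        split_ifs <;> omega)
      -- the strings from the second box to the outer box
      have k3 := psum_same ε W B (2 * m - i) i (2 * n + k - i) (by omega) (psum ε A (2 * m)) (by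
        have e1 := k1 (2 * m - i) le_rfl
        have e2 := k2 i le_rfl
        rw [Nat.zero_add] at e1 e2
        rw [e1, e2]
        ring) (by
        intro x hx
        simp only [hB, starB]
        congr 1
        split_ifs <;> omega)
      -- the strings that join the sides of the boxes
      have k4 := psum_opp ε A B (2 * m) (2 * n + 2 * k) k (by omega) (by omega) (psum ε A (2 * m))
        (by rw [show 2 * n + 2 * k = 2 * (n + k) by ring, hB0]; ring) (by
        intro x hx
        simp only [hA, hB, starA, starB]
        congr 1
        split_ifs <;> omega)
      -- the left side of the first box
      have k5 := psum_same ε W A (2 * c + k) (2 * m + k) k (by omega) 0 (by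
        have e3 := k3 (2 * n + k - i) le_rfl
        have e4 := k4 k le_rfl
        rw [show 2 * m - i + (2 * n + k - i) = 2 * c + k by omega,
          show i + (2 * n + k - i) = 2 * n + k by omega] at e3
        rw [show 2 * n + 2 * k - k = 2 * n + k by omega] at e4
        rw [e3, e4]
        ring) (by
        intro x hx
        simp only [hA, starA]
        congr 1
        split_ifs <;> omega)
      have hO0 : psum ε W (2 * (c + k)) = 0 := by
        have := k5 k le_rfl
        rw [show 2 * c + k + k = 2 * (c + k) by ring, show 2 * m + k + k = 2 * (m + k) by ring,
          hA0] at this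
        simpa using this
      refine ⟨fun d j => match d with
        | none => - psum ε W j
        | some false => - psum ε A j
        | some true => - psum ε B j - psum ε A (2 * m), ?_, ?_, ?_, ?_⟩
      · rintro ⟨_ | _ | _, x⟩
        · change - psum ε W x - - psum ε W (x + 1) =
            if colour ⟨c + k, ε⟩ x then w (starStr m n k i c ε hm hn hc ⟨none, x⟩)
              else - w (starStr m n k i c ε hm hn hc ⟨none, x⟩)
          rw [psum_succ, sgn_mul, hwO]
          ring
        · change - psum ε A x - - psum ε A (x + 1) =
            if colour ⟨m + k, ε⟩ x then w (starStr m n k i c ε hm hn hc ⟨some false, x⟩)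
              else - w (starStr m n k i c ε hm hn hc ⟨some false, x⟩)
          rw [psum_succ, sgn_mul, hwA]
          ring
        · change - psum ε B x - psum ε A (2 * m) - (- psum ε B (x + 1) - psum ε A (2 * m)) =
            if colour ⟨n + k, ε⟩ x then w (starStr m n k i c ε hm hn hc ⟨some true, x⟩)
              else - w (starStr m n k i c ε hm hn hc ⟨some true, x⟩)
          rw [psum_succ, sgn_mul, hwB]
          ring
      · rintro (_ | _ | _)
        · simp [hO0, psum_zero]
        · simp [hA0, psum_zero]
        · simp [hB0, psum_zero]
      · rintro ⟨_ | _ | _, x⟩ <;> have hx := x.2 <;> simp only [disc, pairDisc] at hx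
        · left
          have : starRep m n k i c ε hm (starStr m n k i c ε hm hn hc ⟨none, x⟩) =
            ⟨none, x⟩ := by
            exact dif_pos hx
          rw [this]
          exact ⟨rfl, rfl⟩
        · left
          by_cases h : starA m k i c x < 2 * (c + k)
          · have : starRep m n k i c ε hm (starStr m n k i c ε hm hn hc ⟨some false, x⟩) =
              ⟨none, ⟨starA m k i c x, h⟩⟩ := by
              exact dif_pos h
            rw [this]
            constructor
            · change colour ⟨c + k, ε⟩ (starA m k i c x) = colour ⟨m + k, ε⟩ x
              rw [colour_eq_iff]
              unfold starA at h ⊢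
              split_ifs at h ⊢ <;> omega
            · change - psum ε A x = - psum ε W (starA m k i c x)
              unfold starA at h ⊢
              split_ifs at h ⊢ with h1 h2
              · have := k1 x (by omega)
                rw [Nat.zero_add] at this
                linarith
              · omega
              · have := k5 (x - (2 * m + k)) (by omega)
                rw [show 2 * c + k + (x.1 - (2 * m + k)) = x + 2 * c - 2 * m by omega,
                  show 2 * m + k + (x.1 - (2 * m + k)) = x by omega] at this
                linarith
          · have : starRep m n k i c ε hm (starStr m n k i c ε hm hn hc ⟨some false, x⟩) =
              ⟨some false, x⟩ := by
              refine (dif_neg h).trans ?_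
              congr 1
              apply Fin.ext
              change starA m k i c x - 2 * (c + k) + (2 * m - i) = x.1
              unfold starA at h ⊢
              split_ifs at h ⊢ <;> omega
            rw [this]
            exact ⟨rfl, rfl⟩
        · by_cases h : starB m n k i c x < 2 * (c + k)
          · left
            have : starRep m n k i c ε hm (starStr m n k i c ε hm hn hc ⟨some true, x⟩) =
              ⟨none, ⟨starB m n k i c x, h⟩⟩ := by
              exact dif_pos h
            rw [this]
            constructor
            · change colour ⟨c + k, ε⟩ (starB m n k i c x) = colour ⟨n + k, ε⟩ x
              rw [colour_eq_iff]
              unfold starB at h ⊢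
              split_ifs at h ⊢ <;> omega
            · change - psum ε B x - psum ε A (2 * m) = - psum ε W (starB m n k i c x)
              unfold starB at h ⊢
              split_ifs at h ⊢ with h1 h2
              · omega
              · have := k3 (x - i) (by omega)
                rw [show 2 * m - i + (x.1 - i) = x + 2 * m - 2 * i by omega,
                  show i + (x.1 - i) = x by omega] at this
                linarith
              · omega
          · right
            by_cases h1 : x.1 < i
            · have : starRep m n k i c ε hm (starStr m n k i c ε hm hn hc ⟨some true, x⟩) =
                ⟨some false, ⟨2 * m - 1 - x, by simp only [disc, pairDisc]; omega⟩⟩ := by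
                refine (dif_neg h).trans ?_
                congr 1
                apply Fin.ext
                change starB m n k i c x - 2 * (c + k) + (2 * m - i) = 2 * m - 1 - x.1
                simp only [starB, if_pos h1]
                omega
              rw [this]
              constructor
              · change colour ⟨m + k, ε⟩ (2 * m - 1 - x) = !colour ⟨n + k, ε⟩ x
                rw [colour_eq_not_iff]
                omega
              · change - psum ε B x - psum ε A (2 * m) = - psum ε A (2 * m - 1 - x + 1)
                have := k2 x (by omega)
                rw [Nat.zero_add, show 2 * m - x.1 = 2 * m - 1 - x + 1 by omega] at this
                linarith
            · have h2 : ¬ x.1 < 2 * n + k := by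
                intro h2
                apply h
                simp only [starB, if_neg h1, if_pos h2]
                omega
              have : starRep m n k i c ε hm (starStr m n k i c ε hm hn hc ⟨some true, x⟩) =
                ⟨some false, ⟨2 * m + (2 * n + 2 * k - 1 - x),
                  by simp only [disc, pairDisc]; omega⟩⟩ := by
                refine (dif_neg h).trans ?_
                congr 1
                apply Fin.ext
                change starB m n k i c x - 2 * (c + k) + (2 * m - i) =
                  2 * m + (2 * n + 2 * k - 1 - x.1)
                simp only [starB, if_neg h1, if_neg h2]
                omega
              rw [this]
              constructor
              · change colour ⟨m + k, ε⟩ (2 * m + (2 * n + 2 * k - 1 - x)) =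
                  !colour ⟨n + k, ε⟩ x
                rw [colour_eq_not_iff]
                omega
              · change - psum ε B x - psum ε A (2 * m) =
                  - psum ε A (2 * m + (2 * n + 2 * k - 1 - x) + 1)
                have := k4 (2 * n + 2 * k - x) (by omega)
                rw [show 2 * n + 2 * k - (2 * n + 2 * k - x.1) = x by omega,
                  show 2 * m + (2 * n + 2 * k - x.1) = 2 * m + (2 * n + 2 * k - 1 - x) + 1 by
                    omega] at this
                linarith
      · rintro (_ | _)
        · change - psum ε A (2 * m + k) = - psum ε W (2 * c + k)
          have := k5 0 (Nat.zero_le _)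
          simp only [add_zero] at this
          linarith
        · change - psum ε B (2 * n + k) - psum ε A (2 * m) = - psum ε W (2 * c + k)
          have := k3 (2 * n + k - i) le_rfl
          rw [show 2 * m - i + (2 * n + k - i) = 2 * c + k by omega,
            show i + (2 * n + k - i) = 2 * n + k by omega] at this
          linarith)

end Concrete

end PlanarTangle

open PlanarTangle

universe u

/-- A (shaded) planar algebra over `ℂ`: vector spaces `V b` indexed by the types of discs (so
`V ⟨n, ε⟩` is `P_{n,±}`), on which the planar tangles act by multilinear maps, depending only on
the isotopy class of the tangle, naturally in the labelling of the inner discs, and compatibly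
with gluing; the identity tangles act by the identity. -/
structure PlanarAlgebra where
  V : DiscType → Type u
  [addCommGroup : ∀ b, AddCommGroup (V b)]
  [module : ∀ b, Module ℂ (V b)]
  Z : ∀ {I : Type} {inn : I → DiscType} {out : DiscType}, Tangle inn out →
    MultilinearMap ℂ (fun i => V (inn i)) (V out)
  Z_iso : ∀ {I : Type} {inn : I → DiscType} {out : DiscType} (T T' : Tangle inn out),
    Tangle.Iso T T' → Z T = Z T'
  Z_relabel : ∀ {I J : Type} {inn : I → DiscType} {out : DiscType} (T : Tangle inn out)
    (e : J ≃ I) (x : ∀ i, V (inn i)), Z (T.relabel e) (fun j => x (e j)) = Z T x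
  Z_id : ∀ (b : DiscType) (x : V b), Z (idTangle b) (fun _ => x) = x
  Z_comp : ∀ {I : Type} {inn : I → DiscType} {out : DiscType} {J : I → Type}
    {sub : ∀ i, J i → DiscType} (T : Tangle inn out) (S : ∀ i, Tangle (sub i) (inn i))
    (x : ∀ i j, V (sub i j)),
    Z (T.comp S) (fun y => x y.1 y.2) = Z T (fun i => Z (S i) (x i))

namespace PlanarAlgebra

attribute [instance] PlanarAlgebra.addCommGroup PlanarAlgebra.module

/-- The identity `1 ∈ P_{k,±}`: `k` parallel horizontal strings.  For `k = 0` this is the value of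
the empty tangle. -/
def one (P : PlanarAlgebra.{u}) (k : ℕ) (ε : Bool) : P.V ⟨k, ε⟩ :=
  P.Z (unitTangle k ε) (fun e => e.elim)

/-- A pair of vectors, as a family of labels of two inner discs. -/
def pairVec (P : PlanarAlgebra.{u}) {A B : DiscType} (x : P.V A) (y : P.V B) :
    ∀ i, P.V (pairDisc A B i)
  | false => x
  | true => y

/-- The bilinear map given by a tangle with two inner discs. -/
def bilin (P : PlanarAlgebra.{u}) {A B C : DiscType} (T : Tangle (pairDisc A B) C) :
    P.V A →ₗ[ℂ] P.V B →ₗ[ℂ] P.V C :=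
  LinearMap.mk₂ ℂ (fun x y => P.Z T (P.pairVec x y))
    (fun x x' y => by
      have h : ∀ z, P.pairVec z y = Function.update (P.pairVec x y) false z := fun z => by
        funext i; cases i <;> rfl
      rw [h (x + x'), h x', (P.Z T).map_update_add, ← h, ← h])
    (fun c x y => by
      have h : ∀ z, P.pairVec z y = Function.update (P.pairVec x y) false z := fun z => by
        funext i; cases i <;> rfl
      rw [h (c • x), (P.Z T).map_update_smul, ← h])
    (fun x y y' => by
      have h : ∀ z, P.pairVec x z = Function.update (P.pairVec x y) true z := fun z => by
        funext i; cases i <;> rfl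
      rw [h (y + y'), h y', (P.Z T).map_update_add, ← h, ← h])
    (fun c x y => by
      have h : ∀ z, P.pairVec x z = Function.update (P.pairVec x y) true z := fun z => by
        funext i; cases i <;> rfl
      rw [h (c • y), (P.Z T).map_update_smul, ← h])

end PlanarAlgebra

/-- A subfactor planar algebra: a planar algebra with conjugate-linear involutions `invol` on the
spaces `V b` that intertwine the action of a tangle with that of its mirror image, with finite
dimensional spaces, one-dimensional `P_{0,±}`, which is spherical (the value of a tangle without
outer boundary points does not change when the outer disc is moved to another region of the
sphere), and for which the sesquilinear form `⟨x, y⟩`, given by joining all the points of the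
two boxes labelled `x` and `y*` in pairs, is positive definite. -/
structure SubfactorPlanarAlgebra extends PlanarAlgebra.{u} where
  invol : ∀ {b : DiscType}, V b → V b
  invol_add : ∀ {b : DiscType} (x y : V b), invol (x + y) = invol x + invol y
  invol_smul : ∀ {b : DiscType} (c : ℂ) (x : V b), invol (c • x) = conj c • invol x
  invol_invol : ∀ {b : DiscType} (x : V b), invol (invol x) = x
  invol_Z : ∀ {I : Type} {inn : I → DiscType} {out : DiscType} (T : Tangle inn out)
    (x : ∀ i, V (inn i)), invol (Z T x) = Z T.reflect (fun i => invol (x i))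
  finite_dim : ∀ b, FiniteDimensional ℂ (V b)
  dim_zero : ∀ ε, Module.finrank ℂ (V ⟨0, ε⟩) = 1
  spherical : ∀ {I : Type} {inn : I → DiscType} {ε : Bool} (T : Tangle inn ⟨0, ε⟩) (r : T.Reg)
    (x : ∀ i, V (inn i)), ∃ c : ℂ, Z T x = c • toPlanarAlgebra.one 0 ε ∧
      Z (T.moveOuter r) x = c • toPlanarAlgebra.one 0 (T.shade r)
  pos_def : ∀ (n : ℕ) (ε : Bool) (x : V ⟨n, ε⟩), x ≠ 0 → ∃ t : ℝ, 0 < t ∧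
    toPlanarAlgebra.bilin (starTangle n n 0 (2 * n) 0 ε le_rfl le_rfl (by omega)) x (invol x) =
      (t : ℂ) • toPlanarAlgebra.one 0 ε

namespace SubfactorPlanarAlgebra

/-- The graded vector space `Gr_k(P) = ⨁ n, P_{n,k}`, where `P_{n,k} = P_{n+k}`.  Here `ε` is the
shading of the distinguished intervals (`false`, i.e. unshaded, in the usual convention
`P_n = P_{n,+}`). -/
abbrev Gr (P : SubfactorPlanarAlgebra.{u}) (ε : Bool) (k : ℕ) : Type u :=
  ⨁ n : ℕ, P.V ⟨n + k, ε⟩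

variable (P : SubfactorPlanarAlgebra.{u}) (ε : Bool) (k : ℕ)

/-- The product `⋆ : P_{m,k} × P_{n,k} → Gr_k(P)`: the sum over `0 ≤ i ≤ min (2 * m) (2 * n)` of the
elements of `P_{m+n-i,k}` given by the tangles with `i` strings joining the tops of the boxes. -/
def mulHom (m n : ℕ) : P.V ⟨m + k, ε⟩ →ₗ[ℂ] P.V ⟨n + k, ε⟩ →ₗ[ℂ] P.Gr ε k :=
  ∑ i : Fin (min (2 * m) (2 * n) + 1),
    (P.bilin (starTangle m n k i (m + n - i) ε (by omega) (by omega) (by omega))).compr₂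
      (DirectSum.lof ℂ ℕ (fun n => P.V ⟨n + k, ε⟩) (m + n - i))

/-- The product `⋆` on `Gr_k(P)`, extended bilinearly. -/
def mul : P.Gr ε k →ₗ[ℂ] P.Gr ε k →ₗ[ℂ] P.Gr ε k :=
  DirectSum.toModule ℂ ℕ _ fun m =>
    (DirectSum.toModule ℂ ℕ _ fun n => (P.mulHom ε k m n).flip).flip

/-- The identity element of `Gr_k(P)`: the identity of `P_k = P_{0,k}`. -/
def grOne : P.Gr ε k :=
  DirectSum.lof ℂ ℕ (fun n => P.V ⟨n + k, ε⟩) 0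
    (P.one (0 + k) ε)

/-- The involution on `P_{n,k}` coming from the planar algebra: reflect the picture of a box, with
its `k` points on the left, `2 * n` points on the top and `k` points on the right, in a vertical
line.  The reflected box is labelled by `x*` and has its distinguished interval at the top right;
`turnTangle` moves it back to the top left. -/
def involHom (n : ℕ) (x : P.V ⟨n + k, ε⟩) : P.V ⟨n + k, ε⟩ :=
  P.Z (turnTangle n k ε) (fun _ => P.invol x)

/-- The involution on `Gr_k(P)`, degree by degree. -/
def grStar (x : P.Gr ε k) : P.Gr ε k :=
  DFinsupp.mapRange (fun n => P.involHom ε k n) (fun n => by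
    have h : P.invol (0 : P.V ⟨n + k, ε⟩) = 0 := by
      simpa using P.invol_smul (0 : ℂ) (0 : P.V ⟨n + k, ε⟩)
    unfold involHom
    rw [h]
    exact (P.Z (turnTangle n k ε)).map_coord_zero () rfl) x

end SubfactorPlanarAlgebra

/-! Each identity holds because its two sides are the actions of isotopic tangles, up to a
rearrangement of finite sums. Tangles are recorded here by strings, regions and incidences, and a
glued tangle is a quotient, so the task is to recognise isotopic composites without computing the
quotients.

The fact that carries this is a rigidity statement, `Tangle.nonempty_iso`: a tangle in which every
string has an end is determined by the pairing of its marked points together with, for each inner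
disc, one coincidence between a region at that disc and a region at the outer disc. For strings this
is clear. For regions it is a cohomological argument on the sphere: `connected` shows that every
region touches some disc, and `acyclic` transports an integral function on the regions of one tangle
to a function on those of the other with the same jumps across strings. Transporting the indicator
function of a region shows that intervals sharing a region in one tangle share one in the other.

An equation between composites therefore needs only a list of joined points, one region per box
(usually the one at the bottom), and the absence of closed loops. `HasPattern` records these data
and `Z_eq_of_hasPattern` draws the conclusion.

Associativity: a product of three boxes is described by the numbers `x`, `y`, `z` of strings between
the tops of `a` and `b`, of `b` and `c`, and of `a` and `c`. A string from `a` to `c` must pass over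
`b`, which is possible only if no top string of `b` reaches the outer box; so `z = 0` or `x + y = 2
* n`. In `(a ⋆ b) ⋆ c` this picture is the term with indices `(x, y + z)`, in `a ⋆ (b ⋆ c)` the one
with `(y, x + z)`; see `bilin_star_assoc` and `mul_of_assoc`. For the unit only the term without
strings between the tops occurs, and the horizontal strings extend those of `a` (`bilin_one_star`,
`bilin_star_one`). For the involution, the mirror image of a product is the product of the mirror
images in the opposite order (`involHom_bilin`), and the rotation by `2 * n` cancels against its own
mirror image (`involHom_involHom`). -/

namespace PlanarTangle

/-! ### Rigidity of tangles without closed loops -/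

section Rigidity

variable {I : Type} {inn : I → DiscType} {out : DiscType}

theorem Tangle.isSource_ne (T : Tangle inn out) {p q : Pt inn out} (hne : q ≠ p)
    (h : T.str q = T.str p) : isSource q ≠ isSource p :=
  fun hs => hne (T.str_inj q p h hs)

/-- If two tangles join every point to the same other point, then points on the same string of one
tangle are on the same string of the other. -/
theorem Tangle.str_eq_of_str_eq {T T' : Tangle inn out}
    (hstr : ∀ p, ∃ q, q ≠ p ∧ T.str q = T.str p ∧ T'.str q = T'.str p) {p r : Pt inn out}
    (h : T.str p = T.str r) : T'.str p = T'.str r := by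
  by_cases hpr : r = p
  · rw [hpr]
  obtain ⟨q, hq, h1, h2⟩ := hstr p
  have h3 := T.isSource_ne hq h1
  have h4 := T.isSource_ne hpr h.symm
  -- Both `q` and `r` are ends of the string of `p` with the orientation opposite to that of `p`,
  -- and a string has only one such end.
  have : q = r := T.str_inj q r (h1.trans h) (by
    revert h3 h4
    cases isSource q <;> cases isSource p <;> cases isSource r <;> simp)
  rw [← this, h2]

theorem isSource_some (i : I) (j : Fin (2 * (disc inn out (some i)).half)) :
    isSource (⟨some i, j⟩ : Pt inn out) = ivColour (before (⟨some i, j⟩ : Pt inn out)) := by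
  simp [isSource]

/-- The jumps of a function on regions form a cycle. -/
theorem Tangle.sum_jump_eq_zero (T : Tangle inn out) (h : T.Reg → ℤ) (i : I) :
    ∑ j : Fin (2 * (disc inn out (some i)).half),
      (if isSource (⟨some i, j⟩ : Pt inn out) then
          h (T.side (T.str ⟨some i, j⟩) true) - h (T.side (T.str ⟨some i, j⟩) false)
        else - (h (T.side (T.str ⟨some i, j⟩) true) - h (T.side (T.str ⟨some i, j⟩) false))) =
      0 := by
  have e (j : Fin (2 * (disc inn out (some i)).half)) :=
    jump_eq T _ h (fun _ => rfl) (⟨some i, j⟩ : Pt inn out)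
  simp only [isSource_some]
  -- Each summand is the increment of `h` between the two intervals next to a point, so the sum
  -- telescopes around the disc; `reg_last` closes the circle.
  rw [← Finset.sum_congr rfl fun j _ => e j, Finset.sum_sub_distrib]
  have e1 := Fin.sum_univ_castSucc fun j => h (T.reg (⟨some i, j⟩ : Iv inn out))
  have e2 := Fin.sum_univ_succ fun j => h (T.reg (⟨some i, j⟩ : Iv inn out))
  have e3 := congrArg h (T.reg_last (some i))
  simp only [before, after]
  linarith

/-- A function on the intervals without increments at the points, and with equal values at one
interval of each inner disc and one of the outer disc, is constant. -/
theorem eq_of_before_eq_after {f : Iv inn out → ℤ} (hf : ∀ p, f (before p) = f (after p))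
    (hbase : ∀ i, ∃ u v, f ⟨some i, u⟩ = f ⟨none, v⟩) (v v' : Iv inn out) : f v = f v' := by
  have hdisc : ∀ d j, f ⟨d, j⟩ = f ⟨d, 0⟩ := by
    intro d j
    induction j using Fin.induction with
    | zero => rfl
    | succ j ih => exact (hf ⟨d, j⟩).symm.trans ih
  have key : ∀ v, f v = f ⟨none, 0⟩ := by
    rintro ⟨_ | i, j⟩
    · exact hdisc none j
    · obtain ⟨u, v, h⟩ := hbase i
      rw [hdisc (some i) j, ← hdisc (some i) u, h, hdisc none v]
  rw [key v, key v']

/-- A region touching no disc would have an indicator function without jumps, since every string has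
an end and its two sides touch a disc there. By `connected` this function would be constant,
although it vanishes at the outer disc. -/
theorem Tangle.reg_surjective (T : Tangle inn out) (hT : Function.Surjective T.str) :
    Function.Surjective T.reg := by
  classical
  intro r
  by_contra hr
  push Not at hr
  have := T.connected (fun r' => if r' = r then 1 else 0) (fun s => by
    obtain ⟨p, rfl⟩ := hT s
    simp [T.side_nb, hr]) r (T.reg ⟨none, 0⟩)
  simp [hr] at this

/-- If `T'` separated `u` from `v`, the indicator function of a region of `T'` would do so. Its
jumps are a cycle on the strings common to both tangles, hence the jumps of a function on the
regions of `T`; up to a constant the two functions agree on all intervals, and the second cannot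
separate `u` from `v`. -/
theorem Tangle.reg_eq_of_reg_eq {T T' : Tangle inn out} (hT : Function.Surjective T.str)
    (hstr : ∀ p, ∃ q, q ≠ p ∧ T.str q = T.str p ∧ T'.str q = T'.str p)
    (hreg : ∀ i, ∃ u v, T.reg ⟨some i, u⟩ = T.reg ⟨none, v⟩ ∧
      T'.reg ⟨some i, u⟩ = T'.reg ⟨none, v⟩) {u v : Iv inn out}
    (huv : T.reg u = T.reg v) : T'.reg u = T'.reg v := by
  classical
  by_contra hne
  set h' : T'.Reg → ℤ := fun r => if r = T'.reg u then 1 else 0 with hh'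
  obtain ⟨e, he⟩ := hT.hasRightInverse
  have hestr (p : Pt inn out) : T'.str (e (T.str p)) = T'.str p :=
    Tangle.str_eq_of_str_eq hstr (he (T.str p))
  -- `e` picks an end of each string of `T`; through it the jumps of `h'` become weights on the
  -- strings of `T`. The cycle condition is the one that holds in `T'`.
  obtain ⟨h, hh⟩ := T.acyclic
    (fun s => h' (T'.side (T'.str (e s)) true) - h' (T'.side (T'.str (e s)) false)) (fun i => by
      simp only [hestr]
      exact T'.sum_jump_eq_zero h' i)
  -- The two functions have equal increments at every point, and the base incidences, which hold in
  -- both tangles, tie the constants on the inner discs to the one on the outer disc.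
  have key := eq_of_before_eq_after (f := fun v => h (T.reg v) - h' (T'.reg v)) (fun p => by
    have e1 := jump_eq T _ h hh p
    have e2 := jump_eq T' _ h' (fun _ => rfl) p
    simp only [hestr] at e1
    linarith) (fun i => by
      obtain ⟨u, v, h1, h2⟩ := hreg i
      exact ⟨u, v, by simp only [h1, h2]⟩) u v
  simp only [huv, hh', if_neg (Ne.symm hne)] at key
  simp at key

/-- A tangle without closed loops is determined by the pairing of the marked points and, for each
inner disc, one incidence with a region at the outer disc. -/
theorem Tangle.nonempty_iso {T T' : Tangle inn out} (hT : Function.Surjective T.str)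
    (hT' : Function.Surjective T'.str)
    (hstr : ∀ p, ∃ q, q ≠ p ∧ T.str q = T.str p ∧ T'.str q = T'.str p)
    (hreg : ∀ i, ∃ u v, T.reg ⟨some i, u⟩ = T.reg ⟨none, v⟩ ∧
      T'.reg ⟨some i, u⟩ = T'.reg ⟨none, v⟩) : Nonempty (Tangle.Iso T T') := by
  have hstr' : ∀ p, ∃ q, q ≠ p ∧ T'.str q = T'.str p ∧ T.str q = T.str p := fun p => by
    obtain ⟨q, h1, h2, h3⟩ := hstr p
    exact ⟨q, h1, h3, h2⟩
  have hreg' : ∀ i, ∃ u v, T'.reg ⟨some i, u⟩ = T'.reg ⟨none, v⟩ ∧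
      T.reg ⟨some i, u⟩ = T.reg ⟨none, v⟩ := fun i => by
    obtain ⟨u, v, h1, h2⟩ := hreg i
    exact ⟨u, v, h2, h1⟩
  -- Two surjections with the same fibres have canonically isomorphic targets. This is applied to
  -- strings, as images of points, and to regions, as images of intervals.
  have lift {X Y Z : Type} {f : X → Y} {g : X → Z} (hf : f.Surjective) (hg : g.Surjective)
      (h1 : ∀ a b, f a = f b → g a = g b) (h2 : ∀ a b, g a = g b → f a = f b) :
      ∃ e : Y ≃ Z, ∀ a, e (f a) = g a := by
    obtain ⟨φ, hφ⟩ := hf.hasRightInverse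
    obtain ⟨ψ, hψ⟩ := hg.hasRightInverse
    refine ⟨⟨fun y => g (φ y), fun z => f (ψ z), fun y => ?_, fun z => ?_⟩,
      fun a => h1 _ _ (hφ _)⟩
    · exact (h2 _ _ (hψ _)).trans (hφ y)
    · exact (h1 _ _ (hφ _)).trans (hψ z)
  obtain ⟨e, he⟩ := lift hT hT' (fun _ _ => Tangle.str_eq_of_str_eq hstr)
    (fun _ _ => Tangle.str_eq_of_str_eq hstr')
  obtain ⟨r, hr⟩ := lift (T.reg_surjective hT) (T'.reg_surjective hT')
    (fun _ _ => Tangle.reg_eq_of_reg_eq hT hstr hreg)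
    (fun _ _ => Tangle.reg_eq_of_reg_eq hT' hstr' hreg')
  refine ⟨⟨e, r, fun s c => ?_, he, hr⟩⟩
  obtain ⟨p, rfl⟩ := hT s
  rw [T.side_nb, hr, he, T'.side_nb]

end Rigidity

/-! ### Patterns: the data that determine a tangle, with named boxes -/

section Patterns

variable {I K : Type} {inn : I → DiscType} {out : DiscType}

/-- The tangle `T`, whose inner discs are named by `ν`, has no closed loops, joins the points
`(d, x)` and `(d', y)` whenever `J d x d' y`, and has the interval `(base i).1` of each inner
disc in the same region as the interval `(base i).2` of the outer disc. -/
structure Tangle.HasPattern (T : Tangle inn out) (ν : I ≃ K)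
    (J : Option K → ℕ → Option K → ℕ → Prop) (base : K → ℕ × ℕ) : Prop where
  surj : Function.Surjective T.str
  join : ∀ p q : Pt inn out, J (p.1.map ν) p.2 (q.1.map ν) q.2 → T.str p = T.str q
  reg : ∀ i u v, u.1 = (base (ν i)).1 → v.1 = (base (ν i)).2 →
    T.reg ⟨some i, u⟩ = T.reg ⟨none, v⟩

/-- The pattern `J, base` determines a tangle with inner discs of types `D`. -/
structure CompletePattern (D : K → DiscType) (out : DiscType)
    (J : Option K → ℕ → Option K → ℕ → Prop) (base : K → ℕ × ℕ) : Prop where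
  join : ∀ p : Pt D out, ∃ q : Pt D out, q.1 ≠ p.1 ∧ (J p.1 p.2 q.1 q.2 ∨ J q.1 q.2 p.1 p.2)
  base_fst : ∀ i, (base i).1 ≤ 2 * (D i).half
  base_snd : ∀ i, (base i).2 ≤ 2 * out.half

theorem relabelPt_surjective {J : Type} (e : J ≃ I) :
    Function.Surjective (relabelPt e : Pt (fun j => inn (e j)) out → Pt inn out) := by
  rintro ⟨_ | i, j⟩
  · exact ⟨⟨none, j⟩, rfl⟩
  · obtain ⟨i, rfl⟩ := e.surjective i
    exact ⟨⟨some i, j⟩, rfl⟩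

/-- Renaming the discs of a tangle with a pattern. -/
theorem Tangle.HasPattern.exists_rename {T : Tangle inn out} {ν : I ≃ K} {D : K → DiscType}
    {J : Option K → ℕ → Option K → ℕ → Prop} {base : K → ℕ × ℕ}
    (h : T.HasPattern ν J base) (hD : ∀ i, inn i = D (ν i)) :
    ∃ T₁ : Tangle D out, T₁.HasPattern (Equiv.refl K) J base ∧
      ∀ (P : PlanarAlgebra.{u}) (x : ∀ i, P.V (inn i)) (y : ∀ i, P.V (D i)),
        (∀ i, HEq (x i) (y (ν i))) → P.Z T x = P.Z T₁ y := by
  -- After this substitution the discs `D` are by definition those of a relabelled tangle, so that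
  -- no transport along equalities of types is needed.
  obtain rfl : D = fun i => inn (ν.symm i) := by
    funext i
    rw [hD, ν.apply_symm_apply]
  refine ⟨T.relabel ν.symm, ⟨?_, ?_, ?_⟩, fun P x y hxy => ?_⟩
  · exact h.surj.comp (relabelPt_surjective _)
  · rintro ⟨_ | i, x⟩ ⟨_ | i', y⟩ hJ <;> apply h.join <;>
      simpa [relabelPt] using hJ
  · intro i u v hu hv
    exact h.reg (ν.symm i) u v (by simpa using hu) (by simpa using hv)
  · rw [← P.Z_relabel T ν.symm x]
    congr 1
    funext i
    have h1 := hxy (ν.symm i)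
    rw [ν.apply_symm_apply] at h1
    exact eq_of_heq h1

/-- Composites to be compared index their boxes by different sigma types. Naming the boxes in a
common type `K` brings both to the same inner discs, where rigidity applies; heterogeneous equality
compares the labels, whose types agree only through the names. -/
theorem Z_eq_of_hasPattern {I' : Type} {inn' : I' → DiscType}
    {T : Tangle inn out} {T' : Tangle inn' out} {ν : I ≃ K} {ν' : I' ≃ K} {D : K → DiscType}
    {J : Option K → ℕ → Option K → ℕ → Prop} {base : K → ℕ × ℕ}
    (hJ : CompletePattern D out J base)
    (h : T.HasPattern ν J base) (h' : T'.HasPattern ν' J base)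
    (hD : ∀ i, inn i = D (ν i)) (hD' : ∀ i, inn' i = D (ν' i)) (P : PlanarAlgebra.{u})
    {x : ∀ i, P.V (inn i)} {x' : ∀ i, P.V (inn' i)} (y : ∀ i, P.V (D i))
    (hx : ∀ i, HEq (x i) (y (ν i))) (hx' : ∀ i, HEq (x' i) (y (ν' i))) :
    P.Z T x = P.Z T' x' := by
  obtain ⟨T₁, h₁, e⟩ := h.exists_rename hD
  obtain ⟨T₁', h₁', e'⟩ := h'.exists_rename hD'
  rw [e P x y hx, e' P x' y hx']
  obtain ⟨f⟩ := Tangle.nonempty_iso h₁.surj h₁'.surj (fun p => by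
    obtain ⟨q, hne, hq⟩ := hJ.join p
    -- The pattern never joins two points of the same disc, so the partner of a point differs from
    -- it.
    refine ⟨q, fun hqp => hne (congrArg Sigma.fst hqp), ?_⟩
    rcases hq with hq | hq
    · exact ⟨(h₁.join p q (by simpa using hq)).symm, (h₁'.join p q (by simpa using hq)).symm⟩
    · exact ⟨h₁.join q p (by simpa using hq), h₁'.join q p (by simpa using hq)⟩) (fun i => by
    refine ⟨⟨(base i).1, Nat.lt_succ_of_le (hJ.base_fst i)⟩,
      ⟨(base i).2, Nat.lt_succ_of_le (hJ.base_snd i)⟩, ?_, ?_⟩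
    · exact h₁.reg i _ _ rfl rfl
    · exact h₁'.reg i _ _ rfl rfl)
  rw [P.Z_iso T₁ T₁' f]

end Patterns

/-! ### Strings and regions of a glued tangle -/

section Comp

variable {I : Type} {inn : I → DiscType} {out : DiscType} {J : I → Type}
  {sub : ∀ i, J i → DiscType} (T : Tangle inn out) (S : ∀ i, Tangle (sub i) (inn i))

theorem Tangle.comp_str_none (j : Fin (2 * out.half)) :
    (T.comp S).str ⟨none, j⟩ = Quot.mk _ (Sum.inl (T.str ⟨none, j⟩)) := rfl

variable {T S}

/-- Following a string out of an inner box up to the gluing circle represents it by a piece of `T`;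
comparisons of strings can then be made in `T`, before gluing. -/
theorem Tangle.comp_str_some {i : I} {x : J i} {j : Fin (2 * (sub i x).half)}
    {j' : Fin (2 * (inn i).half)} (h : (S i).str ⟨some x, j⟩ = (S i).str ⟨none, j'⟩) :
    (T.comp S).str ⟨some ⟨i, x⟩, j⟩ = Quot.mk _ (Sum.inl (T.str ⟨some i, j'⟩)) := by
  refine Eq.trans ?_ (Quot.sound (StrGlue.mk i j')).symm
  change Quot.mk _ (Sum.inr (⟨i, (S i).str ⟨some x, j⟩⟩ : Σ i, (S i).Str)) = _
  rw [h]

theorem Tangle.comp_str_some_eq {i : I} {x x' : J i} {j : Fin (2 * (sub i x).half)}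
    {j' : Fin (2 * (sub i x').half)} (h : (S i).str ⟨some x, j⟩ = (S i).str ⟨some x', j'⟩) :
    (T.comp S).str ⟨some ⟨i, x⟩, j⟩ = (T.comp S).str ⟨some ⟨i, x'⟩, j'⟩ := by
  change Quot.mk (StrGlue T S) (Sum.inr (⟨i, (S i).str ⟨some x, j⟩⟩ : Σ i, (S i).Str)) =
    Quot.mk (StrGlue T S) (Sum.inr (⟨i, (S i).str ⟨some x', j'⟩⟩ : Σ i, (S i).Str))
  rw [h]

theorem Tangle.comp_reg_some {i : I} {x : J i} {u : Fin (2 * (sub i x).half + 1)}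
    {u' : Fin (2 * (inn i).half + 1)} {v : Fin (2 * out.half + 1)}
    (h : (S i).reg ⟨some x, u⟩ = (S i).reg ⟨none, u'⟩)
    (h' : T.reg ⟨some i, u'⟩ = T.reg ⟨none, v⟩) :
    (T.comp S).reg ⟨some ⟨i, x⟩, u⟩ = (T.comp S).reg ⟨none, v⟩ := by
  change Quot.mk (RegGlue T S) (Sum.inr (⟨i, (S i).reg ⟨some x, u⟩⟩ : Σ i, (S i).Reg)) =
    Quot.mk (RegGlue T S) (Sum.inl (T.reg ⟨none, v⟩))
  rw [h, ← h']
  exact (Quot.sound (RegGlue.mk i u')).symm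

/-- Gluing arcs to arcs might produce closed loops. This is excluded if every string of `T` reaches
the outer disc or continues at one of its ends into an arc that stops at an innermost box. -/
theorem Tangle.comp_str_surjective (hS : ∀ i, Function.Surjective (S i).str)
    (hT : ∀ s, (∃ j, T.str ⟨none, j⟩ = s) ∨ ∃ i j x j', T.str ⟨some i, j⟩ = s ∧
      (S i).str ⟨some x, j'⟩ = (S i).str ⟨none, j⟩) :
    Function.Surjective (T.comp S).str := by
  have hl : ∀ s, ∃ p, (T.comp S).str p = Quot.mk _ (Sum.inl s) := by
    intro s
    rcases hT s with ⟨j, rfl⟩ | ⟨i, j, x, j', rfl, h⟩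
    · exact ⟨⟨none, j⟩, rfl⟩
    · exact ⟨⟨some ⟨i, x⟩, j'⟩, Tangle.comp_str_some h⟩
  rintro ⟨s | ⟨i, s⟩⟩
  · exact hl s
  · obtain ⟨⟨_ | x, j⟩, rfl⟩ := hS i s
    · obtain ⟨p, hp⟩ := hl (T.str ⟨some i, j⟩)
      exact ⟨p, hp.trans (Quot.sound (StrGlue.mk i j))⟩
    · exact ⟨⟨some ⟨i, x⟩, j⟩, rfl⟩

/-- No string joins two points of the outer disc. -/
def Tangle.NoCaps (T : Tangle inn out) : Prop :=
  ∀ j, ∃ i j', T.str ⟨some i, j'⟩ = T.str ⟨none, j⟩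

/-- Without caps in the `S i`, a string of `T` that enters a glued disc continues to an innermost
box and cannot be sent back into `T`. -/
theorem Tangle.NoCaps.comp_str_surjective (hS' : ∀ i, (S i).NoCaps)
    (hS : ∀ i, Function.Surjective (S i).str) (hT : Function.Surjective T.str) :
    Function.Surjective (T.comp S).str := by
  refine Tangle.comp_str_surjective hS fun s => ?_
  obtain ⟨⟨_ | i, j⟩, rfl⟩ := hT s
  · exact Or.inl ⟨j, rfl⟩
  · obtain ⟨x, j', h⟩ := hS' i j
    exact Or.inr ⟨i, j, x, j', rfl, h⟩

theorem Tangle.reflect_str_surjective {T : Tangle inn out} (hT : Function.Surjective T.str) :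
    Function.Surjective T.reflect.str :=
  hT.comp fun p => ⟨revPt p, revPt_revPt p⟩

theorem Tangle.NoCaps.reflect {T : Tangle inn out} (hT : T.NoCaps) : T.reflect.NoCaps := by
  intro j
  obtain ⟨i, j', h⟩ := hT j.rev
  refine ⟨i, j'.rev, ?_⟩
  change T.str ⟨some i, j'.rev.rev⟩ = T.str ⟨none, j.rev⟩
  rw [Fin.rev_rev, h]

end Comp

/-! ### Incidences in the identity, unit, rotation and product tangles -/

section Elementary

variable {I : Type} {inn : I → DiscType} {out : DiscType}

/-- A string has a single region on its side of a given shading. -/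
theorem Tangle.reg_before_eq (T : Tangle inn out) {p q : Pt inn out} (h : T.str p = T.str q)
    (hc : ivColour (before p) = ivColour (before q)) : T.reg (before p) = T.reg (before q) := by
  rw [← T.side_before, ← T.side_before, h, hc]

theorem idTangle_str (b : DiscType) (s t : Fin (2 * b.half)) (h : s.1 = t.1) :
    (idTangle b).str ⟨some (), s⟩ = (idTangle b).str ⟨none, t⟩ := Fin.ext h

theorem idTangle_reg (b : DiscType) (u v : Fin (2 * b.half + 1)) (h : u.1 = v.1) :
    (idTangle b).reg ⟨some (), u⟩ = (idTangle b).reg ⟨none, v⟩ := by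
  obtain rfl : u = v := Fin.ext h
  induction u using Fin.lastCases with
  | last =>
    -- No point follows the last interval; it is the distinguished one, whose incidence is part of
    -- the definition under its other name `0`.
    refine ((idTangle b).reg_last (some ())).symm.trans (Eq.trans ?_ ((idTangle b).reg_last none))
    exact Quot.sound (RegRel.disc ())
  | cast j =>
    exact (idTangle b).reg_before_eq (p := ⟨some (), j⟩) (q := ⟨none, j⟩) rfl rfl

theorem idTangle_str_surjective (b : DiscType) : Function.Surjective (idTangle b).str :=
  fun s => ⟨⟨none, s⟩, rfl⟩

theorem idTangle_noCaps (b : DiscType) : (idTangle b).NoCaps :=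
  fun j => ⟨(), j, rfl⟩

theorem unitTangle_str (k : ℕ) (ε : Bool) (s t : Fin (2 * k)) (h : s.1 + t.1 + 1 = 2 * k) :
    (unitTangle k ε).str ⟨none, s⟩ = (unitTangle k ε).str ⟨none, t⟩ := by
  apply Fin.ext
  change (if s.1 < k then s.1 else 2 * k - 1 - s.1) = if t.1 < k then t.1 else 2 * k - 1 - t.1
  split_ifs <;> omega

theorem unitTangle_str_surjective (k : ℕ) (ε : Bool) :
    Function.Surjective (unitTangle k ε).str := by
  intro s
  have hs : s.1 < k := s.2
  refine ⟨⟨none, ⟨s.1, by simp only; omega⟩⟩, ?_⟩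
  apply Fin.ext
  change (if s.1 < k then s.1 else 2 * k - 1 - s.1) = s.1
  rw [if_pos hs]

section Turn

variable {n k : ℕ} {ε : Bool}

theorem turnTangle_str (s t : Fin (2 * (n + k)))
    (h : s.1 < 2 * k ∧ t.1 = s.1 + 2 * n ∨ 2 * k ≤ s.1 ∧ s.1 = t.1 + 2 * k) :
    (turnTangle n k ε).str ⟨some (), s⟩ = (turnTangle n k ε).str ⟨none, t⟩ := by
  apply Fin.ext
  change (if s.1 < 2 * k then s.1 + 2 * n else s.1 - 2 * k) = t.1
  split_ifs <;> omega

/-- The bound on `u` avoids the wrap-around of the numbering. Below `2 * k` the region lies beside a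
radial string; at `2 * k` the incidence is built into the tangle, with the outer interval `0` under
its other name. -/
theorem turnTangle_reg (u v : Fin (2 * (n + k) + 1)) (hu : u.1 ≤ 2 * k)
    (h : v.1 = u.1 + 2 * n) :
    (turnTangle n k ε).reg ⟨some (), u⟩ = (turnTangle n k ε).reg ⟨none, v⟩ := by
  rcases hu.lt_or_eq with hu | hu
  · refine (turnTangle n k ε).reg_before_eq (p := ⟨some (), ⟨u.1, by simp only; omega⟩⟩)
      (q := ⟨none, ⟨u.1 + 2 * n, by simp only; omega⟩⟩) ?_ ?_ |>.trans ?_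
    · exact turnTangle_str _ _ (Or.inl ⟨hu, rfl⟩)
    · change colour ⟨n + k, ε⟩ u.1 = colour ⟨n + k, ε⟩ (u.1 + 2 * n)
      rw [colour_eq_iff]
      omega
    · exact congrArg (fun j => (turnTangle n k ε).reg ⟨none, j⟩) (Fin.ext h.symm)
  · have h1 : u = ⟨2 * k, by omega⟩ := Fin.ext hu
    have h2 : v = Fin.last _ := Fin.ext (by simp only [Fin.val_last]; omega)
    rw [h1, h2]
    exact (Quot.sound (RegRel.disc ())).trans ((turnTangle n k ε).reg_last none)

theorem turnTangle_str_surjective : Function.Surjective (turnTangle n k ε).str :=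
  fun s => ⟨⟨none, s⟩, rfl⟩

theorem turnTangle_noCaps : (turnTangle n k ε).NoCaps := by
  intro j
  have hj : j.1 < 2 * (n + k) := j.2
  by_cases h : j.1 < 2 * n
  · exact ⟨(), ⟨j.1 + 2 * k, by simp only; omega⟩, turnTangle_str _ _
      (Or.inr ⟨by simp only; omega, rfl⟩)⟩
  · exact ⟨(), ⟨j.1 - 2 * n, by simp only; omega⟩, turnTangle_str _ _
      (Or.inl ⟨by simp only; omega, by simp only; omega⟩)⟩

end Turn

section Star

variable {m n k i c : ℕ} {ε : Bool} {hm : i ≤ 2 * m} {hn : i ≤ 2 * n} {hc : c + i = m + n}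

theorem starTangle_str_left (s : Fin (2 * (m + k))) (t : Fin (2 * (c + k)))
    (h : s.1 + i < 2 * m ∧ t.1 = s.1 ∨ 2 * m + k ≤ s.1 ∧ t.1 + 2 * m = s.1 + 2 * c) :
    (starTangle m n k i c ε hm hn hc).str ⟨some false, s⟩ =
      (starTangle m n k i c ε hm hn hc).str ⟨none, t⟩ := by
  apply Fin.ext
  change starA m k i c s.1 = t.1
  unfold starA
  split_ifs <;> omega

theorem starTangle_str_right (s : Fin (2 * (n + k))) (t : Fin (2 * (c + k)))
    (h : i ≤ s.1 ∧ s.1 < 2 * n + k ∧ t.1 + 2 * i = s.1 + 2 * m) :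
    (starTangle m n k i c ε hm hn hc).str ⟨some true, s⟩ =
      (starTangle m n k i c ε hm hn hc).str ⟨none, t⟩ := by
  apply Fin.ext
  change starB m n k i c s.1 = t.1
  unfold starB
  split_ifs <;> omega

theorem starTangle_str_middle (s : Fin (2 * (m + k))) (t : Fin (2 * (n + k)))
    (h : s.1 < 2 * m ∧ 2 * m ≤ s.1 + i ∧ s.1 + t.1 + 1 = 2 * m ∨
      2 * m ≤ s.1 ∧ s.1 < 2 * m + k ∧ s.1 + t.1 + 1 = 2 * m + 2 * n + 2 * k) :
    (starTangle m n k i c ε hm hn hc).str ⟨some false, s⟩ =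
      (starTangle m n k i c ε hm hn hc).str ⟨some true, t⟩ := by
  apply Fin.ext
  change starA m k i c s.1 = starB m n k i c t.1
  unfold starA starB
  split_ifs <;> omega

theorem starTangle_reg_left (u : Fin (2 * (m + k) + 1)) (v : Fin (2 * (c + k) + 1))
    (hu : u.1 = 2 * m + k) (hv : v.1 = 2 * c + k) :
    (starTangle m n k i c ε hm hn hc).reg ⟨some false, u⟩ =
      (starTangle m n k i c ε hm hn hc).reg ⟨none, v⟩ := by
  obtain ⟨u, hu'⟩ := u
  obtain ⟨v, hv'⟩ := v
  obtain rfl : u = 2 * m + k := hu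
  obtain rfl : v = 2 * c + k := hv
  exact Quot.sound (RegRel.disc false)

theorem starTangle_reg_right (u : Fin (2 * (n + k) + 1)) (v : Fin (2 * (c + k) + 1))
    (hu : u.1 = 2 * n + k) (hv : v.1 = 2 * c + k) :
    (starTangle m n k i c ε hm hn hc).reg ⟨some true, u⟩ =
      (starTangle m n k i c ε hm hn hc).reg ⟨none, v⟩ := by
  obtain ⟨u, hu'⟩ := u
  obtain ⟨v, hv'⟩ := v
  obtain rfl : u = 2 * n + k := hu
  obtain rfl : v = 2 * c + k := hv
  exact Quot.sound (RegRel.disc true)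

theorem starTangle_noCaps : (starTangle m n k i c ε hm hn hc).NoCaps := by
  intro t
  have ht : t.1 < 2 * (c + k) := t.2
  by_cases h1 : t.1 + i < 2 * m
  · exact ⟨false, (⟨t.1, by omega⟩ : Fin (2 * (m + k))),
      starTangle_str_left _ _ (Or.inl ⟨h1, rfl⟩)⟩
  by_cases h2 : t.1 < 2 * c + k
  · exact ⟨true, (⟨t.1 + 2 * i - 2 * m, by omega⟩ : Fin (2 * (n + k))),
      starTangle_str_right _ _ (by dsimp only; omega)⟩
  · exact ⟨false, (⟨t.1 + 2 * m - 2 * c, by omega⟩ : Fin (2 * (m + k))),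
      starTangle_str_left _ _ (Or.inr (by dsimp only; omega))⟩

theorem starTangle_str_surjective :
    Function.Surjective (starTangle m n k i c ε hm hn hc).str := by
  intro s
  have hs : s.1 < 2 * (c + k) + (i + k) := s.2
  by_cases h : s.1 < 2 * (c + k)
  · exact ⟨⟨none, ⟨s.1, h⟩⟩, rfl⟩
  · refine ⟨⟨some false, ⟨s.1 - 2 * (c + k) + (2 * m - i), by simp only; omega⟩⟩, ?_⟩
    apply Fin.ext
    change starA m k i c (s.1 - 2 * (c + k) + (2 * m - i)) = s.1
    unfold starA
    split_ifs <;> omega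

end Star

end Elementary

/-! ### Following strings through the gluing circles -/

section Comp

variable {I : Type} {inn : I → DiscType} {out : DiscType} {J : I → Type}
  {sub : ∀ i, J i → DiscType} {T : Tangle inn out} {S : ∀ i, Tangle (sub i) (inn i)}

theorem Tangle.comp_str_some_none {i : I} {x : J i} {j : Fin (2 * (sub i x).half)}
    {t : Fin (2 * out.half)} (j' : Fin (2 * (inn i).half))
    (h : (S i).str ⟨some x, j⟩ = (S i).str ⟨none, j'⟩)
    (h' : T.str ⟨some i, j'⟩ = T.str ⟨none, t⟩) :
    (T.comp S).str ⟨some ⟨i, x⟩, j⟩ = (T.comp S).str ⟨none, t⟩ := by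
  rw [Tangle.comp_str_some h, h']
  rfl

theorem Tangle.comp_str_some_some {i₁ i₂ : I} {x₁ : J i₁} {x₂ : J i₂}
    {j₁ : Fin (2 * (sub i₁ x₁).half)} {j₂ : Fin (2 * (sub i₂ x₂).half)}
    (t₁ : Fin (2 * (inn i₁).half)) (t₂ : Fin (2 * (inn i₂).half))
    (h₁ : (S i₁).str ⟨some x₁, j₁⟩ = (S i₁).str ⟨none, t₁⟩)
    (h₂ : (S i₂).str ⟨some x₂, j₂⟩ = (S i₂).str ⟨none, t₂⟩)
    (h : T.str ⟨some i₁, t₁⟩ = T.str ⟨some i₂, t₂⟩) :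
    (T.comp S).str ⟨some ⟨i₁, x₁⟩, j₁⟩ = (T.comp S).str ⟨some ⟨i₂, x₂⟩, j₂⟩ := by
  rw [Tangle.comp_str_some h₁, Tangle.comp_str_some h₂, h]

/-- For the unit tangle, which has caps: a cap glued into a disc connects two strings of the
surrounding tangle. -/
theorem Tangle.comp_str_cap {i : I} {j j' : Fin (2 * (inn i).half)}
    (h : (S i).str ⟨none, j⟩ = (S i).str ⟨none, j'⟩) :
    Quot.mk (StrGlue T S) (Sum.inl (T.str ⟨some i, j⟩)) =
      Quot.mk (StrGlue T S) (Sum.inl (T.str ⟨some i, j'⟩)) := by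
  rw [Quot.sound (StrGlue.mk i j), Quot.sound (StrGlue.mk i j'), h]

end Comp

/-! ### Composites in a tangle with two inner discs -/

section Pairs

variable {I₁ I₂ : Type} {s₁ : I₁ → DiscType} {s₂ : I₂ → DiscType} {A B C : DiscType}

/-- The inner discs of the tangles glued into a tangle with two inner discs. -/
abbrev pairIdx (I₁ I₂ : Type) : Bool → Type
  | false => I₁
  | true => I₂

/-- The types of the inner discs of two tangles. -/
abbrev pairSub (s₁ : I₁ → DiscType) (s₂ : I₂ → DiscType) : ∀ i, pairIdx I₁ I₂ i → DiscType
  | false => s₁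
  | true => s₂

/-- Two tangles, to be glued into a tangle with two inner discs. -/
abbrev pairTangle (S₁ : Tangle s₁ A) (S₂ : Tangle s₂ B) :
    ∀ i, Tangle (pairSub s₁ s₂ i) (pairDisc A B i)
  | false => S₁
  | true => S₂

/-- The labels of the inner discs of two tangles. -/
abbrev pairFam (P : PlanarAlgebra.{u}) (x₁ : ∀ j, P.V (s₁ j)) (x₂ : ∀ j, P.V (s₂ j)) :
    ∀ i j, P.V (pairSub s₁ s₂ i j)
  | false => x₁
  | true => x₂

theorem bilin_apply (P : PlanarAlgebra.{u}) (T : Tangle (pairDisc A B) C) (x : P.V A)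
    (y : P.V B) : P.bilin T x y = P.Z T (P.pairVec x y) := rfl

/-- Makes a nested product the action of one glued tangle. A factor that is a mere label becomes a
value of a tangle through `Z_id`. -/
theorem bilin_Z (P : PlanarAlgebra.{u}) (T : Tangle (pairDisc A B) C) (S₁ : Tangle s₁ A)
    (S₂ : Tangle s₂ B) (x₁ : ∀ j, P.V (s₁ j)) (x₂ : ∀ j, P.V (s₂ j)) :
    P.bilin T (P.Z S₁ x₁) (P.Z S₂ x₂) =
      P.Z (T.comp (pairTangle S₁ S₂)) (fun y => pairFam P x₁ x₂ y.1 y.2) := by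
  rw [P.Z_comp T (pairTangle S₁ S₂) (pairFam P x₁ x₂), bilin_apply]
  congr 1
  funext i
  cases i <;> rfl

theorem pairTangle_str_surjective {S₁ : Tangle s₁ A} {S₂ : Tangle s₂ B}
    (h₁ : Function.Surjective S₁.str) (h₂ : Function.Surjective S₂.str) (i : Bool) :
    Function.Surjective (pairTangle S₁ S₂ i).str := by
  cases i
  exacts [h₁, h₂]

theorem pairTangle_noCaps {S₁ : Tangle s₁ A} {S₂ : Tangle s₂ B} (h₁ : S₁.NoCaps)
    (h₂ : S₂.NoCaps) (i : Bool) : (pairTangle S₁ S₂ i).NoCaps := by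
  cases i
  exacts [h₁, h₂]

end Pairs

/-! ### Associativity: products of three boxes -/

section Associativity

/-- Names for three boxes. -/
inductive Box3
  | a | b | c

/-- The boxes of `(a ⋆ b) ⋆ c`. -/
def leftBoxes : (Σ i, pairIdx Bool Unit i) ≃ Box3 where
  toFun
    | ⟨false, false⟩ => .a
    | ⟨false, true⟩ => .b
    | ⟨true, _⟩ => .c
  invFun
    | .a => ⟨false, false⟩
    | .b => ⟨false, true⟩
    | .c => ⟨true, ()⟩
  left_inv := by rintro ⟨_ | _, _ | _⟩ <;> rfl
  right_inv := by rintro (_ | _ | _) <;> rfl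

/-- The boxes of `a ⋆ (b ⋆ c)`. -/
def rightBoxes : (Σ i, pairIdx Unit Bool i) ≃ Box3 where
  toFun
    | ⟨false, _⟩ => .a
    | ⟨true, false⟩ => .b
    | ⟨true, true⟩ => .c
  invFun
    | .a => ⟨false, ()⟩
    | .b => ⟨true, false⟩
    | .c => ⟨true, true⟩
  left_inv := by rintro ⟨_ | _, _ | _⟩ <;> rfl
  right_inv := by rintro (_ | _ | _) <;> rfl

/-- The types of three boxes. -/
abbrev boxDisc (m n l k : ℕ) (ε : Bool) : Box3 → DiscType
  | .a => ⟨m + k, ε⟩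
  | .b => ⟨n + k, ε⟩
  | .c => ⟨l + k, ε⟩

/-- The strings of a product of three boxes with `x` strings between the tops of `a` and `b`, `y`
between those of `b` and `c`, and `z` between those of `a` and `c`. -/
def tripleJoin (m n l k d x y z : ℕ) : Option Box3 → ℕ → Option Box3 → ℕ → Prop
  | some .a, s, none, t => s + x + z < 2 * m ∧ t = s ∨ 2 * m + k ≤ s ∧ t + 2 * m = s + 2 * d
  | some .a, s, some .b, t => s < 2 * m ∧ 2 * m ≤ s + x ∧ s + t + 1 = 2 * m ∨
      2 * m ≤ s ∧ s < 2 * m + k ∧ s + t + 1 = 2 * m + 2 * n + 2 * k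
  | some .a, s, some .c, t =>
      s + x < 2 * m ∧ 2 * m ≤ s + x + z ∧ s + t + 1 + x = 2 * m + y
  | some .b, s, none, t => x ≤ s ∧ s + y < 2 * n ∧ t + 2 * x + z = s + 2 * m
  | some .b, s, some .c, t => s < 2 * n ∧ 2 * n ≤ s + y ∧ s + t + 1 = 2 * n ∨
      2 * n ≤ s ∧ s < 2 * n + k ∧ s + t + 1 = 2 * n + 2 * l + 2 * k
  | some .c, s, none, t =>
      y + z ≤ s ∧ s < 2 * l + k ∧ t + 2 * x + 2 * y + 2 * z = 2 * m + 2 * n + s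
  | _, _, _, _ => False

/-- The intervals at the bottom of three boxes and of the outer box. -/
def tripleBase (m n l k d : ℕ) : Box3 → ℕ × ℕ
  | .a => (2 * m + k, 2 * d + k)
  | .b => (2 * n + k, 2 * d + k)
  | .c => (2 * l + k, 2 * d + k)

variable {m n l k d x y z : ℕ} {ε : Bool}

/-- Read clockwise, the outer circle carries `2 * m - x - z` strings from the top of `a`, `2 * n - x
- y` from the top of `b`, `2 * l - y - z` from the top of `c`, then the right side of `c` and the
left side of `a`. The witnesses invert these shifts, and similarly for the other circles. -/
theorem tripleJoin_complete (hxy : x + y ≤ 2 * n)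
    (hxz : x + z ≤ 2 * m) (hyz : y + z ≤ 2 * l) (hd : d + x + y + z = m + n + l) :
    CompletePattern (boxDisc m n l k ε) ⟨d + k, ε⟩ (tripleJoin m n l k d x y z)
      (tripleBase m n l k d) where
  base_fst := by rintro (_ | _ | _) <;> simp only [tripleBase] <;> omega
  base_snd := by rintro (_ | _ | _) <;> simp only [tripleBase] <;> omega
  join := by
    rintro ⟨_ | _ | _ | _, s, hs⟩ <;> simp only at hs
    · by_cases h1 : s + x + z < 2 * m ∨ 2 * d + k ≤ s
      · refine ⟨⟨some .a, ⟨if s < 2 * d + k then s else s + 2 * m - 2 * d, ?_⟩⟩,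
          by simp, Or.inr ?_⟩
        · simp only; split_ifs <;> omega
        · simp only [tripleJoin]; split_ifs <;> omega
      by_cases h2 : s + 2 * x + y + z < 2 * n + 2 * m ∧ s + x + z + y < 2 * m + 2 * n - x
      · refine ⟨⟨some .b, ⟨s + 2 * x + z - 2 * m, ?_⟩⟩, by simp, Or.inr ?_⟩
        · simp only; omega
        · simp only [tripleJoin]; omega
      · refine ⟨⟨some .c, ⟨s + 2 * x + 2 * y + 2 * z - 2 * m - 2 * n, ?_⟩⟩, by simp, Or.inr ?_⟩
        · simp only; omega
        · simp only [tripleJoin]; omega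
    · by_cases h1 : s + x + z < 2 * m ∨ 2 * m + k ≤ s
      · refine ⟨⟨none, ⟨if s < 2 * m then s else s + 2 * d - 2 * m, ?_⟩⟩,
          by simp, Or.inl ?_⟩
        · simp only; split_ifs <;> omega
        · simp only [tripleJoin]; split_ifs <;> omega
      by_cases h2 : s + x < 2 * m
      · refine ⟨⟨some .c, ⟨2 * m + y - s - 1 - x, ?_⟩⟩, by simp, Or.inl ?_⟩
        · simp only; omega
        · simp only [tripleJoin]; omega
      · refine ⟨⟨some .b, ⟨if s < 2 * m then 2 * m - 1 - s else 2 * m + 2 * n + 2 * k - 1 - s, ?_⟩⟩,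
          by simp, Or.inl ?_⟩
        · simp only; split_ifs <;> omega
        · simp only [tripleJoin]; split_ifs <;> omega
    · by_cases h1 : s < x ∨ 2 * n + k ≤ s
      · refine ⟨⟨some .a, ⟨if s < x then 2 * m - 1 - s else 2 * m + 2 * n + 2 * k - 1 - s, ?_⟩⟩,
          by simp, Or.inr ?_⟩
        · simp only; split_ifs <;> omega
        · simp only [tripleJoin]; split_ifs <;> omega
      by_cases h2 : s + y < 2 * n
      · refine ⟨⟨none, ⟨s + 2 * m - 2 * x - z, ?_⟩⟩, by simp, Or.inl ?_⟩
        · simp only; omega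
        · simp only [tripleJoin]; omega
      · refine ⟨⟨some .c, ⟨if s < 2 * n then 2 * n - 1 - s else 2 * n + 2 * l + 2 * k - 1 - s, ?_⟩⟩,
          by simp, Or.inl ?_⟩
        · simp only; split_ifs <;> omega
        · simp only [tripleJoin]; split_ifs <;> omega
    · by_cases h1 : s < y ∨ 2 * l + k ≤ s
      · refine ⟨⟨some .b, ⟨if s < y then 2 * n - 1 - s else 2 * n + 2 * l + 2 * k - 1 - s, ?_⟩⟩,
          by simp, Or.inr ?_⟩
        · simp only; split_ifs <;> omega
        · simp only [tripleJoin]; split_ifs <;> omega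
      by_cases h2 : s < y + z
      · refine ⟨⟨some .a, ⟨2 * m + y - s - 1 - x, ?_⟩⟩, by simp, Or.inr ?_⟩
        · simp only; omega
        · simp only [tripleJoin]; omega
      · refine ⟨⟨none, ⟨2 * m + 2 * n + s - 2 * x - 2 * y - 2 * z, ?_⟩⟩, by simp, Or.inl ?_⟩
        · simp only; omega
        · simp only [tripleJoin]; omega

variable {e j : ℕ}

/-- Of the `j` nested strings between `a ⋆ b` and `c`, the innermost `y` come from `b` and the other
`z` from `a`; they get past `b` only when all its top points are used, which is the content of `hz`.
-/
theorem leftTriple_hasPattern (hxy : x + y ≤ 2 * n) (hz : z = 0 ∨ x + y = 2 * n)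
    (hxz : x + z ≤ 2 * m) (hyz : y + z ≤ 2 * l) {h1 : x ≤ 2 * m} {h2 : x ≤ 2 * n}
    {h3 : e + x = m + n} (hj : j = y + z) {h4 : j ≤ 2 * e} {h5 : j ≤ 2 * l}
    {h6 : d + j = e + l} :
    ((starTangle e l k j d ε h4 h5 h6).comp (pairTangle (starTangle m n k x e ε h1 h2 h3)
      (idTangle ⟨l + k, ε⟩))).HasPattern leftBoxes (tripleJoin m n l k d x y z)
        (tripleBase m n l k d) where
  surj := Tangle.NoCaps.comp_str_surjective
    (pairTangle_noCaps starTangle_noCaps (idTangle_noCaps _))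
    (pairTangle_str_surjective starTangle_str_surjective (idTangle_str_surjective _))
    starTangle_str_surjective
  reg := by
    rintro ⟨_ | _, _ | _⟩ u v hu hv
    · exact Tangle.comp_reg_some (u' := ⟨2 * e + k, by simp only; omega⟩)
        (starTangle_reg_left _ _ hu rfl) (starTangle_reg_left _ _ rfl hv)
    · exact Tangle.comp_reg_some (u' := ⟨2 * e + k, by simp only; omega⟩)
        (starTangle_reg_right _ _ hu rfl) (starTangle_reg_left _ _ rfl hv)
    · exact Tangle.comp_reg_some (u' := ⟨2 * l + k, by simp only; omega⟩)
        (idTangle_reg _ _ _ hu) (starTangle_reg_right _ _ rfl hv)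
  join := by
    rintro ⟨_ | ⟨_ | _, _ | _⟩, s, hs⟩ ⟨_ | ⟨_ | _, _ | _⟩, t, ht⟩ h <;>
      simp only [Option.map_some, Option.map_none, leftBoxes, Equiv.coe_fn_mk, tripleJoin] at h <;>
      simp only at hs ht
    -- The witness is the position of `s` on the box of `a ⋆ b`: top points of `a` keep their
    -- number, points on its left side are shifted because there are now `2 * e` top points.
    · refine Tangle.comp_str_some_none (S := pairTangle _ _) (i := false) (x := false)
        (⟨if s < 2 * m then s else s + 2 * e - 2 * m, ?_⟩ : Fin (2 * (e + k)))
        (starTangle_str_left _ _ ?_) (starTangle_str_left _ _ ?_) <;>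
        (try dsimp only) <;> (try split_ifs) <;> omega
    · exact Tangle.comp_str_some_eq (starTangle_str_middle _ _ (by dsimp only; omega))
    -- A string from `a` to `c` forces `z > 0`, hence `x + y = 2 * n`; this makes the numbering on
    -- `a ⋆ b` agree with the one in the pattern.
    · refine Tangle.comp_str_some_some (S := pairTangle _ _) (i₁ := false) (x₁ := false)
        (i₂ := true) (x₂ := ())
        (⟨s, ?_⟩ : Fin (2 * (e + k))) (⟨t, ht⟩ : Fin (2 * (l + k)))
        (starTangle_str_left _ _ ?_) (idTangle_str _ _ _ rfl) (starTangle_str_middle _ _ ?_) <;>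
        (try dsimp only) <;> omega
    -- On the box of `a ⋆ b` the points of `b`, without its first `x`, follow the `2 * m - x`
    -- remaining top points of `a`.
    · refine Tangle.comp_str_some_none (S := pairTangle _ _) (i := false) (x := true)
        (⟨s + 2 * m - 2 * x, ?_⟩ : Fin (2 * (e + k)))
        (starTangle_str_right _ _ ?_) (starTangle_str_left _ _ ?_) <;>
        (try dsimp only) <;> omega
    · refine Tangle.comp_str_some_some (S := pairTangle _ _) (i₁ := false) (x₁ := true)
        (i₂ := true) (x₂ := ())
        (⟨s + 2 * m - 2 * x, ?_⟩ : Fin (2 * (e + k))) (⟨t, ht⟩ : Fin (2 * (l + k)))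
        (starTangle_str_right _ _ ?_) (idTangle_str _ _ _ rfl) (starTangle_str_middle _ _ ?_) <;>
        (try dsimp only) <;> omega
    · refine Tangle.comp_str_some_none (S := pairTangle _ _) (i := true) (x := ())
        (⟨s, hs⟩ : Fin (2 * (l + k)))
        (idTangle_str _ _ _ rfl) (starTangle_str_right _ _ ?_)
      dsimp only
      omega

/-- Now the `j` nested strings run between `a` and `b ⋆ c`: the innermost `x` end on `b`, and the
other `z` pass over it to `c`. -/
theorem rightTriple_hasPattern (hxy : x + y ≤ 2 * n) (hz : z = 0 ∨ x + y = 2 * n)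
    (hyz : y + z ≤ 2 * l) {h1 : y ≤ 2 * n} {h2 : y ≤ 2 * l}
    {h3 : e + y = n + l} (hj : j = x + z) {h4 : j ≤ 2 * m} {h5 : j ≤ 2 * e}
    {h6 : d + j = m + e} :
    ((starTangle m e k j d ε h4 h5 h6).comp (pairTangle (idTangle ⟨m + k, ε⟩)
      (starTangle n l k y e ε h1 h2 h3))).HasPattern rightBoxes (tripleJoin m n l k d x y z)
        (tripleBase m n l k d) where
  surj := Tangle.NoCaps.comp_str_surjective
    (pairTangle_noCaps (idTangle_noCaps _) starTangle_noCaps)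
    (pairTangle_str_surjective (idTangle_str_surjective _) starTangle_str_surjective)
    starTangle_str_surjective
  reg := by
    rintro ⟨_ | _, _ | _⟩ u v hu hv
    · exact Tangle.comp_reg_some (u' := ⟨2 * m + k, by simp only; omega⟩)
        (idTangle_reg _ _ _ hu) (starTangle_reg_left _ _ rfl hv)
    · exact Tangle.comp_reg_some (u' := ⟨2 * e + k, by simp only; omega⟩)
        (starTangle_reg_left _ _ hu rfl) (starTangle_reg_right _ _ rfl hv)
    · exact Tangle.comp_reg_some (u' := ⟨2 * e + k, by simp only; omega⟩)
        (starTangle_reg_right _ _ hu rfl) (starTangle_reg_right _ _ rfl hv)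
  join := by
    rintro ⟨_ | ⟨_ | _, _ | _⟩, s, hs⟩ ⟨_ | ⟨_ | _, _ | _⟩, t, ht⟩ h <;>
      simp only [Option.map_some, Option.map_none, rightBoxes, Equiv.coe_fn_mk, tripleJoin] at h <;>
      simp only at hs ht
    · refine Tangle.comp_str_some_none (S := pairTangle _ _) (i := false) (x := ())
        (⟨s, hs⟩ : Fin (2 * (m + k)))
        (idTangle_str _ _ _ rfl) (starTangle_str_left _ _ ?_)
      dsimp only
      omega
    -- The two cases of the witness are the top and the left side of `b`, located on the box of `b ⋆
    -- c`.
    · refine Tangle.comp_str_some_some (S := pairTangle _ _) (i₁ := false) (x₁ := ())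
        (i₂ := true) (x₂ := false)
        (⟨s, hs⟩ : Fin (2 * (m + k)))
        (⟨if t < x then t else t + 2 * e - 2 * n, ?_⟩ : Fin (2 * (e + k)))
        (idTangle_str _ _ _ rfl) (starTangle_str_left _ _ ?_) (starTangle_str_middle _ _ ?_) <;>
        (try dsimp only) <;> (try split_ifs) <;> omega
    · refine Tangle.comp_str_some_some (S := pairTangle _ _) (i₁ := false) (x₁ := ())
        (i₂ := true) (x₂ := true)
        (⟨s, hs⟩ : Fin (2 * (m + k))) (⟨t + 2 * n - 2 * y, ?_⟩ : Fin (2 * (e + k)))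
        (idTangle_str _ _ _ rfl) (starTangle_str_right _ _ ?_) (starTangle_str_middle _ _ ?_) <;>
        (try dsimp only) <;> omega
    · refine Tangle.comp_str_some_none (S := pairTangle _ _) (i := true) (x := false) (⟨s, ?_⟩ : Fin (2 * (e + k)))
        (starTangle_str_left _ _ ?_) (starTangle_str_right _ _ ?_) <;>
        (try dsimp only) <;> omega
    · exact Tangle.comp_str_some_eq (starTangle_str_middle _ _ (by dsimp only; omega))
    · refine Tangle.comp_str_some_none (S := pairTangle _ _) (i := true) (x := true)
        (⟨s + 2 * n - 2 * y, ?_⟩ : Fin (2 * (e + k)))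
        (starTangle_str_right _ _ ?_) (starTangle_str_right _ _ ?_) <;>
        (try dsimp only) <;> omega

/-- The labels of three boxes. -/
abbrev boxVec (P : PlanarAlgebra.{u}) (a : P.V ⟨m + k, ε⟩) (b : P.V ⟨n + k, ε⟩)
    (c : P.V ⟨l + k, ε⟩) : ∀ i, P.V (boxDisc m n l k ε i)
  | .a => a
  | .b => b
  | .c => c

/-- Both sides draw the picture with parameters `x`, `y`, `z`. The strings between `a` and `c` are
counted together with those between `b` and `c` on the left, and with those between `a` and `b` on
the right. -/
theorem bilin_star_assoc (P : PlanarAlgebra.{u}) {e' j' : ℕ}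
    (hxy : x + y ≤ 2 * n) (hz : z = 0 ∨ x + y = 2 * n)
    (hj : j = y + z) (hj' : j' = x + z)
    {h1 : x ≤ 2 * m} {h2 : x ≤ 2 * n} {h3 : e + x = m + n}
    {h4 : j ≤ 2 * e} {h5 : j ≤ 2 * l} {h6 : d + j = e + l}
    {h1' : y ≤ 2 * n} {h2' : y ≤ 2 * l} {h3' : e' + y = n + l}
    {h4' : j' ≤ 2 * m} {h5' : j' ≤ 2 * e'} {h6' : d + j' = m + e'}
    (a : P.V ⟨m + k, ε⟩) (b : P.V ⟨n + k, ε⟩) (c : P.V ⟨l + k, ε⟩) :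
    P.bilin (starTangle e l k j d ε h4 h5 h6) (P.bilin (starTangle m n k x e ε h1 h2 h3) a b) c =
      P.bilin (starTangle m e' k j' d ε h4' h5' h6') a
        (P.bilin (starTangle n l k y e' ε h1' h2' h3') b c) := by
  conv_lhs => rw [← P.Z_id ⟨l + k, ε⟩ c, bilin_apply P (starTangle m n k x e ε h1 h2 h3), bilin_Z]
  conv_rhs =>
    rw [← P.Z_id ⟨m + k, ε⟩ a, bilin_apply P (starTangle n l k y e' ε h1' h2' h3'), bilin_Z]
  refine Z_eq_of_hasPattern
    (tripleJoin_complete (m := m) (n := n) (l := l) (x := x) (y := y) (z := z)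
      hxy (by omega) (by omega) (by omega))
    (leftTriple_hasPattern hxy hz (by omega) (by omega) hj)
    (rightTriple_hasPattern hxy hz (by omega) hj') ?_ ?_ P (boxVec P a b c) ?_ ?_ <;>
  · rintro ⟨_ | _, _ | _⟩ <;> rfl

end Associativity

/-! ### The unit -/

section Identity

/-- Radial strings. -/
def idJoin : Option Unit → ℕ → Option Unit → ℕ → Prop
  | some _, s, none, t => s = t
  | _, _, _, _ => False

theorem idJoin_complete (b : DiscType) {r : ℕ} (hr : r ≤ 2 * b.half) :
    CompletePattern (fun _ => b) b idJoin (fun _ => (r, r)) where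
  base_fst _ := hr
  base_snd _ := hr
  join := by
    rintro ⟨_ | _, s⟩
    · exact ⟨⟨some (), s⟩, by simp, Or.inr rfl⟩
    · exact ⟨⟨none, s⟩, by simp, Or.inl rfl⟩

/-- The interval `r` is left free because composites give their incidence at different places: the
bottom `2 * n + k` for the unit laws, `2 * n` for two rotations. -/
theorem idTangle_hasPattern (b : DiscType) (r : ℕ) :
    (idTangle b).HasPattern (Equiv.refl Unit) idJoin (fun _ => (r, r)) where
  surj := idTangle_str_surjective b
  reg _ u v hu hv := idTangle_reg b u v (hu.trans hv.symm)
  join := by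
    rintro ⟨_ | _, s⟩ ⟨_ | _, t⟩ h
    · exact h.elim
    · exact h.elim
    · exact idTangle_str b s t h
    · exact h.elim

/-- A tangle with the pattern of the identity tangle acts by the identity. -/
theorem Z_eq_self_of_hasPattern {I : Type} {inn : I → DiscType} {b : DiscType}
    {T : Tangle inn b} {ν : I ≃ Unit} {r : ℕ} (hr : r ≤ 2 * b.half)
    (h : T.HasPattern ν idJoin (fun _ => (r, r))) (hb : ∀ i, inn i = b) (P : PlanarAlgebra.{u})
    {x : ∀ i, P.V (inn i)} (y : P.V b) (hx : ∀ i, HEq (x i) y) : P.Z T x = y :=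
  (Z_eq_of_hasPattern (idJoin_complete b hr) h (idTangle_hasPattern b r) hb (fun _ => rfl) P
    (fun _ => y) hx (fun _ => HEq.rfl)).trans (P.Z_id b y)

/-- The box of `1 ⋆ a`. -/
def oneLeftBox : (Σ i, pairIdx Empty Unit i) ≃ Unit where
  toFun _ := ()
  invFun _ := ⟨true, ()⟩
  left_inv := by
    rintro ⟨_ | _, x⟩
    · exact x.elim
    · rfl
  right_inv _ := rfl

/-- The box of `a ⋆ 1`. -/
def oneRightBox : (Σ i, pairIdx Unit Empty i) ≃ Unit where
  toFun _ := ()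
  invFun _ := ⟨false, ()⟩
  left_inv := by
    rintro ⟨_ | _, x⟩
    · rfl
    · exact x.elim
  right_inv _ := rfl

variable {n k : ℕ} {ε : Bool}

/-- The left side of `a` is joined to the outer box through the unit, all its other points directly.
The strings of the unit are caps, so closed loops are excluded by following each point of its box:
from the right side to `a`, from the left side to the outer box. -/
theorem one_star_hasPattern {h1 : 0 ≤ 2 * 0} {h2 : 0 ≤ 2 * n} {h3 : n + 0 = 0 + n} :
    ((starTangle 0 n k 0 n ε h1 h2 h3).comp (pairTangle (unitTangle (0 + k) ε)
      (idTangle ⟨n + k, ε⟩))).HasPattern oneLeftBox idJoin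
        (fun _ => (2 * n + k, 2 * n + k)) where
  surj := by
    refine Tangle.comp_str_surjective (pairTangle_str_surjective (unitTangle_str_surjective _ _)
      (idTangle_str_surjective _)) fun s => ?_
    obtain ⟨⟨_ | _ | _, j⟩, rfl⟩ := starTangle_str_surjective s
    · exact Or.inl ⟨j, rfl⟩
    · have hj : j.1 < 2 * (0 + k) := j.2
      by_cases h : j.1 < k
      · exact Or.inr ⟨true, (⟨2 * n + 2 * k - 1 - j.1, by omega⟩ : Fin (2 * (n + k))), (), _,
          (starTangle_str_middle _ _ (by dsimp only; omega)).symm, rfl⟩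
      · exact Or.inl ⟨⟨j.1 + 2 * n, by simp only; omega⟩,
          (starTangle_str_left _ _ (by dsimp only; omega)).symm⟩
    · exact Or.inr ⟨true, j, (), j, rfl, rfl⟩
  reg := by
    rintro ⟨_ | _, x⟩ u v hu hv
    · exact x.elim
    · exact Tangle.comp_reg_some (u' := ⟨2 * n + k, by simp only; omega⟩)
        (idTangle_reg _ _ _ hu) (starTangle_reg_right _ _ rfl hv)
  join := by
    rintro ⟨_ | ⟨_ | _, x⟩, s, hs⟩ ⟨_ | ⟨_ | _, y⟩, t, ht⟩ h
    -- The only pair which `idJoin` allows: a point of the box of `a` and a point of the outer disc.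
    on_goal 7 =>
      obtain rfl : s = t := h
      simp only at hs ht
      by_cases h : s < 2 * n + k
      · exact Tangle.comp_str_some_none (T := starTangle 0 n k 0 n ε h1 h2 h3) (S := pairTangle _ _) (i := true) (x := ())
          (⟨s, hs⟩ : Fin (2 * (n + k))) (idTangle_str _ _ _ rfl)
          (starTangle_str_right _ _ ⟨Nat.zero_le _, h, rfl⟩)
      -- The point `s` on the left of `a` meets the right side of the unit at `2 * n + 2 * k - 1 -
      -- s`; the horizontal string there leaves on the left at `s - 2 * n`, which is joined to the
      -- outer point `s`.
      · refine (Tangle.comp_str_some (T := starTangle 0 n k 0 n ε h1 h2 h3) (S := pairTangle _ _) (i := true) (x := ())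
          (j' := (⟨s, hs⟩ : Fin (2 * (n + k)))) (idTangle_str _ _ _ rfl)).trans ?_
        have e1 := starTangle_str_middle (hm := h1) (hn := h2) (hc := h3) (ε := ε)
          (⟨2 * n + 2 * k - 1 - s, by omega⟩ : Fin (2 * (0 + k)))
          (⟨s, hs⟩ : Fin (2 * (n + k))) (by dsimp only; omega)
        have e2 := starTangle_str_left (hm := h1) (hn := h2) (hc := h3) (ε := ε)
          (⟨s - 2 * n, by omega⟩ : Fin (2 * (0 + k)))
          (⟨s, ht⟩ : Fin (2 * (n + k))) (by dsimp only; omega)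
        rw [← e1, Tangle.comp_str_none, ← e2]
        exact Tangle.comp_str_cap (unitTangle_str _ _ _ _ (by dsimp only; omega))
    all_goals first | exact h.elim | exact x.elim

/-- Here the right side of `a` is prolonged through the unit, from the left side of the unit to its
right side. -/
theorem star_one_hasPattern {h1 : 0 ≤ 2 * n} {h2 : 0 ≤ 2 * 0} {h3 : n + 0 = n + 0} :
    ((starTangle n 0 k 0 n ε h1 h2 h3).comp (pairTangle (idTangle ⟨n + k, ε⟩)
      (unitTangle (0 + k) ε))).HasPattern oneRightBox idJoin
        (fun _ => (2 * n + k, 2 * n + k)) where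
  surj := by
    refine Tangle.comp_str_surjective (pairTangle_str_surjective (idTangle_str_surjective _)
      (unitTangle_str_surjective _ _)) fun s => ?_
    obtain ⟨⟨_ | _ | _, j⟩, rfl⟩ := starTangle_str_surjective s
    · exact Or.inl ⟨j, rfl⟩
    · exact Or.inr ⟨false, j, (), j, rfl, rfl⟩
    · have hj : j.1 < 2 * (0 + k) := j.2
      by_cases h : j.1 < k
      · exact Or.inl ⟨⟨j.1 + 2 * n, by simp only; omega⟩,
          (starTangle_str_right _ _ (by dsimp only; omega)).symm⟩
      · exact Or.inr ⟨false, (⟨2 * n + 2 * k - 1 - j.1, by omega⟩ : Fin (2 * (n + k))), (), _,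
          starTangle_str_middle _ _ (by dsimp only; omega), rfl⟩
  reg := by
    rintro ⟨_ | _, x⟩ u v hu hv
    · exact Tangle.comp_reg_some (u' := ⟨2 * n + k, by simp only; omega⟩)
        (idTangle_reg _ _ _ hu) (starTangle_reg_left _ _ rfl hv)
    · exact x.elim
  join := by
    rintro ⟨_ | ⟨_ | _, x⟩, s, hs⟩ ⟨_ | ⟨_ | _, y⟩, t, ht⟩ h
    on_goal 4 =>
      obtain rfl : s = t := h
      simp only at hs ht
      by_cases h : s < 2 * n ∨ 2 * n + k ≤ s
      · exact Tangle.comp_str_some_none (T := starTangle n 0 k 0 n ε h1 h2 h3) (S := pairTangle _ _) (i := false) (x := ())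
          (⟨s, hs⟩ : Fin (2 * (n + k))) (idTangle_str _ _ _ rfl)
          (starTangle_str_left _ _ (by dsimp only; omega))
      · refine (Tangle.comp_str_some (T := starTangle n 0 k 0 n ε h1 h2 h3) (S := pairTangle _ _) (i := false) (x := ())
          (j' := (⟨s, hs⟩ : Fin (2 * (n + k)))) (idTangle_str _ _ _ rfl)).trans ?_
        have e1 := starTangle_str_middle (hm := h1) (hn := h2) (hc := h3) (ε := ε)
          (⟨s, hs⟩ : Fin (2 * (n + k)))
          (⟨2 * n + 2 * k - 1 - s, by omega⟩ : Fin (2 * (0 + k))) (by dsimp only; omega)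
        have e2 := starTangle_str_right (hm := h1) (hn := h2) (hc := h3) (ε := ε)
          (⟨s - 2 * n, by omega⟩ : Fin (2 * (0 + k)))
          (⟨s, ht⟩ : Fin (2 * (n + k))) (by dsimp only; omega)
        rw [e1, Tangle.comp_str_none, ← e2]
        exact Tangle.comp_str_cap (unitTangle_str _ _ _ _ (by dsimp only; omega))
    all_goals first | exact h.elim | exact x.elim

theorem bilin_one_star (P : PlanarAlgebra.{u}) {h1 : 0 ≤ 2 * 0} {h2 : 0 ≤ 2 * n}
    {h3 : n + 0 = 0 + n} (a : P.V ⟨n + k, ε⟩) :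
    P.bilin (starTangle 0 n k 0 n ε h1 h2 h3) (P.one (0 + k) ε) a = a := by
  conv_lhs => rw [← P.Z_id ⟨n + k, ε⟩ a, PlanarAlgebra.one, bilin_Z]
  refine Z_eq_self_of_hasPattern (by simp only; omega) one_star_hasPattern ?_ P a ?_
  · rintro ⟨_ | _, x⟩
    · exact x.elim
    · rfl
  · rintro ⟨_ | _, x⟩
    · exact x.elim
    · rfl

theorem bilin_star_one (P : PlanarAlgebra.{u}) {h1 : 0 ≤ 2 * n} {h2 : 0 ≤ 2 * 0}
    {h3 : n + 0 = n + 0} (a : P.V ⟨n + k, ε⟩) :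
    P.bilin (starTangle n 0 k 0 n ε h1 h2 h3) a (P.one (0 + k) ε) = a := by
  conv_lhs => rw [← P.Z_id ⟨n + k, ε⟩ a, PlanarAlgebra.one, bilin_Z]
  refine Z_eq_self_of_hasPattern (by simp only; omega) star_one_hasPattern ?_ P a ?_
  · rintro ⟨_ | _, x⟩
    · rfl
    · exact x.elim
  · rintro ⟨_ | _, x⟩
    · rfl
    · exact x.elim

end Identity

/-! ### The involution: rotations and mirror images -/

section Involution

variable {m n k i c : ℕ} {ε : Bool}

/-- The box of a composite of tangles with one inner disc. -/
def singleBox : (Σ _ : Unit, Unit) ≃ Unit where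
  toFun _ := ()
  invFun _ := ⟨(), ()⟩
  left_inv _ := rfl
  right_inv _ := rfl

/-- The mirror image of the shift by `2 * n` is the shift by `-2 * n`, so the two cancel. Interval
`0` of the middle circle faces interval `2 * n` of the inner and of the outer one, whence the base.
-/
theorem turn_turn_hasPattern :
    ((turnTangle n k ε).comp (fun _ => (turnTangle n k ε).reflect)).HasPattern singleBox
      idJoin (fun _ => (2 * n, 2 * n)) where
  surj := Tangle.NoCaps.comp_str_surjective (fun _ => turnTangle_noCaps.reflect)
    (fun _ => Tangle.reflect_str_surjective turnTangle_str_surjective) turnTangle_str_surjective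
  reg := by
    rintro ⟨_, _⟩ u v hu hv
    refine Tangle.comp_reg_some (u' := ⟨0, by simp only; omega⟩) ?_
      (turnTangle_reg _ _ (Nat.zero_le _) (hv.trans (Nat.zero_add _).symm))
    simp only at hu
    refine turnTangle_reg (Fin.rev _) (Fin.rev _) ?_ ?_ <;> simp only [Fin.val_rev, hu] <;> omega
  join := by
    rintro ⟨_ | ⟨_, _⟩, s, hs⟩ ⟨_ | ⟨_, _⟩, t, ht⟩ h
    on_goal 3 =>
      obtain rfl : s = t := h
      simp only at hs
      -- The witness on the middle circle is `s - 2 * n` modulo `2 * (n + k)`.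
      refine Tangle.comp_str_some_none (S := fun _ => (turnTangle n k ε).reflect) (i := ())
        (x := ())
        (⟨if s < 2 * n then s + 2 * k else s - 2 * n, by split_ifs <;> omega⟩ :
          Fin (2 * (n + k))) (turnTangle_str (Fin.rev _) (Fin.rev _) ?_)
        (turnTangle_str _ _ ?_)
      · simp only [Fin.val_rev]
        split_ifs <;> omega
      · dsimp only
        split_ifs <;> omega
    all_goals exact h.elim

/-- The boxes of `(a ⋆ b)†`. -/
def involLeftBoxes : (Σ _ : Unit, Bool) ≃ Bool where
  toFun x := x.2
  invFun x := ⟨(), x⟩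
  left_inv _ := rfl
  right_inv _ := rfl

/-- The boxes of `b† ⋆ a†`. -/
def involRightBoxes : (Σ i, pairIdx Unit Unit i) ≃ Bool where
  toFun x := !x.1
  invFun
    | false => ⟨true, ()⟩
    | true => ⟨false, ()⟩
  left_inv := by rintro ⟨_ | _, _⟩ <;> rfl
  right_inv := by rintro (_ | _) <;> rfl

/-- The strings of the mirror image of a product of two boxes, whose distinguished intervals have
been moved to the top right. -/
def involJoin (n k i c : ℕ) : Option Bool → ℕ → Option Bool → ℕ → Prop
  | some false, s, none, t => 2 * k + i ≤ s ∧ t + 2 * i + 2 * k = s + 2 * n ∨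
      s < k ∧ t = s + 2 * c
  | some true, s, none, t => 2 * k ≤ s ∧ s + i < 2 * n + 2 * k ∧ t + 2 * k = s ∨
      k ≤ s ∧ s < 2 * k ∧ t = s + 2 * c
  | some true, s, some false, t => 2 * k ≤ s ∧ 2 * n + 2 * k ≤ s + i ∧
      s + t + 1 = 2 * n + 4 * k ∨ s < k ∧ s + t + 1 = 2 * k
  | _, _, _, _ => False

/-- Clockwise from the top right, a reflected box has `k` points on the right side, `k` on the left
side and then its top, so its bottom is interval `k`. The outer box has the usual numbering from the
top left, with bottom `2 * c + k`; box `true`, labelled by `b`, stands on the left. -/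
theorem involJoin_complete (hm : i ≤ 2 * m) (hn : i ≤ 2 * n) (hc : c + i = m + n) :
    CompletePattern (pairDisc ⟨m + k, ε⟩ ⟨n + k, ε⟩) ⟨c + k, ε⟩ (involJoin n k i c)
      (fun _ => (k, 2 * c + k)) where
  base_fst := by rintro (_ | _) <;> simp only <;> omega
  base_snd := by rintro (_ | _) <;> simp only <;> omega
  join := by
    rintro ⟨_ | _ | _, s, hs⟩ <;> simp only at hs
    · by_cases h1 : s + i < 2 * n ∨ 2 * c + k ≤ s
      · refine ⟨⟨some true, ⟨if s < 2 * c then s + 2 * k else s - 2 * c, ?_⟩⟩, by simp, Or.inr ?_⟩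
        · simp only; split_ifs <;> omega
        · simp only [involJoin]; split_ifs <;> omega
      · refine ⟨⟨some false, ⟨if s < 2 * c then s + 2 * i + 2 * k - 2 * n else s - 2 * c, ?_⟩⟩,
          by simp, Or.inr ?_⟩
        · simp only; split_ifs <;> omega
        · simp only [involJoin]; split_ifs <;> omega
    · by_cases h1 : 2 * k + i ≤ s ∨ s < k
      · refine ⟨⟨none, ⟨if s < k then s + 2 * c else s + 2 * n - 2 * i - 2 * k, ?_⟩⟩, by simp,
          Or.inl ?_⟩
        · simp only; split_ifs <;> omega
        · simp only [involJoin]; split_ifs <;> omega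
      · refine ⟨⟨some true, ⟨if s < 2 * k then 2 * k - 1 - s else 2 * n + 4 * k - 1 - s, ?_⟩⟩,
          by simp, Or.inr ?_⟩
        · simp only; split_ifs <;> omega
        · simp only [involJoin]; split_ifs <;> omega
    · by_cases h1 : k ≤ s ∧ s + i < 2 * n + 2 * k
      · by_cases h2 : s < 2 * k
        · refine ⟨⟨none, ⟨s + 2 * c, ?_⟩⟩, by simp, Or.inl (Or.inr ⟨h1.1, h2, rfl⟩)⟩
          simp only; omega
        · refine ⟨⟨none, ⟨s - 2 * k, ?_⟩⟩, by simp, Or.inl ?_⟩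
          · simp only; omega
          · simp only [involJoin]; omega
      · by_cases h2 : s < 2 * k
        · by_cases h3 : s < k
          · refine ⟨⟨some false, ⟨2 * k - 1 - s, ?_⟩⟩, by simp, Or.inl ?_⟩
            · simp only; omega
            · simp only [involJoin]; omega
          · refine ⟨⟨none, ⟨s + 2 * c, ?_⟩⟩, by simp, Or.inl ?_⟩
            · simp only; omega
            · simp only [involJoin]; omega
        · refine ⟨⟨some false, ⟨2 * n + 4 * k - 1 - s, ?_⟩⟩, by simp, Or.inl ?_⟩
          · simp only; omega
          · simp only [involJoin]; omega

variable {hm : i ≤ 2 * m} {hn : i ≤ 2 * n} {hc : c + i = m + n} {hc' : c + i = n + m}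

/-- Reflection replaces each position by its `Fin.rev`, so the incidences are those of `starTangle`
at reversed positions, followed by the rotation of the outer circle. -/
theorem involLeft_hasPattern :
    ((turnTangle c k ε).comp (fun _ => (starTangle m n k i c ε hm hn hc).reflect)).HasPattern
      involLeftBoxes (involJoin n k i c) (fun _ => (k, 2 * c + k)) where
  surj := Tangle.NoCaps.comp_str_surjective (fun _ => starTangle_noCaps.reflect)
    (fun _ => Tangle.reflect_str_surjective starTangle_str_surjective) turnTangle_str_surjective
  reg := by
    rintro ⟨_, _ | _⟩ u v hu hv <;> simp only at hu hv
    · refine Tangle.comp_reg_some (u' := ⟨k, by simp only; omega⟩)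
        (starTangle_reg_left (hm := hm) (hn := hn) (hc := hc) (Fin.rev _) (Fin.rev _) ?_ ?_) (turnTangle_reg _ _ ?_ ?_) <;>
        simp only [Fin.val_rev, hu, hv] <;> omega
    · refine Tangle.comp_reg_some (u' := ⟨k, by simp only; omega⟩)
        (starTangle_reg_right (hm := hm) (hn := hn) (hc := hc) (Fin.rev _) (Fin.rev _) ?_ ?_) (turnTangle_reg _ _ ?_ ?_) <;>
        simp only [Fin.val_rev, hu, hv] <;> omega
  join := by
    rintro ⟨_ | ⟨_, _ | _⟩, s, hs⟩ ⟨_ | ⟨_, _ | _⟩, t, ht⟩ h <;>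
      simp only [Option.map_some, Option.map_none, involLeftBoxes, Equiv.coe_fn_mk,
        involJoin] at h <;>
      simp only at hs ht
    -- On the circle between the reflected product and the rotation, the outer point `t` corresponds
    -- to `t - 2 * c` modulo `2 * (c + k)`.
    · refine Tangle.comp_str_some_none
        (S := fun _ => (starTangle m n k i c ε hm hn hc).reflect) (i := ()) (x := false)
        (⟨if t < 2 * c then t + 2 * k else t - 2 * c, ?_⟩ : Fin (2 * (c + k)))
        (starTangle_str_left (hm := hm) (hn := hn) (hc := hc) (Fin.rev _) (Fin.rev _) ?_) (turnTangle_str _ _ ?_) <;>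
        (try simp only [Fin.val_rev]) <;> split_ifs <;> omega
    · refine Tangle.comp_str_some_none
        (S := fun _ => (starTangle m n k i c ε hm hn hc).reflect) (i := ()) (x := true)
        (⟨if t < 2 * c then t + 2 * k else t - 2 * c, ?_⟩ : Fin (2 * (c + k)))
        (starTangle_str_right (hm := hm) (hn := hn) (hc := hc) (Fin.rev _) (Fin.rev _) ?_) (turnTangle_str _ _ ?_) <;>
        (try simp only [Fin.val_rev]) <;> split_ifs <;> omega
    · refine Tangle.comp_str_some_eq (S := fun _ => (starTangle m n k i c ε hm hn hc).reflect)
        (starTangle_str_middle (hm := hm) (hn := hn) (hc := hc) (Fin.rev _) (Fin.rev _) ?_).symm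
      simp only [Fin.val_rev]
      omega

/-- Here each factor is rotated by itself, which brings its top points to the front of the numbering
and its bottom from `k` to the place where the product tangle expects it. -/
theorem involRight_hasPattern :
    ((starTangle n m k i c ε hn hm hc').comp
      (pairTangle (turnTangle n k ε) (turnTangle m k ε))).HasPattern
      involRightBoxes (involJoin n k i c) (fun _ => (k, 2 * c + k)) where
  surj := Tangle.NoCaps.comp_str_surjective (pairTangle_noCaps turnTangle_noCaps turnTangle_noCaps)
    (pairTangle_str_surjective turnTangle_str_surjective turnTangle_str_surjective)
    starTangle_str_surjective
  reg := by
    rintro ⟨_ | _, _⟩ u v hu hv <;> simp only at hu hv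
    · exact Tangle.comp_reg_some (u' := ⟨2 * n + k, by simp only; omega⟩)
        (turnTangle_reg _ _ (by omega) (by simp only; omega)) (starTangle_reg_left _ _ rfl hv)
    · exact Tangle.comp_reg_some (u' := ⟨2 * m + k, by simp only; omega⟩)
        (turnTangle_reg _ _ (by omega) (by simp only; omega)) (starTangle_reg_right _ _ rfl hv)
  join := by
    rintro ⟨_ | ⟨_ | _, _⟩, s, hs⟩ ⟨_ | ⟨_ | _, _⟩, t, ht⟩ h <;>
      simp only [Option.map_some, Option.map_none, involRightBoxes, Equiv.coe_fn_mk, Bool.not_true,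
        Bool.not_false, involJoin] at h <;>
      simp only at hs ht
    · refine Tangle.comp_str_some_none (S := pairTangle _ _) (i := false) (x := ())
        (⟨if s < 2 * k then s + 2 * n else s - 2 * k, ?_⟩ : Fin (2 * (n + k)))
        (turnTangle_str _ _ ?_) (starTangle_str_left _ _ ?_) <;>
        (try dsimp only) <;> split_ifs <;> omega
    · refine Tangle.comp_str_some_some (S := pairTangle _ _) (i₁ := false) (x₁ := ())
        (i₂ := true) (x₂ := ())
        (⟨if s < 2 * k then s + 2 * n else s - 2 * k, ?_⟩ : Fin (2 * (n + k)))
        (⟨if t < 2 * k then t + 2 * m else t - 2 * k, ?_⟩ : Fin (2 * (m + k)))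
        (turnTangle_str _ _ ?_) (turnTangle_str _ _ ?_) (starTangle_str_middle _ _ ?_) <;>
        (try dsimp only) <;> split_ifs <;> omega
    · refine Tangle.comp_str_some_none (S := pairTangle _ _) (i := true) (x := ())
        (⟨if s < 2 * k then s + 2 * m else s - 2 * k, ?_⟩ : Fin (2 * (m + k)))
        (turnTangle_str _ _ ?_) (starTangle_str_right _ _ ?_) <;>
        (try dsimp only) <;> split_ifs <;> omega

end Involution

end PlanarTangle

/-! ### The graded algebra -/

namespace SubfactorPlanarAlgebra

variable (P : SubfactorPlanarAlgebra.{u}) (ε : Bool) (k : ℕ)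

theorem involHom_involHom (n : ℕ) (x : P.V ⟨n + k, ε⟩) :
    P.involHom ε k n (P.involHom ε k n x) = x := by
  unfold involHom
  rw [P.invol_Z, P.invol_invol]
  exact (P.Z_comp (turnTangle n k ε) (fun _ => (turnTangle n k ε).reflect)
    (fun _ _ => x)).symm.trans
      (Z_eq_self_of_hasPattern (by simp only; omega) turn_turn_hasPattern (fun _ => rfl)
        P.toPlanarAlgebra x fun _ => HEq.rfl)

/-- A reflection in a vertical line exchanges the two boxes and keeps the `i` nested strings between
their tops; moving the distinguished interval of the product back to the top left amounts to doing
so in each factor. -/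
theorem involHom_bilin {m n i c : ℕ} (hm : i ≤ 2 * m) (hn : i ≤ 2 * n) (hc : c + i = m + n)
    (hc' : c + i = n + m) (a : P.V ⟨m + k, ε⟩) (b : P.V ⟨n + k, ε⟩) :
    P.involHom ε k c (P.bilin (starTangle m n k i c ε hm hn hc) a b) =
      P.bilin (starTangle n m k i c ε hn hm hc') (P.involHom ε k n b) (P.involHom ε k m a) := by
  unfold involHom
  rw [bilin_Z, bilin_apply, P.invol_Z]
  refine (P.Z_comp (turnTangle c k ε) (fun _ => (starTangle m n k i c ε hm hn hc).reflect)
    (fun _ i => P.invol (P.pairVec a b i))).symm.trans ?_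
  refine Z_eq_of_hasPattern (involJoin_complete hm hn hc) involLeft_hasPattern
    involRight_hasPattern ?_ ?_ P.toPlanarAlgebra (P.pairVec (P.invol a) (P.invol b)) ?_ ?_
  · rintro ⟨_, _ | _⟩ <;> rfl
  · rintro ⟨_ | _, _⟩ <;> rfl
  · rintro ⟨_, _ | _⟩ <;> rfl
  · rintro ⟨_ | _, _⟩ <;> rfl

/-- The inclusion of `P_{n,k}` in `Gr_k(P)`. -/
abbrev of (n : ℕ) : P.V ⟨n + k, ε⟩ →ₗ[ℂ] P.Gr ε k :=
  DirectSum.lof ℂ ℕ (fun n => P.V ⟨n + k, ε⟩) n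

/-- The component `(a ⋆ b)_i` in `Gr_k(P)`, zero if there are too few strings. -/
def mulTerm (m n i : ℕ) (a : P.V ⟨m + k, ε⟩) (b : P.V ⟨n + k, ε⟩) : P.Gr ε k :=
  if h : i ≤ 2 * m ∧ i ≤ 2 * n then
    P.of ε k (m + n - i) (P.bilin (starTangle m n k i (m + n - i) ε h.1 h.2 (by omega)) a b)
  else 0

/-- The degree `c` is a variable subject to an equation, so that terms whose degrees are different
expressions of the same number can be compared without a transport between spaces. -/
theorem mulTerm_eq {m n i c : ℕ} (hm : i ≤ 2 * m) (hn : i ≤ 2 * n) (hc : c + i = m + n)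
    (a : P.V ⟨m + k, ε⟩) (b : P.V ⟨n + k, ε⟩) :
    P.mulTerm ε k m n i a b = P.of ε k c (P.bilin (starTangle m n k i c ε hm hn hc) a b) := by
  obtain rfl : c = m + n - i := by omega
  exact dif_pos ⟨hm, hn⟩

theorem mul_of_of (m n : ℕ) (a : P.V ⟨m + k, ε⟩) (b : P.V ⟨n + k, ε⟩) :
    P.mul ε k (P.of ε k m a) (P.of ε k n b) =
      ∑ i ∈ Finset.range (min (2 * m) (2 * n) + 1), P.mulTerm ε k m n i a b := by
  have h : P.mul ε k (P.of ε k m a) (P.of ε k n b) = P.mulHom ε k m n a b := by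
    simp [mul, of]
  rw [h, mulHom, Finset.sum_range]
  simp only [LinearMap.sum_apply, LinearMap.compr₂_apply]
  refine Finset.sum_congr rfl fun i _ => ?_
  rw [P.mulTerm_eq ε k (c := m + n - i) (by omega) (by omega) (by omega)]

theorem of_induction {p : P.Gr ε k → Prop} (zero : p 0) (of : ∀ n x, p (P.of ε k n x))
    (add : ∀ x y, p x → p y → p (x + y)) (x : P.Gr ε k) : p x :=
  DirectSum.induction_on x zero of add

/-- Both sides are double sums over pairs of string numbers, and both amount to sums over the
triples `(x, y, z)` with `z = 0` or `x + y = 2 * n`, seen as `(x, y + z)` on the left and `(y, x +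
z)` on the right. -/
theorem mul_of_assoc (m n l : ℕ) (a : P.V ⟨m + k, ε⟩) (b : P.V ⟨n + k, ε⟩)
    (c : P.V ⟨l + k, ε⟩) :
    P.mul ε k (P.mul ε k (P.of ε k m a) (P.of ε k n b)) (P.of ε k l c) =
      P.mul ε k (P.of ε k m a) (P.mul ε k (P.of ε k n b) (P.of ε k l c)) := by
  -- The conditional makes the summand a function of arbitrary `i` and `j`, which allows the double
  -- sum to be reindexed; its value `0` is never taken on the range of summation.
  have hl (i : ℕ) (hi : i ∈ Finset.range (min (2 * m) (2 * n) + 1)) :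
      P.mul ε k (P.mulTerm ε k m n i a b) (P.of ε k l c) =
        ∑ j ∈ Finset.range (min (2 * (m + n - i)) (2 * l) + 1),
          if h : i ≤ 2 * m ∧ i ≤ 2 * n then P.mulTerm ε k (m + n - i) l j
            (P.bilin (starTangle m n k i (m + n - i) ε h.1 h.2 (by omega)) a b) c else 0 := by
    rw [Finset.mem_range] at hi
    have h : i ≤ 2 * m ∧ i ≤ 2 * n := by omega
    simp only [dif_pos h]
    rw [P.mulTerm_eq ε k (c := m + n - i) h.1 h.2 (by omega), mul_of_of]
  have hr (i : ℕ) (hi : i ∈ Finset.range (min (2 * n) (2 * l) + 1)) :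
      P.mul ε k (P.of ε k m a) (P.mulTerm ε k n l i b c) =
        ∑ j ∈ Finset.range (min (2 * m) (2 * (n + l - i)) + 1),
          if h : i ≤ 2 * n ∧ i ≤ 2 * l then P.mulTerm ε k m (n + l - i) j a
            (P.bilin (starTangle n l k i (n + l - i) ε h.1 h.2 (by omega)) b c) else 0 := by
    rw [Finset.mem_range] at hi
    have h : i ≤ 2 * n ∧ i ≤ 2 * l := by omega
    simp only [dif_pos h]
    rw [P.mulTerm_eq ε k (c := n + l - i) h.1 h.2 (by omega), mul_of_of]
  rw [mul_of_of, mul_of_of, map_sum, LinearMap.sum_apply, map_sum, Finset.sum_congr rfl hl,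
    Finset.sum_congr rfl hr, Finset.sum_sigma', Finset.sum_sigma']
  -- From `(x, j)` with `j = y + z` one recovers `y = min j (2 * n - x)`, since the strings from `c`
  -- use up the free top points of `b` before reaching `a`. The target is `(y, x + z)`, and by
  -- symmetry the same formula is its inverse.
  refine Finset.sum_bij' (fun q _ => ⟨min q.2 (2 * n - q.1), q.1 + (q.2 - min q.2 (2 * n - q.1))⟩)
    (fun q _ => ⟨min q.2 (2 * n - q.1), q.1 + (q.2 - min q.2 (2 * n - q.1))⟩) ?_ ?_ ?_ ?_ ?_ <;>
    rintro ⟨i, j⟩ hij <;> simp only [Finset.mem_sigma, Finset.mem_range] at hij ⊢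
  · omega
  · omega
  · simp only [Sigma.mk.injEq, heq_eq_eq]
    omega
  · simp only [Sigma.mk.injEq, heq_eq_eq]
    omega
  · have h : i ≤ 2 * m ∧ i ≤ 2 * n := by omega
    have h' : min j (2 * n - i) ≤ 2 * n ∧ min j (2 * n - i) ≤ 2 * l := by omega
    rw [dif_pos h, dif_pos h',
      P.mulTerm_eq ε k (c := m + n + l - i - j) (by omega) (by omega) (by omega),
      P.mulTerm_eq ε k (c := m + n + l - i - j) (by omega) (by omega) (by omega)]
    congr 1
    -- Either the minimum is `j`, and then `z = 0`, or it is `2 * n - i`, and then `x + y = 2 * n`.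
    exact bilin_star_assoc (x := i) (y := min j (2 * n - i)) (z := j - min j (2 * n - i))
      P.toPlanarAlgebra (by omega) (by omega) (by omega) rfl a b c

theorem mul_mul_eq (a b c : P.Gr ε k) :
    P.mul ε k (P.mul ε k a b) c = P.mul ε k a (P.mul ε k b c) := by
  induction a using P.of_induction ε k with
  | zero => simp
  | add x y hx hy => simp only [map_add, LinearMap.add_apply, hx, hy]
  | of m a =>
    induction b using P.of_induction ε k with
    | zero => simp
    | add x y hx hy => simp only [map_add, LinearMap.add_apply, hx, hy]
    | of n b =>
      induction c using P.of_induction ε k with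
      | zero => simp
      | add x y hx hy => simp only [map_add, hx, hy]
      | of l c => exact P.mul_of_assoc ε k m n l a b c

theorem grOne_mul (a : P.Gr ε k) : P.mul ε k (P.grOne ε k) a = a := by
  induction a using P.of_induction ε k with
  | zero => simp
  | add x y hx hy => rw [map_add, hx, hy]
  | of n a =>
    refine (P.mul_of_of ε k 0 n _ a).trans ?_
    -- The unit has no top strings, so only the term `i = 0` is present.
    rw [show min (2 * 0) (2 * n) + 1 = 1 by omega, Finset.sum_range_one,
      P.mulTerm_eq ε k (c := n) (by omega) (by omega) (by omega), bilin_one_star]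

theorem mul_grOne (a : P.Gr ε k) : P.mul ε k a (P.grOne ε k) = a := by
  induction a using P.of_induction ε k with
  | zero => simp
  | add x y hx hy => rw [map_add, LinearMap.add_apply, hx, hy]
  | of n a =>
    refine (P.mul_of_of ε k n 0 a _).trans ?_
    rw [show min (2 * n) (2 * 0) + 1 = 1 by omega, Finset.sum_range_one,
      P.mulTerm_eq ε k (c := n) (by omega) (by omega) (by omega), bilin_star_one]

theorem involHom_add (n : ℕ) (x y : P.V ⟨n + k, ε⟩) :
    P.involHom ε k n (x + y) = P.involHom ε k n x + P.involHom ε k n y := by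
  -- A single label is written as an update of the zero family, to which multilinearity in one
  -- coordinate applies.
  have h (z : P.V ⟨n + k, ε⟩) : (fun _ : Unit => z) = Function.update (fun _ => 0) () z := by
    funext i
    simp
  unfold involHom
  rw [P.invol_add, h, MultilinearMap.map_update_add, ← h, ← h]

theorem involHom_smul (n : ℕ) (z : ℂ) (x : P.V ⟨n + k, ε⟩) :
    P.involHom ε k n (z • x) = conj z • P.involHom ε k n x := by
  have h (z : P.V ⟨n + k, ε⟩) : (fun _ : Unit => z) = Function.update (fun _ => 0) () z := by
    funext i
    simp
  unfold involHom
  rw [P.invol_smul, h, MultilinearMap.map_update_smul, ← h]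

theorem grStar_apply (a : P.Gr ε k) (n : ℕ) :
    P.grStar ε k a n = P.involHom ε k n (a n) := by
  unfold grStar
  exact DFinsupp.mapRange_apply _ _ _ _

theorem grStar_add (a b : P.Gr ε k) :
    P.grStar ε k (a + b) = P.grStar ε k a + P.grStar ε k b := by
  refine DFinsupp.ext fun n => ?_
  rw [grStar_apply, DirectSum.add_apply, DirectSum.add_apply, grStar_apply, grStar_apply,
    involHom_add]

theorem grStar_smul (z : ℂ) (a : P.Gr ε k) :
    P.grStar ε k (z • a) = conj z • P.grStar ε k a := by
  refine DFinsupp.ext fun n => ?_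
  rw [grStar_apply, DirectSum.smul_apply, DirectSum.smul_apply, grStar_apply, involHom_smul]

theorem grStar_grStar (a : P.Gr ε k) : P.grStar ε k (P.grStar ε k a) = a := by
  refine DFinsupp.ext fun n => ?_
  rw [grStar_apply, grStar_apply, involHom_involHom]

theorem grStar_zero : P.grStar ε k 0 = 0 := by
  simpa using P.grStar_smul ε k 0 0

theorem grStar_sum {ι : Type} (s : Finset ι) (f : ι → P.Gr ε k) :
    P.grStar ε k (∑ i ∈ s, f i) = ∑ i ∈ s, P.grStar ε k (f i) :=
  map_sum (AddMonoidHom.mk' (P.grStar ε k) (P.grStar_add ε k)) f s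

theorem grStar_of (n : ℕ) (x : P.V ⟨n + k, ε⟩) :
    P.grStar ε k (P.of ε k n x) = P.of ε k n (P.involHom ε k n x) := by
  unfold grStar
  exact DFinsupp.mapRange_single

theorem grStar_mul (a b : P.Gr ε k) :
    P.grStar ε k (P.mul ε k a b) = P.mul ε k (P.grStar ε k b) (P.grStar ε k a) := by
  induction a using P.of_induction ε k with
  | zero => simp [grStar_zero]
  | add x y hx hy => simp only [map_add, LinearMap.add_apply, grStar_add, hx, hy]
  | of m a =>
    induction b using P.of_induction ε k with
    | zero => simp [grStar_zero]
    | add x y hx hy => simp only [map_add, LinearMap.add_apply, grStar_add, hx, hy]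
    | of n b =>
      -- Exchanging the factors keeps the range of `i`, and the involution matches the terms with
      -- the same `i`.
      rw [grStar_of, grStar_of, mul_of_of, mul_of_of, grStar_sum, min_comm]
      refine Finset.sum_congr rfl fun i hi => ?_
      rw [Finset.mem_range] at hi
      rw [P.mulTerm_eq ε k (c := m + n - i) (by omega) (by omega) (by omega),
        P.mulTerm_eq ε k (c := m + n - i) (by omega) (by omega) (by omega), grStar_of,
        involHom_bilin]

end SubfactorPlanarAlgebra

theorem mainTheorem9 (P : SubfactorPlanarAlgebra.{u}) (ε : Bool) (k : ℕ) :
    (∀ a b c : P.Gr ε k, P.mul ε k (P.mul ε k a b) c = P.mul ε k a (P.mul ε k b c)) ∧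
    (∀ a : P.Gr ε k, P.mul ε k (P.grOne ε k) a = a ∧ P.mul ε k a (P.grOne ε k) = a) ∧
    (∀ a b : P.Gr ε k, P.grStar ε k (a + b) = P.grStar ε k a + P.grStar ε k b) ∧
    (∀ (z : ℂ) (a : P.Gr ε k), P.grStar ε k (z • a) = conj z • P.grStar ε k a) ∧
    (∀ a : P.Gr ε k, P.grStar ε k (P.grStar ε k a) = a) ∧
    (∀ a b : P.Gr ε k,
      P.grStar ε k (P.mul ε k a b) = P.mul ε k (P.grStar ε k b) (P.grStar ε k a)) :=
  ⟨P.mul_mul_eq ε k, fun a => ⟨P.grOne_mul ε k a, P.mul_grOne ε k a⟩, P.grStar_add ε k,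
    P.grStar_smul ε k, P.grStar_grStar ε k, P.grStar_mul ε k⟩
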